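/- **Setting.** Let $T>0$, $0=h_0<h_1<\dots<h_N=:h$, let $\mathcal K\subseteq\mathbb R^m$ be a closed convex cone, $A:[0,T]\rightsquigarrow\mathbb R^q$ a set-valued map, $f:[0,T]\times(\mathbb R^n)^{N+1}\times\mathbb R^q\to\mathbb R^n$, $G=(g_{ij}):[0,T]\times\mathbb R^q\to\mathbb R^{n\times m}$ and $\zeta:[-h,0]\to\mathbb R^n$. Let $\ell$ be Lebesgue measure, and let $\mathscr L\times\mathcal B^q$ be the product of the Lebesgue $\sigma$-algebra of $[0,T]$ and the Borel $\sigma$-algebra of $\mathbb R^q$. For an $\mathbb R^l$-valued Borel measure $\mu$ on $[0,T]$ put $|\mu|=\sum_{j}(\mu^j_++\mu^j_-)$ (Jordan decompositions of the components) and $\omega=\frac{d\mu}{d|\mu|}$. A matrix-valued function $\Psi$ is *$\mu$-integrable* if $\Psi\omega$ is $|\mu|$-integrable, and then $\int_B\Psi\,d\mu:=\int_B\Psi\,\omega\,d|\mu|$. We write $\mu_i\rightharpoonup^*\mu$ if $\int_{[0,T]}\varphi\,d\mu_i^j\to\int_{[0,T]}\varphi\,d\mu^j$ for all $\varphi\in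 C([0,T],\mathbb R)$ and all $j$. For a function $x$, $dx$ denotes the (unique, if it exists) vector measure on $[0,T]$ with $x(t)=x(0)+dx([0,t])$ for all $t\in\,]0,T]$. An *impulsive process* is a triple $(\mu,\alpha,x)$ where $\mu$ is a vector measure on the Borel subsets of $[0,T]$ with values in $\mathcal K$; $\alpha:[0,T]\to\mathbb R^q$ is Borel measurable with $\alpha(t)\in A(t)$ for $\ell$-a.e. and $|\mu|$-a.e. $t$; $t\mapsto G(t,\alpha(t))$ is $\mu$-integrable; and $x:[-h,T]\to\mathbb R^n$ is of bounded variation with $x=\zeta$ a.e. on $[-h,0[$ and $$x(t)=x(0)+\int_0^t f\big(s,\{x(s-h_k)\}_{k=0}^N,\alpha(s)\big)\,ds+\int_{[0,t]}G(s,\alpha(s))\,\mu(ds)\qquad\forall t\in\,]0,T],$$ the first integrand being Lebesgue integrable on $[0,T]$. It is a *strict sense process* if moreover $\mu\ll\ell$. **Hypotheses.** - (H1) The graph $\{(t,a):a\in A(t)\}$ is $\mathscr L\times\mathcal B^q$-measurable. - (H2) $\zeta\in L^\infty([-h,0],\mathbb R^n)$; for each $z\in(\mathbb R^n)^{N+1}$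 the map $(t,a)\mapsto f(t,z,a)$ is $\mathscr L\times\mathcal B^q$-measurable; and for each $M>0$ there is a nonnegative $L_M\in L^1([0,T])$ such that for a.e. $t\in[0,T]$, $|f(t,z,a)-f(t,y,a)|\le L_M(t)|z-y|$ whenever $|z|,|y|\le M$ and $a\in A(t)$. - (H3) There is a nonnegative $c\in L^1([0,T])$ such that for a.e. $t\in[0,T]$, $|f(t,z,a)|\le c(t)(1+|z|)$ for all $z\in(\mathbb R^n)^{N+1}$ and $a\in A(t)$. - (H4)$^*$ With $\tilde{\mathcal K}=\{w\in\mathcal K:|w^j|\le1\ \forall j\}$ and $$\mathfrak h(t,a,w)=\frac{w}{1+\sum_{i=1}^n\big|\sum_{j=1}^m g_{ij}(t,a)w^j\big|},\qquad \mathfrak g(t,a,w)=\frac{G(t,a)\,w}{1+\sum_{i=1}^n\big|\sum_{j=1}^m g_{ij}(t,a)w^j\big|},$$ the set-valued map $t\mapsto\overline{\mathrm{co}}\,(\mathfrak h,\mathfrak g)(t,A(t),\tilde{\mathcal K})$ is uniformly bounded and continuous on $[0,T]$ with respect to the Hausdorff metric. - $G$ is $\mathscr L\times\mathcal B^q$-measurable.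 **Proposition (Density).** Under these hypotheses, for every impulsive process $(\bar\mu,\bar\alpha,\bar x)$ there exists a sequence of strict sense processes $(\mu_i,\alpha_i,x_i)_i$ such that $$\mu_i\rightharpoonup^*\bar\mu,\qquad \ell\big(\{t\in[0,T]:\alpha_i(t)=\bar\alpha(t)\}\big)\to T,\qquad dx_i\rightharpoonup^*d\bar x,\qquad x_i(t)\to\bar x(t)\quad\forall t\in\mathcal E,$$ where $\mathcal E\subseteq[0,T]$ is a set of full Lebesgue measure containing $0$ and $T$ (and the measures $dx_i$, $d\bar x$ exist). -/

import Mathlib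

open MeasureTheory Set Filter Topology

noncomputable section

namespace Impulsive

/-! Vectors in `ℝ^l` are functions `Fin l → ℝ`.  The choice of the norm on a finite dimensional
space is immaterial everywhere below: norms occur only in conditions of the form "there is a
constant (or an integrable function) such that ...", in boundedness, convergence and bounded
variation statements. -/

/-! ### Measures on `[0,T]` -/

/-- Lebesgue measure on `[0,T]`. -/
def leb (T : ℝ) : Measure (Icc 0 T) := Measure.comap Subtype.val volume

/-- The `j`-th component of a vector measure with values in `ℝ^l`. -/
def comp {T : ℝ} {l : ℕ} (μ : VectorMeasure (Icc 0 T) (Fin l → ℝ)) (j : Fin l) :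
    SignedMeasure (Icc 0 T) :=
  μ.mapRange (Pi.evalAddMonoidHom (fun _ : Fin l => ℝ) j) (continuous_apply j)

/-- The total variation measure `|μ| = ∑ j, (μ^j_+ + μ^j_-)`, from the Jordan decompositions of
the components. -/
def totalVar {T : ℝ} {l : ℕ} (μ : VectorMeasure (Icc 0 T) (Fin l → ℝ)) : Measure (Icc 0 T) :=
  ∑ j, (comp μ j).totalVariation

/-- The Radon-Nikodym derivative `ω = dμ/d|μ|`, componentwise. -/
def density {T : ℝ} {l : ℕ} (μ : VectorMeasure (Icc 0 T) (Fin l → ℝ)) (t : Icc 0 T) :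
    Fin l → ℝ :=
  fun j => (comp μ j).rnDeriv (totalVar μ) t

/-- A matrix-valued function `Ψ` is `μ`-integrable if `Ψ ω` is `|μ|`-integrable, where
`ω = dμ/d|μ|` (a vector-valued function is integrable iff each of its components is). -/
def IntegrableAgainst {T : ℝ} {n m : ℕ} (Ψ : Icc 0 T → Matrix (Fin n) (Fin m) ℝ)
    (μ : VectorMeasure (Icc 0 T) (Fin m → ℝ)) : Prop :=
  Integrable (fun s => (Ψ s).mulVec (density μ s)) (totalVar μ)

/-- `∫_B Ψ(s) μ(ds) = ∫_B Ψ(s) ω(s) |μ|(ds)`, where `ω = dμ/d|μ|`. -/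
def integralAgainst {T : ℝ} {n m : ℕ} (B : Set (Icc 0 T)) (Ψ : Icc 0 T → Matrix (Fin n) (Fin m) ℝ)
    (μ : VectorMeasure (Icc 0 T) (Fin m → ℝ)) : Fin n → ℝ :=
  ∫ s in B, (Ψ s).mulVec (density μ s) ∂(totalVar μ)

/-- The integral of a (continuous) scalar function with respect to a signed measure. -/
def signedIntegral {T : ℝ} (φ : Icc 0 T → ℝ) (s : SignedMeasure (Icc 0 T)) : ℝ :=
  ∫ t, φ t ∂s.toJordanDecomposition.posPart - ∫ t, φ t ∂s.toJordanDecomposition.negPart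

/-- Weak* convergence `μ_i ⇀* μ`: convergence of the integrals of all continuous functions on
`[0,T]` against all components. -/
def WeakStar {T : ℝ} {l : ℕ} (μs : ℕ → VectorMeasure (Icc 0 T) (Fin l → ℝ))
    (μ : VectorMeasure (Icc 0 T) (Fin l → ℝ)) : Prop :=
  ∀ (φ : C(Icc 0 T, ℝ)) (j : Fin l),
    Tendsto (fun i => signedIntegral φ (comp (μs i) j)) atTop (𝓝 (signedIntegral φ (comp μ j)))

/-- `dx = ν` on `[0,T]`: `x(t) = x(0) + ν([0,t])` for all `t ∈ ]0,T]`.  There is at most one such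
measure `ν`; its mass at `0` is the jump `x(0+) - x(0)`. -/
def IsDifferential {T : ℝ} {n : ℕ} (x : ℝ → Fin n → ℝ)
    (ν : VectorMeasure (Icc 0 T) (Fin n → ℝ)) : Prop :=
  ∀ t : Icc 0 T, 0 < (t : ℝ) → x t = x 0 + ν (Iic t)

/-! ### Delayed impulsive control systems -/

/-- The data of a delayed impulsive control system
`dx(t) = f(t, x(t - h 0), …, x(t - h N), α(t)) dt + G(t, α(t)) μ(dt)` on `[0,T]`,
`x = ζ` a.e. on `[-h N, 0[`, with `α(t) ∈ A(t)` and with `K`-valued measures `μ`. -/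
structure ImpulsiveSystem (n m q N : ℕ) where
  T : ℝ
  T_pos : 0 < T
  h : Fin (N + 1) → ℝ
  h_zero : h 0 = 0
  h_strictMono : StrictMono h
  f : Icc 0 T → (Fin (N + 1) → Fin n → ℝ) → (Fin q → ℝ) → Fin n → ℝ
  G : Icc 0 T → (Fin q → ℝ) → Matrix (Fin n) (Fin m) ℝ
  A : Icc 0 T → Set (Fin q → ℝ)
  /-- the history; only its values on `[-h N, 0]` matter -/
  ζ : ℝ → Fin n → ℝ
  K : Set (Fin m → ℝ)
  K_closed : IsClosed K
  K_convex : Convex ℝ K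
  K_cone : ∀ w ∈ K, ∀ r : ℝ, 0 < r → r • w ∈ K

namespace ImpulsiveSystem

variable {n m q N : ℕ} (S : ImpulsiveSystem n m q N)

/-- The time interval `[0,T]`. -/
abbrev I : Type := Icc (0 : ℝ) S.T

/-- `[0,T]` with the `σ`-algebra of its Lebesgue measurable subsets. -/
abbrev LebesgueI : Type := NullMeasurableSpace S.I (leb S.T)

/-- The largest delay. -/
def hmax : ℝ := S.h (Fin.last N)

/-- `(x(t - h 0), …, x(t - h N))`. -/
def delayed (x : ℝ → Fin n → ℝ) (t : S.I) : Fin (N + 1) → Fin n → ℝ :=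
  fun k => x ((t : ℝ) - S.h k)

/-! #### Hypotheses on the data -/

/-- The graph of `A` is Lebesgue × Borel measurable. -/
def MeasurableGraph : Prop :=
  MeasurableSet {p : S.LebesgueI × (Fin q → ℝ) | p.2 ∈ S.A p.1}

/-- `ζ ∈ L^∞`; `f` is Lebesgue × Borel measurable in `(t,a)`, and locally Lipschitz in the
delayed states, with integrable Lipschitz constants. -/
def LipschitzDrift : Prop :=
  MemLp S.ζ ⊤ (volume.restrict (Icc (-S.hmax) 0)) ∧
  (∀ z, Measurable (fun p : S.LebesgueI × (Fin q → ℝ) => S.f p.1 z p.2)) ∧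
  ∀ M : ℝ, 0 < M → ∃ L : S.I → ℝ, Integrable L (leb S.T) ∧ (∀ t, 0 ≤ L t) ∧
    ∀ᵐ t ∂leb S.T, ∀ z y, ‖z‖ ≤ M → ‖y‖ ≤ M → ∀ a ∈ S.A t,
      ‖S.f t z a - S.f t y a‖ ≤ L t * ‖z - y‖

/-- Linear growth of `f`, with integrable constant. -/
def LinearGrowth : Prop :=
  ∃ c : S.I → ℝ, Integrable c (leb S.T) ∧ (∀ t, 0 ≤ c t) ∧
    ∀ᵐ t ∂leb S.T, ∀ z, ∀ a ∈ S.A t, ‖S.f t z a‖ ≤ c t * (1 + ‖z‖)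

/-- The fast dynamics `G` is Lebesgue × Borel measurable in `(t,a)`. -/
def MeasurableFastDynamics : Prop :=
  ∀ i j, Measurable (fun p : S.LebesgueI × (Fin q → ℝ) => S.G p.1 p.2 i j)

/-- `K̃ = {w ∈ K : |w^j| ≤ 1 for all j}`. -/
def Ktilde : Set (Fin m → ℝ) := {w | w ∈ S.K ∧ ∀ j, |w j| ≤ 1}

/-- The normalizing factor `1 + ∑ i, |∑ j, g_ij(t,a) w^j|`. -/
def norming (t : S.I) (a : Fin q → ℝ) (w : Fin m → ℝ) : ℝ :=
  1 + ∑ i, |∑ j, S.G t a i j * w j|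

/-- `𝔤(t,a,w) = G(t,a) w / (1 + ∑ i, |∑ j, g_ij(t,a) w^j|)`. -/
def gfrak (t : S.I) (a : Fin q → ℝ) (w : Fin m → ℝ) : Fin n → ℝ :=
  (S.norming t a w)⁻¹ • (S.G t a).mulVec w

/-- `𝔥(t,a,w) = w / (1 + ∑ i, |∑ j, g_ij(t,a) w^j|)`. -/
def hfrak (t : S.I) (a : Fin q → ℝ) (w : Fin m → ℝ) : Fin m → ℝ :=
  (S.norming t a w)⁻¹ • w

/-- The closed convex hull of `(𝔥,𝔤)(t, A(t), K̃)`. -/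
def hull (t : S.I) : Set ((Fin m → ℝ) × (Fin n → ℝ)) :=
  closure (convexHull ℝ {v | ∃ a ∈ S.A t, ∃ w ∈ S.Ktilde, v = (S.hfrak t a w, S.gfrak t a w)})

/-- `t ↦ hull t` is uniformly bounded and continuous with respect to the Hausdorff metric. -/
def ContinuousHull : Prop :=
  (∃ R : ℝ, ∀ t, ∀ v ∈ S.hull t, ‖v‖ ≤ R) ∧
  ∀ t, Tendsto (fun s => Metric.hausdorffEDist (S.hull s) (S.hull t)) (𝓝 t) (𝓝 0)

/-! #### Controls and processes -/

/-- `(μ,α)` is an impulsive control: `μ` is a vector measure with range in `K`, `α` is Borel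
measurable with `α(t) ∈ A(t)` a.e. and `μ`-a.e., and `t ↦ G(t, α(t))` is `μ`-integrable.
(Vector measures are finite, and finite Borel measures on `[0,T]` are regular.) -/
def IsControl (μ : VectorMeasure S.I (Fin m → ℝ)) (α : S.I → Fin q → ℝ) : Prop :=
  (∀ B, MeasurableSet B → μ B ∈ S.K) ∧
  Measurable α ∧
  (∀ᵐ t ∂leb S.T, α t ∈ S.A t) ∧
  (∀ᵐ t ∂(totalVar μ), α t ∈ S.A t) ∧
  IntegrableAgainst (fun t => S.G t (α t)) μ

/-- `(μ,α,x)` is an impulsive process: `(μ,α)` is an impulsive control, and `x` is a function of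
bounded variation on `[-h N, T]` which solves the integral equation on `]0,T]` and agrees with
the history `ζ` a.e. on `[-h N, 0[`. -/
def IsImpulsiveTriple (μ : VectorMeasure S.I (Fin m → ℝ)) (α : S.I → Fin q → ℝ)
    (x : ℝ → Fin n → ℝ) : Prop :=
  S.IsControl μ α ∧
  BoundedVariationOn x (Icc (-S.hmax) S.T) ∧
  Integrable (fun s => S.f s (S.delayed x s) (α s)) (leb S.T) ∧
  (∀ t : S.I, 0 < (t : ℝ) →
    x t = x 0 + (∫ s in Iic t, S.f s (S.delayed x s) (α s) ∂(leb S.T))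
      + integralAgainst (Iic t) (fun s => S.G s (α s)) μ) ∧
  ∀ᵐ t ∂(volume.restrict (Ico (-S.hmax) 0)), x t = S.ζ t

/-- A strict sense process is an impulsive process with `μ` absolutely continuous with respect
to Lebesgue measure. -/
def IsStrictSenseTriple (μ : VectorMeasure S.I (Fin m → ℝ)) (α : S.I → Fin q → ℝ)
    (x : ℝ → Fin n → ℝ) : Prop :=
  S.IsImpulsiveTriple μ α x ∧ totalVar μ ≪ leb S.T

end ImpulsiveSystem

end Impulsive

end

/-! The first reduction normalises the control. Multiplying `|μ|` by a suitable integrable weight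
gives a finite measure `θ` for which the pair `(μ, G μ)` is `v θ`, with `v t` in the bounded convex
set `S.hull t` (`IsControl.exists_density`). From then on `μ` and `G μ` are approximated together,
as one vector measure.

The core is `exists_absolutelyContinuous_approx`. On a short cell, Hausdorff continuity makes the
hull nearly constant, so the `θ`-average of `v` over the cell is close to `S.hull s` for every `s`
in the cell. It is therefore close to a convex combination of finitely many net points, each of
which is nearly a value `(𝔥, 𝔤)(s, a, w)` for a set of `s` of positive Lebesgue measure
(`exists_convexCombination`). Measurable selection realises these values by controls on parts of
those sets. The parts may be shrunk until they are disjoint and of total length at most `ε`, since a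
large density restores the required mass. As `𝔤 = G 𝔥`, the first component `u` of the density
carries `G u` as second component, and `α` changes only on the small set. Cellwise agreement of
integrals together with a uniform mass bound gives weak* convergence of `u ds` and `G u ds`, and
convergence of the integrals over `[0,t]` unless `θ` has an atom at `t`
(`CellApprox.norm_integral_sub_le`).

For the trajectories, the delay equation with an absolutely continuous control is solved by a
contraction in a Bielecki norm, and linear growth bounds all solutions uniformly
(`exists_delay_solution`, `norm_delay_solution_le`, `exists_strictSenseTriple`). The difference of
an approximate and the given trajectory is the primitive of the drift difference plus an error from
the `G` terms, which tends to zero off the atoms of `θ`. Only countably many times `s` have some `s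
- h k` at an atom, so the error tends to zero almost everywhere in every delayed argument. A
Gronwall argument then makes the drift difference small in `L¹` (`integral_norm_le_of_delay`,
`tendsto_integral_norm_drift_sub`), which yields the weak* convergence of the differentials and the
pointwise convergence off the atoms. At `0` the initial values agree, and at `T` the test function
`1` replaces the missing continuity. -/

noncomputable section

namespace Impulsive

/-! ### Measurable selections on sets of positive measure -/

/-- Analytic sets of positive outer measure contain compact images of positive measure. -/
theorem exists_isCompact_image_ne_zero {X : Type*} [TopologicalSpace X] [MeasurableSpace X]
    (μ : Measure X) [μ.OuterRegular] {g : (ℕ → ℕ) → X} (hg : Continuous g)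
    (h : μ (range g) ≠ 0) : ∃ C : Set (ℕ → ℕ), IsCompact C ∧ μ (g '' C) ≠ 0 := by
  obtain ⟨c, hc0, hc⟩ := exists_between (pos_iff_ne_zero.2 h)
  have step : ∀ (S : {S : Set (ℕ → ℕ) // c < μ (g '' S)}) (k : ℕ),
      ∃ m : ℕ, c < μ (g '' (S.1 ∩ {y | y k ≤ m})) := by
    rintro ⟨S, hS⟩ k
    have hmono : Monotone fun m : ℕ => g '' (S ∩ {y | y k ≤ m}) := fun a b hab =>
      image_mono (inter_subset_inter_right _ fun y hy => le_trans hy hab)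
    have hU : g '' S = ⋃ m : ℕ, g '' (S ∩ {y | y k ≤ m}) := by
      rw [← image_iUnion, ← inter_iUnion]
      congr 1
      refine (inter_eq_left.2 fun y _ => ?_).symm
      exact mem_iUnion.2 ⟨y k, le_refl (y k)⟩
    simp only at hS ⊢
    -- Continuity from below holds for increasing unions of arbitrary sets, so the images need not
    -- be measurable.
    rw [hU, hmono.measure_iUnion] at hS
    exact lt_iSup_iff.1 hS
  choose b hb using step
  let Ts : ℕ → {S : Set (ℕ → ℕ) // c < μ (g '' S)} := fun k =>
    Nat.rec ⟨univ, by simpa using hc⟩ (fun k S => ⟨S.1 ∩ {y | y k ≤ b S k}, hb S k⟩) k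
  let z : ℕ → ℕ := fun k => b (Ts k) k
  have hTs : ∀ k, (Ts k).1 = {y | ∀ i < k, y i ≤ z i} := by
    intro k
    induction k with
    | zero => simp [Ts]
    | succ k ih =>
      have : (Ts (k + 1)).1 = (Ts k).1 ∩ {y | y k ≤ z k} := rfl
      rw [this, ih]
      ext y
      simp only [mem_inter_iff, mem_ofPred_eq, Nat.lt_succ_iff_lt_or_eq]
      constructor
      · rintro ⟨h1, h2⟩ i (hi | rfl)
        · exact h1 i hi
        · exact h2
      · intro h
        exact ⟨fun i hi => h i (Or.inl hi), h k (Or.inr rfl)⟩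
  have hC : IsCompact (univ.pi fun i => Iic (z i)) :=
    isCompact_univ_pi fun i => (finite_Iic (z i)).isCompact
  refine ⟨_, hC, ?_⟩
  intro h0
  -- The image of the limit box may be smaller than the intersection of the images of the sets `Ts
  -- k`. Outer regularity bridges this: an open `U` of measure below `c` around the image of the box
  -- cannot contain any `g '' (Ts k).1`.
  obtain ⟨U, hCU, hU, hUc⟩ := Set.exists_isOpen_lt_of_lt (μ := μ) (g '' univ.pi fun i => Iic (z i)) c
    (by rw [h0]; exact hc0)
  by_cases hex : ∃ k, g '' (Ts k).1 ⊆ U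
  · obtain ⟨k, hk⟩ := hex
    exact absurd (measure_mono hk) (not_le.2 (hUc.trans (Ts k).2))
  push Not at hex
  have : ∀ k, ∃ y, (∀ i < k, y i ≤ z i) ∧ g y ∉ U := by
    intro k
    obtain ⟨_, ⟨y, hy, rfl⟩, hyU⟩ := not_subset.1 (hex k)
    rw [hTs] at hy
    exact ⟨y, hy, hyU⟩
  choose y hy hyU using this
  -- Truncation moves `y k` into the compact box without changing its first `k` coordinates, so the
  -- truncated and the original subsequence have the same limit.
  obtain ⟨w, hw, φ, hφ, hlim⟩ := hC.tendsto_subseq (x := fun k i => min (y k i) (z i))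
    (fun k i _ => mem_Iic.2 (min_le_right _ _))
  have hlim2 : Tendsto (fun k => y (φ k)) atTop (𝓝 w) := by
    rw [tendsto_pi_nhds] at hlim ⊢
    intro i
    refine (hlim i).congr' ?_
    filter_upwards [hφ.tendsto_atTop.eventually_gt_atTop i] with k hk
    exact min_eq_left (hy _ i hk)
  have hmem : g w ∈ Uᶜ := hU.isClosed_compl.mem_of_tendsto
    ((hg.tendsto w).comp hlim2) (Eventually.of_forall fun k => hyU _)
  exact hmem (hCU ⟨w, hw, rfl⟩)

/-- A compact subset of a product has a Borel measurable section over its projection. -/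
theorem _root_.IsCompact.exists_measurable_section {X Y : Type*} [MetricSpace X]
    [MeasurableSpace X] [BorelSpace X] [MetricSpace Y] [MeasurableSpace Y] [BorelSpace Y]
    {K : Set (X × Y)} (hK : IsCompact K) (hne : K.Nonempty) :
    ∃ τ : X → Y, Measurable τ ∧ ∀ x ∈ Prod.fst '' K, (x, τ x) ∈ K := by
  have := hne.to_subtype
  have := isCompact_iff_compactSpace.1 hK
  obtain ⟨p0, hp0c, hp0s⟩ := exists_nat_bool_continuous_surjective_of_compact K
  let p : cantorSet → X × Y := fun c => (p0 (cantorSetHomeomorphNatToBool c)).1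
  have hp : Continuous p :=
    continuous_subtype_val.comp (hp0c.comp cantorSetHomeomorphNatToBool.continuous)
  have hpK : ∀ c, p c ∈ K := fun c => (p0 _).2
  have hps : ∀ v ∈ K, ∃ c, p c = v := by
    intro v hv
    obtain ⟨b, hb⟩ := hp0s ⟨v, hv⟩
    exact ⟨cantorSetHomeomorphNatToBool.symm b, by simp [p, hb]⟩
  have hcomp : CompactSpace cantorSet := isCompact_iff_compactSpace.1 isCompact_cantorSet
  -- `K` is a continuous image of the Cantor set, whose order selects a parameter: the section at
  -- `x` uses the least parameter in the fibre over `x`.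
  let R : X → Set ℝ := fun x => Subtype.val '' {c : cantorSet | (p c).1 = x}
  have hRc : ∀ x, IsCompact (R x) := fun x =>
    ((isClosed_singleton.preimage (continuous_fst.comp hp)).isCompact).image
      continuous_subtype_val
  have hRne : ∀ x ∈ Prod.fst '' K, (R x).Nonempty := by
    rintro _ ⟨v, hv, rfl⟩
    obtain ⟨c, rfl⟩ := hps v hv
    exact ⟨c, c, rfl, rfl⟩
  have hRe : ∀ x ∉ Prod.fst '' K, R x = ∅ := by
    intro x hx
    by_contra hne
    obtain ⟨_, c, hc, rfl⟩ := nonempty_iff_ne_empty.2 hne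
    exact hx ⟨p c, hpK c, hc⟩
  have hF : IsClosed (Prod.fst '' K) := (hK.image continuous_fst).isClosed
  let σ : X → ℝ := fun x => sInf (R x)
  have hσm : Measurable σ := by
    refine measurable_of_Iic fun r => ?_
    -- Over the projection of `K` a sublevel set of `σ` is the image of a compact set of parameters.
    -- Elsewhere `σ = 0`, because `sInf ∅ = 0`, which conveniently is a point of the Cantor set.
    have : σ ⁻¹' Iic r = ((fun c => (p c).1) '' {c : cantorSet | (c : ℝ) ≤ r}) ∪
        ({x | x ∉ Prod.fst '' K} ∩ {_x | (0 : ℝ) ≤ r}) := by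
      ext x
      by_cases hx : x ∈ Prod.fst '' K
      · simp only [mem_preimage, mem_Iic, mem_union, mem_inter_iff, mem_ofPred_eq, hx,
          not_true_eq_false, false_and, or_false]
        constructor
        · intro h
          obtain ⟨c, hc, hc'⟩ := (hRc x).sInf_mem (hRne x hx)
          exact ⟨c, by rw [mem_ofPred_eq, hc']; exact h, hc⟩
        · rintro ⟨c, hc, rfl⟩
          exact (csInf_le (hRc _).bddBelow ⟨c, rfl, rfl⟩).trans hc
      · have hnot : x ∉ (fun c => (p c).1) '' {c : cantorSet | (c : ℝ) ≤ r} := by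
          rintro ⟨c, _, rfl⟩
          exact hx ⟨p c, hpK c, rfl⟩
        simp only [mem_preimage, mem_Iic, mem_union, hnot, false_or, mem_inter_iff, mem_ofPred_eq,
          hx, not_false_eq_true, true_and, σ, hRe x hx, Real.sInf_empty]
    rw [this]
    refine MeasurableSet.union ?_ (hF.measurableSet.compl.inter (MeasurableSet.const _))
    refine IsClosed.measurableSet (IsCompact.isClosed ?_)
    refine IsCompact.image (IsClosed.isCompact ?_) (continuous_fst.comp hp)
    exact isClosed_le continuous_subtype_val continuous_const
  have hσmem : ∀ x, σ x ∈ cantorSet := by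
    intro x
    by_cases hx : x ∈ Prod.fst '' K
    · obtain ⟨c, _, hc'⟩ := (hRc x).sInf_mem (hRne x hx)
      simp only [σ, ← hc', c.2]
    · simp only [σ, hRe x hx, Real.sInf_empty, zero_mem_cantorSet]
  refine ⟨fun x => (p ⟨σ x, hσmem x⟩).2,
    (continuous_snd.comp hp).measurable.comp (hσm.subtype_mk), fun x hx => ?_⟩
  obtain ⟨c, hc, hc'⟩ := (hRc x).sInf_mem (hRne x hx)
  have : (⟨σ x, hσmem x⟩ : cantorSet) = c := Subtype.ext hc'.symm
  simp only [this]
  have h2 : (x, (p c).2) = p c := Prod.ext hc.symm rfl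
  rw [h2]
  exact hpK c

/-- A `Lebesgue × Borel` measurable set is Borel up to a null set of the first coordinates. -/
theorem exists_measurableSet_prod_of_nullMeasurableSpace {X Y : Type*} [MeasurableSpace X]
    [MeasurableSpace Y] {μ : Measure X} {D : Set (X × Y)}
    (hD : MeasurableSet (α := NullMeasurableSpace X μ × Y) D) :
    ∃ D' : Set (X × Y), MeasurableSet D' ∧ ∃ Z : Set X, MeasurableSet Z ∧ μ Z = 0 ∧
      ∀ x ∉ Z, ∀ y : Y, (x, y) ∈ D ↔ (x, y) ∈ D' := by
  -- The good sets form a `σ`-algebra: the exceptional null set must not depend on `y`, and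
  -- countable unions preserve this.
  let M : MeasurableSpace (NullMeasurableSpace X μ × Y) :=
    { MeasurableSet' := fun D : Set (X × Y) => ∃ D' : Set (X × Y), MeasurableSet D' ∧
        ∃ Z : Set X, MeasurableSet Z ∧ μ Z = 0 ∧
        ∀ x ∉ Z, ∀ y : Y, (x, y) ∈ D ↔ (x, y) ∈ D'
      measurableSet_empty := ⟨∅, .empty, ∅, .empty, measure_empty, fun _ _ _ => Iff.rfl⟩
      measurableSet_compl := by
        rintro D ⟨D', hD', Z, hZ, hZ0, h⟩
        exact ⟨D'ᶜ, hD'.compl, Z, hZ, hZ0, fun x hx y => not_congr (h x hx y)⟩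
      measurableSet_iUnion := by
        intro D h
        choose D' hD' Z hZ hZ0 h using h
        refine ⟨⋃ i, D' i, .iUnion hD', ⋃ i, Z i, .iUnion hZ, measure_iUnion_null hZ0, ?_⟩
        intro x hx y
        simp only [mem_iUnion, not_exists] at hx ⊢
        exact mem_iUnion.trans (exists_congr fun i => h i x (hx i) y) }
  have hle : Prod.instMeasurableSpace ≤ M := by
    refine sup_le (α := MeasurableSpace (NullMeasurableSpace X μ × Y)) ?_ ?_
    · rintro _ ⟨A, hA, rfl⟩
      have hA' : NullMeasurableSet (α := X) A μ := hA
      obtain ⟨A', hA', hAA⟩ := hA'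
      obtain ⟨Z, hZsub, hZ, hZ0⟩ := exists_measurable_superset_of_null (ae_iff.1 hAA)
      refine ⟨Prod.fst ⁻¹' A', measurable_fst hA', Z, hZ, hZ0, fun x hx y => ?_⟩
      have : ¬¬ (A x = A' x) := fun hne => hx (hZsub hne)
      rw [not_not] at this
      change A x ↔ A' x
      rw [this]
    · rintro _ ⟨B, hB, rfl⟩
      exact ⟨Prod.snd ⁻¹' B, measurable_snd hB, ∅, .empty, measure_empty, fun _ _ _ => Iff.rfl⟩
  exact hle _ hD

/-- **Measurable selection** from a `Lebesgue × Borel` measurable set, on a set of positive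
measure. -/
theorem exists_measurable_selection {X Y : Type*} [MetricSpace X] [PolishSpace X]
    [MeasurableSpace X] [BorelSpace X] [MetricSpace Y] [PolishSpace Y] [MeasurableSpace Y]
    [BorelSpace Y] {μ : Measure X} [IsFiniteMeasure μ] {D : Set (X × Y)}
    (hD : MeasurableSet (α := NullMeasurableSpace X μ × Y) D)
    (h : μ {x : X | ∃ y : Y, (x, y) ∈ D} ≠ 0) :
    ∃ F : Set X, MeasurableSet F ∧ μ F ≠ 0 ∧ ∃ τ : X → Y, Measurable τ ∧
      ∀ x ∈ F, (x, τ x) ∈ D := by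
  obtain ⟨D', hD', Z, hZ, hZ0, hDD⟩ := exists_measurableSet_prod_of_nullMeasurableSpace hD
  have hE : MeasurableSet (D' ∩ (Prod.fst ⁻¹' Zᶜ)) := hD'.inter (measurable_fst hZ.compl)
  have hpos : μ (Prod.fst '' (D' ∩ (Prod.fst ⁻¹' Zᶜ))) ≠ 0 := by
    intro h0
    refine h (measure_mono_null (t := Prod.fst '' (D' ∩ (Prod.fst ⁻¹' Zᶜ)) ∪ Z) ?_
      (measure_union_null h0 hZ0))
    rintro x ⟨y, hy⟩
    by_cases hx : x ∈ Z
    · exact Or.inr hx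
    · exact Or.inl ⟨(x, y), ⟨(hDD x hx y).1 hy, hx⟩, rfl⟩
  -- A Borel set in a Polish space is a continuous image of `ℕ → ℕ`. Passing to a compact set of
  -- parameters keeps positive measure of the projection and allows a Borel section.
  have han := hE.analyticSet
  rw [AnalyticSet] at han
  rcases han with h0 | ⟨f, hf, hfr⟩
  · rw [h0] at hpos
    simp at hpos
  rw [← hfr, ← range_comp] at hpos
  obtain ⟨C, hC, hCpos⟩ := exists_isCompact_image_ne_zero μ (continuous_fst.comp hf) hpos
  have hCne : C.Nonempty := by
    rw [nonempty_iff_ne_empty]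
    rintro rfl
    simp at hCpos
  obtain ⟨τ, hτ, hsec⟩ := (hC.image hf).exists_measurable_section (hCne.image f)
  rw [image_comp] at hCpos
  refine ⟨_, ((hC.image hf).image continuous_fst).isClosed.measurableSet, hCpos, τ, hτ, ?_⟩
  intro x hx
  obtain ⟨y, _, hy⟩ := hsec x hx
  have : (x, τ x) ∈ D' ∩ (Prod.fst ⁻¹' Zᶜ) := by
    rw [← hfr, ← hy]
    exact mem_range_self y
  exact (hDD x this.2 _).2 this.1

/-! ### Signed and vector measures with a density -/

instance leb_isFiniteMeasure (T : ℝ) : IsFiniteMeasure (leb T) := by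
  refine ⟨?_⟩
  rw [leb, Measure.comap_apply _ Subtype.val_injective
    (fun s hs => measurableSet_Icc.subtype_image hs) _ MeasurableSet.univ, image_univ,
    Subtype.range_coe]
  exact measure_Icc_lt_top

/-- The integral against a difference of two finite measures. -/
theorem signedIntegral_toSignedMeasure_sub {T : ℝ} (φ : C(Icc 0 T, ℝ)) (p q : Measure (Icc 0 T))
    [IsFiniteMeasure p] [IsFiniteMeasure q] :
    signedIntegral φ (p.toSignedMeasure - q.toSignedMeasure) = ∫ t, φ t ∂p - ∫ t, φ t ∂q := by
  set s := p.toSignedMeasure - q.toSignedMeasure with hs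
  have hint : ∀ (μ : Measure (Icc 0 T)) [IsFiniteMeasure μ], Integrable φ μ := fun μ _ =>
    φ.continuous.integrable_of_hasCompactSupport (HasCompactSupport.of_compactSpace φ)
  -- Two decompositions of the same signed measure satisfy `pos + q = neg + p`, an identity of
  -- positive measures that can be integrated.
  have key : s.toJordanDecomposition.posPart + q = s.toJordanDecomposition.negPart + p := by
    ext B hB
    rw [← ENNReal.toReal_eq_toReal_iff' (measure_ne_top _ _) (measure_ne_top _ _)]
    change (s.toJordanDecomposition.posPart + q).real B
      = (s.toJordanDecomposition.negPart + p).real B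
    rw [measureReal_add_apply, measureReal_add_apply]
    have h1 := s.apply_eq_posPart_real_sub_negPart_real hB
    have h2 : s B = p.real B - q.real B := by
      rw [hs, Measure.toSignedMeasure_sub_apply hB]
    linarith
  have h := congrArg (fun μ : Measure (Icc 0 T) => ∫ t, φ t ∂μ) key
  beta_reduce at h
  rw [integral_add_measure (hint _) (hint _), integral_add_measure (hint _) (hint _)] at h
  rw [signedIntegral]
  linarith

/-- The Jordan decomposition is not additive, but `signedIntegral` sees only the difference of the
two measures, so the sums of the positive and of the negative parts serve equally well. -/
theorem signedIntegral_add {T : ℝ} (φ : C(Icc 0 T, ℝ)) (s s' : SignedMeasure (Icc 0 T)) :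
    signedIntegral φ (s + s') = signedIntegral φ s + signedIntegral φ s' := by
  have hint : ∀ (μ : Measure (Icc 0 T)) [IsFiniteMeasure μ], Integrable φ μ := fun μ _ =>
    φ.continuous.integrable_of_hasCompactSupport (HasCompactSupport.of_compactSpace φ)
  have h : s + s' = (s.toJordanDecomposition.posPart +
      s'.toJordanDecomposition.posPart).toSignedMeasure -
      (s.toJordanDecomposition.negPart + s'.toJordanDecomposition.negPart).toSignedMeasure := by
    conv_lhs => rw [← s.toSignedMeasure_toJordanDecomposition,
      ← s'.toSignedMeasure_toJordanDecomposition]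
    rw [JordanDecomposition.toSignedMeasure, JordanDecomposition.toSignedMeasure,
      Measure.toSignedMeasure_add, Measure.toSignedMeasure_add]
    abel
  rw [h, signedIntegral_toSignedMeasure_sub, integral_add_measure (hint _) (hint _),
    integral_add_measure (hint _) (hint _), signedIntegral, signedIntegral]
  ring

theorem signedIntegral_withDensityᵥ {T : ℝ} (φ : C(Icc 0 T, ℝ)) {θ : Measure (Icc 0 T)}
    {v : Icc 0 T → ℝ} (hv : Integrable v θ) :
    signedIntegral φ (θ.withDensityᵥ v) = ∫ t, φ t * v t ∂θ := by
  have := isFiniteMeasure_withDensity_ofReal hv.2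
  have := isFiniteMeasure_withDensity_ofReal hv.neg.2
  obtain ⟨C, hC⟩ : ∃ C, ∀ t, ‖φ t‖ ≤ C := ⟨‖φ‖, fun t => φ.norm_coe_le_norm t⟩
  rw [withDensityᵥ_eq_withDensity_pos_part_sub_withDensity_neg_part hv,
    signedIntegral_toSignedMeasure_sub,
    integral_withDensity_eq_integral_toReal_smul₀ hv.aemeasurable.ennreal_ofReal (by simp),
    integral_withDensity_eq_integral_toReal_smul₀ (f := fun x => ENNReal.ofReal (-v x))
      hv.neg.aemeasurable.ennreal_ofReal (by simp), ← integral_sub]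
  · refine integral_congr_ae (Eventually.of_forall fun t => ?_)
    simp only [ENNReal.toReal_ofReal', smul_eq_mul]
    rcases le_total 0 (v t) with h | h
    · rw [max_eq_left h, max_eq_right (by linarith)]
      ring
    · rw [max_eq_right h, max_eq_left (by linarith)]
      ring
  · simp only [ENNReal.toReal_ofReal']
    exact (hv.pos_part).mul_bdd (c := C) φ.continuous.aestronglyMeasurable
      (Eventually.of_forall hC)
  · simp only [ENNReal.toReal_ofReal']
    exact (hv.neg.pos_part).mul_bdd (c := C) φ.continuous.aestronglyMeasurable
      (Eventually.of_forall hC)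

theorem comp_apply {T : ℝ} {l : ℕ} (μ : VectorMeasure (Icc 0 T) (Fin l → ℝ)) (j : Fin l)
    (B : Set (Icc 0 T)) : comp μ j B = μ B j := rfl

theorem comp_add {T : ℝ} {l : ℕ} (μ ν : VectorMeasure (Icc 0 T) (Fin l → ℝ)) (j : Fin l) :
    comp (μ + ν) j = comp μ j + comp ν j := by
  ext B _
  simp [comp_apply]

theorem comp_withDensityᵥ {T : ℝ} {l : ℕ} {θ : Measure (Icc 0 T)} {v : Icc 0 T → Fin l → ℝ}
    (hv : Integrable v θ) (j : Fin l) :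
    comp (θ.withDensityᵥ v) j = θ.withDensityᵥ fun t => v t j := by
  ext B hB
  rw [comp_apply, withDensityᵥ_apply hv hB, withDensityᵥ_apply (hv.eval j) hB,
    eval_integral fun i => (hv.eval i).integrableOn]

instance totalVar_isFiniteMeasure {T : ℝ} {l : ℕ} (μ : VectorMeasure (Icc 0 T) (Fin l → ℝ)) :
    IsFiniteMeasure (totalVar μ) := by
  have : ∀ j, IsFiniteMeasure (comp μ j).totalVariation := fun j => by
    rw [SignedMeasure.totalVariation]
    infer_instance
  rw [totalVar]
  infer_instance

theorem integrable_density {T : ℝ} {l : ℕ} (μ : VectorMeasure (Icc 0 T) (Fin l → ℝ)) :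
    Integrable (density μ) (totalVar μ) :=
  Integrable.of_eval fun _ => SignedMeasure.integrable_rnDeriv _ _

/-- Each component is dominated by `totalVar μ`, one of whose summands is its own total variation,
so the Radon-Nikodym derivative recovers it. -/
theorem withDensityᵥ_density {T : ℝ} {l : ℕ} (μ : VectorMeasure (Icc 0 T) (Fin l → ℝ))
    (j : Fin l) : (totalVar μ).withDensityᵥ (fun t => density μ t j) = comp μ j := by
  refine ((comp μ j).absolutelyContinuous_iff_withDensityᵥ_rnDeriv_eq (totalVar μ)).1 ?_
  rw [SignedMeasure.absolutelyContinuous_ennreal_iff]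
  rw [VectorMeasure.ennrealToMeasure_toENNRealVectorMeasure]
  refine Measure.absolutelyContinuous_of_le ?_
  rw [totalVar]
  exact Finset.single_le_sum (f := fun j => (comp μ j).totalVariation)
    (fun _ _ => bot_le) (Finset.mem_univ j)

theorem setIntegral_density {T : ℝ} {l : ℕ} (μ : VectorMeasure (Icc 0 T) (Fin l → ℝ))
    {B : Set (Icc 0 T)} (hB : MeasurableSet B) : ∫ t in B, density μ t ∂(totalVar μ) = μ B := by
  ext j
  rw [eval_integral fun i => ((integrable_density μ).eval i).integrableOn, ← comp_apply,
    ← withDensityᵥ_density, withDensityᵥ_apply ((integrable_density μ).eval j) hB]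

theorem withDensityᵥ_density_eq {T : ℝ} {l : ℕ} (μ : VectorMeasure (Icc 0 T) (Fin l → ℝ)) :
    (totalVar μ).withDensityᵥ (density μ) = μ := by
  ext1 B hB
  rw [withDensityᵥ_apply (integrable_density μ) hB, setIntegral_density μ hB]

theorem totalVar_withDensityᵥ_absolutelyContinuous {T : ℝ} {l : ℕ} {θ : Measure (Icc 0 T)}
    {v : Icc 0 T → Fin l → ℝ} (hv : Integrable v θ) :
    totalVar (θ.withDensityᵥ v) ≪ θ := by
  have h : ∀ j, (comp (θ.withDensityᵥ v) j).totalVariation ≪ θ := fun j => by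
    have := (θ.withDensityᵥ_absolutelyContinuous fun t => v t j)
    rw [SignedMeasure.absolutelyContinuous_ennreal_iff,
      VectorMeasure.ennrealToMeasure_toENNRealVectorMeasure] at this
    rwa [comp_withDensityᵥ hv]
  intro B hB
  rw [totalVar, Measure.finsetSum_apply]
  exact Finset.sum_eq_zero fun j _ => h j hB

section WithDensity

variable {T : ℝ} {l : ℕ} {θ : Measure (Icc 0 T)} [IsFiniteMeasure θ] {v : Icc 0 T → Fin l → ℝ}

/-- Chain rule for densities: both sides are densities of the same vector measure with respect to
`θ`, hence agree almost everywhere. This lets any convenient dominating measure replace `totalVar`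
in the definition of integrals. -/
theorem density_withDensityᵥ_ae_eq (hv : Integrable v θ) :
    (fun t => ((totalVar (θ.withDensityᵥ v)).rnDeriv θ t).toReal • density (θ.withDensityᵥ v) t)
      =ᵐ[θ] v := by
  set τ := totalVar (θ.withDensityᵥ v) with hτ
  have hac : τ ≪ θ := totalVar_withDensityᵥ_absolutelyContinuous hv
  have hτθ : θ.withDensity (τ.rnDeriv θ) = τ := Measure.withDensity_rnDeriv_eq _ _ hac
  have hfin := Measure.rnDeriv_lt_top τ θ
  have hint : Integrable (fun t => (τ.rnDeriv θ t).toReal • density (θ.withDensityᵥ v) t) θ := by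
    rw [← integrable_withDensity_iff_integrable_smul' (Measure.measurable_rnDeriv τ θ) hfin, hτθ]
    exact integrable_density _
  refine Integrable.ae_eq_of_withDensityᵥ_eq hint hv ?_
  rw [withDensityᵥ_smul_eq_withDensityᵥ_withDensity'
    (Measure.measurable_rnDeriv τ θ).aemeasurable hfin hint, hτθ, hτ, withDensityᵥ_density_eq]

theorem integrableAgainst_withDensityᵥ_iff (hv : Integrable v θ) {n : ℕ}
    (Ψ : Icc 0 T → Matrix (Fin n) (Fin l) ℝ) :
    IntegrableAgainst Ψ (θ.withDensityᵥ v) ↔ Integrable (fun s => (Ψ s).mulVec (v s)) θ := by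
  rw [IntegrableAgainst]
  have h := density_withDensityᵥ_ae_eq hv
  set τ := totalVar (θ.withDensityᵥ v) with hτ
  have hac : τ ≪ θ := totalVar_withDensityᵥ_absolutelyContinuous hv
  have hτθ : θ.withDensity (τ.rnDeriv θ) = τ := Measure.withDensity_rnDeriv_eq _ _ hac
  conv_lhs => rw [← hτθ]
  rw [integrable_withDensity_iff_integrable_smul' (Measure.measurable_rnDeriv τ θ)
    (Measure.rnDeriv_lt_top τ θ)]
  refine integrable_congr ?_
  filter_upwards [h] with t ht
  rw [← Matrix.mulVec_smul, ht]

theorem integralAgainst_withDensityᵥ (hv : Integrable v θ) {n : ℕ}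
    (Ψ : Icc 0 T → Matrix (Fin n) (Fin l) ℝ) {B : Set (Icc 0 T)} (hB : MeasurableSet B) :
    integralAgainst B Ψ (θ.withDensityᵥ v) = ∫ s in B, (Ψ s).mulVec (v s) ∂θ := by
  rw [integralAgainst]
  have h := density_withDensityᵥ_ae_eq hv
  set τ := totalVar (θ.withDensityᵥ v) with hτ
  have hac : τ ≪ θ := totalVar_withDensityᵥ_absolutelyContinuous hv
  have hτθ : θ.withDensity (τ.rnDeriv θ) = τ := Measure.withDensity_rnDeriv_eq _ _ hac
  conv_lhs => rw [← hτθ]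
  rw [setIntegral_withDensity_eq_setIntegral_toReal_smul (Measure.measurable_rnDeriv τ θ)
    (ae_restrict_of_ae (Measure.rnDeriv_lt_top τ θ)) _ hB]
  refine integral_congr_ae (ae_restrict_of_ae ?_)
  filter_upwards [h] with t ht
  rw [← Matrix.mulVec_smul, ht]

end WithDensity

section Cone

variable {X E : Type*} [MeasurableSpace X] [NormedAddCommGroup E] [NormedSpace ℝ E]
  [CompleteSpace E] {θ : Measure X} [IsFiniteMeasure θ] {K : Set E} {v : X → E}

/-- Integrals of functions with values in a closed convex cone belong to the cone. -/
theorem setIntegral_mem_cone (hK : IsClosed K) (hKc : Convex ℝ K)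
    (hcone : ∀ w ∈ K, ∀ r : ℝ, 0 < r → r • w ∈ K) (h0 : (0 : E) ∈ K) (hv : Integrable v θ)
    (hvK : ∀ᵐ t ∂θ, v t ∈ K) (B : Set X) : ∫ t in B, v t ∂θ ∈ K := by
  by_cases hB : θ B = 0
  · rwa [Measure.restrict_eq_zero.2 hB, integral_zero_measure]
  · have h := hKc.set_average_mem hK hB (measure_ne_top _ _) (ae_restrict_of_ae hvK)
      hv.integrableOn
    rw [setAverage_eq] at h
    have hpos : 0 < θ.real B := ENNReal.toReal_pos hB (measure_ne_top _ _)
    have := hcone _ h _ hpos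
    rwa [smul_smul, mul_inv_cancel₀ hpos.ne', one_smul] at this

/-- A function with all its integrals in a closed convex cone takes values in the cone. -/
theorem ae_mem_cone [MeasurableSpace E] [BorelSpace E] [SecondCountableTopology E]
    (hK : IsClosed K) (hcone : ∀ w ∈ K, ∀ r : ℝ, 0 < r → r • w ∈ K)
    (hm : Measurable v) (hv : Integrable v θ)
    (hvK : ∀ B, MeasurableSet B → ∫ t in B, v t ∂θ ∈ K) : ∀ᵐ t ∂θ, v t ∈ K := by
  suffices (θ.map v) Kᶜ = 0 by
    rw [Measure.map_apply hm hK.measurableSet.compl] at this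
    exact this
  -- It is enough that small closed balls off `K` have null preimage. Otherwise the average of `v`
  -- over such a preimage would lie in the ball by convexity and in `K` by the cone property.
  refine measure_null_of_locally_null _ fun x hx => ?_
  obtain ⟨r, hr, hball⟩ := Metric.nhds_basis_closedBall.mem_iff.1 (hK.isOpen_compl.mem_nhds hx)
  refine ⟨_, mem_nhdsWithin_of_mem_nhds (Metric.closedBall_mem_nhds x hr), ?_⟩
  rw [Measure.map_apply hm Metric.isClosed_closedBall.measurableSet]
  by_contra hB
  have hBm : MeasurableSet (v ⁻¹' Metric.closedBall x r) :=
    hm Metric.isClosed_closedBall.measurableSet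
  have h := (convex_closedBall x r).set_average_mem Metric.isClosed_closedBall hB
    (measure_ne_top _ _) ((ae_restrict_iff' hBm).2 (Eventually.of_forall fun t ht => ht))
    hv.integrableOn
  have hpos : 0 < θ.real (v ⁻¹' Metric.closedBall x r) :=
    ENNReal.toReal_pos hB (measure_ne_top _ _)
  refine hball h ?_
  rw [setAverage_eq]
  exact hcone _ (hvK _ hBm) _ (inv_pos.2 hpos)

end Cone

/-! ### Primitives on `[0,T]` -/

theorem map_val_leb (T : ℝ) : (leb T).map Subtype.val = volume.restrict (Icc 0 T) :=
  map_comap_subtype_coe measurableSet_Icc volume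

theorem leb_apply {T : ℝ} (B : Set (Icc 0 T)) : leb T B = volume (Subtype.val '' B) :=
  (MeasurableEmbedding.subtype_coe measurableSet_Icc).comap_apply _ _

instance leb_nullSingletonClass (T : ℝ) : NullSingletonClass (leb T) :=
  ⟨fun t => by rw [leb_apply, image_singleton, Real.volume_singleton]⟩

theorem leb_univ (T : ℝ) : leb T univ = ENNReal.ofReal T := by
  rw [leb_apply, image_univ, Subtype.range_coe, Real.volume_Icc, sub_zero]

/-- The indefinite integral of `L`. -/
def primitive {T : ℝ} {E : Type*} [NormedAddCommGroup E] [NormedSpace ℝ E] (L : Icc 0 T → E)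
    (t : Icc 0 T) : E := ∫ s in Iic t, L s ∂(leb T)

section Primitive

variable {T : ℝ} {E : Type*} [NormedAddCommGroup E] [NormedSpace ℝ E]

/-- The integrand `(Iic t).indicator L s` is continuous in `t` except at `t = s`, and Lebesgue
measure has no atoms; dominated convergence applies. -/
theorem continuous_primitive {L : Icc 0 T → E} (hL : Integrable L (leb T)) :
    Continuous (primitive L) := by
  have h : primitive L = fun t => ∫ s, (Iic t).indicator L s ∂(leb T) := by
    funext t
    rw [primitive, integral_indicator measurableSet_Iic]
  rw [h, continuous_iff_continuousAt]
  intro t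
  refine continuousAt_of_dominated (bound := fun s => ‖L s‖) ?_ ?_ hL.norm ?_
  · exact Eventually.of_forall fun u => hL.aestronglyMeasurable.indicator measurableSet_Iic
  · exact Eventually.of_forall fun u => Eventually.of_forall fun s =>
      norm_indicator_le_norm_self _ _
  · have : ∀ᵐ s ∂(leb T), s ≠ t := by
      rw [ae_iff]
      simp
    filter_upwards [this] with s hs
    rcases lt_or_gt_of_ne hs with h | h
    · refine (continuousAt_const (y := L s)).congr ?_
      filter_upwards [lt_mem_nhds h] with u hu
      rw [indicator_of_mem (mem_Iic.2 hu.le)]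
    · refine (continuousAt_const (y := (0 : E))).congr ?_
      filter_upwards [gt_mem_nhds h] with u hu
      rw [indicator_of_notMem (fun h' => absurd (mem_Iic.1 h') (not_le.2 hu))]

theorem primitive_nonneg {L : Icc 0 T → ℝ} (hL : ∀ t, 0 ≤ L t) (t : Icc 0 T) :
    0 ≤ primitive L t := integral_nonneg hL

theorem monotone_primitive {L : Icc 0 T → ℝ} (hL : Integrable L (leb T)) (h0 : ∀ t, 0 ≤ L t) :
    Monotone (primitive L) := fun _ _ hst =>
  setIntegral_mono_set hL.integrableOn (Eventually.of_forall h0)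
    (Eventually.of_forall fun _ hu => le_trans hu hst)

theorem primitive_le_integral {L : Icc 0 T → ℝ} (hL : Integrable L (leb T)) (h0 : ∀ t, 0 ≤ L t)
    (t : Icc 0 T) : primitive L t ≤ ∫ s, L s ∂(leb T) :=
  setIntegral_le_integral hL (Eventually.of_forall h0)

theorem primitive_eq_intervalIntegral (hT : 0 ≤ T) (L : Icc 0 T → E) (t : Icc 0 T) :
    primitive L t = ∫ s in (0 : ℝ)..t, L (projIcc 0 T hT s) := by
  have h1 : primitive L t = ∫ s : Icc 0 T,
      (Iic (t : ℝ)).indicator (fun u => L (projIcc 0 T hT u)) (s : ℝ) ∂(leb T) := by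
    rw [primitive, ← integral_indicator measurableSet_Iic]
    refine integral_congr_ae (Eventually.of_forall fun s => ?_)
    beta_reduce
    by_cases hs : s ≤ t
    · rw [indicator_of_mem (mem_Iic.2 hs), indicator_of_mem (mem_Iic.2 (Subtype.coe_le_coe.2 hs)),
        projIcc_val]
    · rw [indicator_of_notMem (fun h => hs (mem_Iic.1 h)),
        indicator_of_notMem (fun h => hs (Subtype.coe_le_coe.1 (mem_Iic.1 h)))]
  rw [h1, leb, integral_subtype_comap measurableSet_Icc, setIntegral_indicator measurableSet_Iic,
    intervalIntegral.integral_of_le t.2.1, ← integral_Icc_eq_integral_Ioc]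
  congr 2
  ext s
  simp only [mem_inter_iff, mem_Icc, mem_Iic]
  exact ⟨fun h => ⟨h.1.1, h.2⟩, fun h => ⟨⟨h.1, h.2.trans t.2.2⟩, h.2⟩⟩

theorem integrableOn_comp_projIcc {T : ℝ} (hT : 0 ≤ T) {L : Icc 0 T → ℝ} (hL : Integrable L (leb T)) :
    IntegrableOn (fun s => L (projIcc 0 T hT s)) (Icc 0 T) := by
  rw [IntegrableOn, ← map_val_leb,
    (MeasurableEmbedding.subtype_coe measurableSet_Icc).integrable_map_iff]
  refine hL.congr (Eventually.of_forall fun s => ?_)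
  simp only [Function.comp_apply, projIcc_val]

/-- The Bielecki weight `exp (2 ∫₀ᵗ L)`. -/
def weight (L : Icc 0 T → ℝ) (t : Icc 0 T) : ℝ := Real.exp (2 * primitive L t)

theorem one_le_weight {L : Icc 0 T → ℝ} (hL : ∀ t, 0 ≤ L t) (t : Icc 0 T) : 1 ≤ weight L t :=
  Real.one_le_exp (mul_nonneg zero_le_two (primitive_nonneg hL t))

theorem continuous_weight {L : Icc 0 T → ℝ} (hL : Integrable L (leb T)) :
    Continuous (weight L) :=
  Real.continuous_exp.comp ((continuous_primitive hL).const_mul 2)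

theorem monotone_weight {L : Icc 0 T → ℝ} (hL : Integrable L (leb T)) (h0 : ∀ t, 0 ≤ L t) :
    Monotone (weight L) := fun _ _ hst =>
  Real.exp_le_exp.2 (mul_le_mul_of_nonneg_left (monotone_primitive hL h0 hst) zero_le_two)

theorem weight_le {L : Icc 0 T → ℝ} (hL : Integrable L (leb T)) (h0 : ∀ t, 0 ≤ L t)
    (t : Icc 0 T) : weight L t ≤ Real.exp (2 * ∫ s, L s ∂(leb T)) :=
  Real.exp_le_exp.2 (mul_le_mul_of_nonneg_left (primitive_le_integral hL h0 t) zero_le_two)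

theorem integrable_mul_weight {L : Icc 0 T → ℝ} (hL : Integrable L (leb T))
    (h0 : ∀ t, 0 ≤ L t) : Integrable (fun s => L s * weight L s) (leb T) := by
  refine hL.mul_bdd (c := Real.exp (2 * ∫ s, L s ∂(leb T)))
    (continuous_weight hL).aestronglyMeasurable (Eventually.of_forall fun t => ?_)
  rw [Real.norm_of_nonneg (zero_le_one.trans (one_le_weight h0 t))]
  exact weight_le hL h0 t

/-- Compositions of an absolutely continuous function with a function that is Lipschitz on its
range are absolutely continuous. -/
theorem _root_.AbsolutelyContinuousOnInterval.comp_of_dist_le {f : ℝ → ℝ} {g : ℝ → ℝ} {a b C : ℝ}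
    (hf : AbsolutelyContinuousOnInterval f a b)
    (hg : ∀ s ∈ uIcc a b, ∀ t ∈ uIcc a b, dist (g (f s)) (g (f t)) ≤ C * dist (f s) (f t)) :
    AbsolutelyContinuousOnInterval (fun t => g (f t)) a b := by
  rw [AbsolutelyContinuousOnInterval] at hf ⊢
  have h3 := Tendsto.const_mul C hf
  rw [mul_zero] at h3
  refine squeeze_zero' (Eventually.of_forall fun E => Finset.sum_nonneg fun _ _ => dist_nonneg) ?_
    h3
  have : ∀ᶠ E in AbsolutelyContinuousOnInterval.totalLengthFilter ⊓
      𝓟 (AbsolutelyContinuousOnInterval.disjWithin a b),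
      E ∈ AbsolutelyContinuousOnInterval.disjWithin a b := eventually_inf_principal.mpr (by simp)
  filter_upwards [this] with E hE
  rw [Finset.mul_sum]
  refine Finset.sum_le_sum fun i hi => ?_
  have := hE.1 i hi
  exact hg _ this.1 _ this.2

/-- The weight is absolutely continuous with derivative `2 L w` almost everywhere, so the left side
is half the increment of the weight. The factor `1 / 2` is what makes the Picard operator a
contraction and the Gronwall iteration converge. -/
theorem setIntegral_mul_weight_le (hT : 0 ≤ T) {L : Icc 0 T → ℝ} (hL : Integrable L (leb T))
    (h0 : ∀ t, 0 ≤ L t) (t : Icc 0 T) :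
    ∫ s in Iic t, L s * weight L s ∂(leb T) ≤ weight L t / 2 := by
  set f : ℝ → ℝ := fun s => L (projIcc 0 T hT s) with hf
  set M : ℝ → ℝ := fun x => ∫ s in (0 : ℝ)..x, f s with hM
  have hIcc : uIcc (0 : ℝ) t ⊆ Icc 0 T := by
    rw [uIcc_of_le t.2.1]
    exact Icc_subset_Icc_right t.2.2
  have hfi : IntervalIntegrable f volume 0 t := by
    rw [intervalIntegrable_iff_integrableOn_Icc_of_le t.2.1]
    exact (integrableOn_comp_projIcc hT hL).mono_set (Icc_subset_Icc_right t.2.2)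
  have hMp : ∀ s (hs : s ∈ Icc 0 T), M s = primitive L ⟨s, hs⟩ := fun s hs =>
    (primitive_eq_intervalIntegral hT L ⟨s, hs⟩).symm
  have hMw : ∀ s (hs : s ∈ Icc 0 T), Real.exp (2 * M s) = weight L ⟨s, hs⟩ := fun s hs => by
    rw [hMp s hs, weight]
  have hac : AbsolutelyContinuousOnInterval M 0 t :=
    hfi.absolutelyContinuousOnInterval_intervalIntegral left_mem_uIcc
  set W : ℝ := Real.exp (2 * ∫ s, L s ∂(leb T)) with hW
  -- The exponential is only locally Lipschitz; `W` bounds it on the range of `2 * M`, and convexity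
  -- gives the constant `2 * W`.
  have hlip : ∀ a b : ℝ, Real.exp (2 * b) ≤ W → Real.exp (2 * b) - Real.exp (2 * a) ≤
      2 * W * |a - b| := by
    intro a b hb
    have h1 : Real.exp (2 * a) = Real.exp (2 * b) * Real.exp (2 * a - 2 * b) := by
      rw [← Real.exp_add]
      congr 1
      ring
    have h2 := Real.add_one_le_exp (2 * a - 2 * b)
    have h3 : 0 < Real.exp (2 * b) := Real.exp_pos _
    have h4 := neg_abs_le (a - b)
    have h5 := abs_nonneg (a - b)
    rw [h1]
    nlinarith
  have hacg : AbsolutelyContinuousOnInterval (fun x => Real.exp (2 * M x)) 0 t := by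
    refine hac.comp_of_dist_le (g := fun y => Real.exp (2 * y)) (C := 2 * W) ?_
    intro s hs u hu
    rw [Real.dist_eq, Real.dist_eq]
    have hs' : Real.exp (2 * M s) ≤ W := by
      rw [hMw s (hIcc hs)]
      exact weight_le hL h0 _
    have hu' : Real.exp (2 * M u) ≤ W := by
      rw [hMw u (hIcc hu)]
      exact weight_le hL h0 _
    refine abs_le.2 ⟨?_, ?_⟩
    · have := hlip (M s) (M u) hu'
      linarith
    · have := hlip (M u) (M s) hs'
      rwa [abs_sub_comm] at this
  have hFTC := hacg.integral_deriv_eq_sub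
  have hcongr : ∫ x in (0 : ℝ)..t, deriv (fun x => Real.exp (2 * M x)) x
      = ∫ x in (0 : ℝ)..t, 2 * (L (projIcc 0 T hT x) * weight L (projIcc 0 T hT x)) := by
    refine intervalIntegral.integral_congr_ae ?_
    filter_upwards [hfi.ae_hasDerivAt_integral] with x hx hxt
    have hx' := hx (uIoc_subset_uIcc hxt) 0 left_mem_uIcc
    have hxI := hIcc (uIoc_subset_uIcc hxt)
    rw [((hx'.const_mul 2).exp).deriv, hMw x hxI, projIcc_of_mem hT hxI]
    simp only [hf, projIcc_of_mem hT hxI]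
    ring
  rw [hcongr, intervalIntegral.integral_const_mul,
    ← primitive_eq_intervalIntegral hT (fun s => L s * weight L s) t, primitive, hMw t t.2] at hFTC
  have := Real.exp_pos (2 * M 0)
  have ht : (⟨(t : ℝ), t.2⟩ : Icc 0 T) = t := rfl
  rw [ht] at hFTC
  linarith

end Primitive

/-- A Gronwall type argument: iterating a contracting bound. -/
theorem le_of_forall_bound_imp {X : Type*} {r w : X → ℝ} {δ C₀ : ℝ} (hw : ∀ t, 0 ≤ w t)
    (hδ : 0 ≤ δ) (hC₀ : 0 ≤ C₀) (h₀ : ∀ t, r t ≤ C₀ * w t)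
    (h : ∀ C, 0 ≤ C → (∀ t, r t ≤ C * w t) → ∀ t, r t ≤ (δ + C / 2) * w t) (t : X) :
    r t ≤ 2 * δ * w t := by
  -- The map `C ↦ δ + C / 2` has fixed point `2 * δ` and halves the distance to it.
  have key : ∀ k : ℕ, ∀ t, r t ≤ (2 * δ + C₀ * (1 / 2) ^ k) * w t := by
    intro k
    induction k with
    | zero =>
      intro t
      refine (h₀ t).trans (mul_le_mul_of_nonneg_right ?_ (hw t))
      rw [pow_zero]
      linarith
    | succ k ih =>
      intro t
      refine (h _ (by positivity) ih t).trans (le_of_eq ?_)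
      ring
  have hlim : Tendsto (fun k : ℕ => (2 * δ + C₀ * (1 / 2) ^ k) * w t) atTop
      (𝓝 ((2 * δ + C₀ * 0) * w t)) :=
    ((tendsto_pow_atTop_nhds_zero_of_lt_one (by norm_num) (by norm_num)).const_mul C₀
      |>.const_add (2 * δ)).mul_const (w t)
  have := ge_of_tendsto' hlim fun k => key k t
  simpa using this

/-! ### Delay integral equations -/

/-- Compositions with a Carathéodory function are measurable. -/
theorem aestronglyMeasurable_comp_of_continuous {X Z E : Type*} [MeasurableSpace X]
    {μ : Measure X} [TopologicalSpace Z] [TopologicalSpace.PseudoMetrizableSpace Z]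
    [NormedAddCommGroup E] {F : X → Z → E}
    (hFm : ∀ z, AEStronglyMeasurable (fun s => F s z) μ) (hc : ∀ᵐ s ∂μ, Continuous (F s))
    {z : X → Z} (hz : AEStronglyMeasurable z μ) :
    AEStronglyMeasurable (fun s => F s (z s)) μ := by
  -- For a simple function only finitely many values of `z` occur; continuity of `F s` is needed
  -- just for the limit.
  let φ := hz.stronglyMeasurable_mk.approx
  have hφ : ∀ k, AEStronglyMeasurable (fun s => F s (φ k s)) μ := by
    intro k
    have : (fun s => F s (φ k s)) =
        fun s => ∑ y ∈ (φ k).range, ((φ k) ⁻¹' {y}).indicator (fun s => F s y) s := by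
      funext s
      rw [Finset.sum_eq_single (φ k s)]
      · exact (indicator_of_mem (s := (φ k) ⁻¹' {φ k s}) (a := s) (mem_singleton (φ k s))
          (fun s' => F s' (φ k s))).symm
      · intro y _ hy
        exact indicator_of_notMem (fun h => hy h.symm) _
      · intro h
        exact absurd ((φ k).mem_range_self s) h
    rw [this]
    exact Finset.aestronglyMeasurable_fun_sum _ fun y _ =>
      (hFm y).indicator ((φ k).measurableSet_fiber y)
  refine aestronglyMeasurable_of_tendsto_ae atTop hφ ?_
  filter_upwards [hc, hz.ae_eq_mk] with s hs hzs
  rw [hzs]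
  exact (hs.tendsto _).comp (hz.stronglyMeasurable_mk.tendsto_approx s)

theorem aestronglyMeasurable_of_eval {X ι E : Type*} [MeasurableSpace X] {μ : Measure X}
    [Fintype ι] [NormedAddCommGroup E] {z : X → ι → E}
    (hz : ∀ i, AEStronglyMeasurable (fun s => z s i) μ) : AEStronglyMeasurable z μ := by
  classical
  have h : z = fun s => ∑ i, Pi.single i (z s i) := by
    funext s
    exact (Finset.univ_sum_single (z s)).symm
  rw [h]
  exact Finset.aestronglyMeasurable_fun_sum _ fun i _ =>
    (continuous_single i).comp_aestronglyMeasurable (hz i)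

/-- The function which equals `y` on `[0,T]` and `x₀` elsewhere. -/
def extendBy {T : ℝ} {E : Type*} (x₀ : ℝ → E) (y : Icc 0 T → E) (t : ℝ) : E :=
  if h : t ∈ Icc 0 T then y ⟨t, h⟩ else x₀ t

theorem extendBy_of_mem {T : ℝ} {E : Type*} (x₀ : ℝ → E) (y : Icc 0 T → E) {t : ℝ}
    (h : t ∈ Icc 0 T) : extendBy x₀ y t = y ⟨t, h⟩ := dif_pos h

theorem extendBy_of_neg {T : ℝ} {E : Type*} (x₀ : ℝ → E) (y : Icc 0 T → E) {t : ℝ}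
    (h : t < 0) : extendBy x₀ y t = x₀ t := dif_neg fun h' => absurd h'.1 (not_le.2 h)

/-- A delayed time lies either in the history, where all candidate trajectories coincide, or at an
earlier time of `[0,T]`, where monotone weights are no larger. -/
theorem delay_cases {T : ℝ} (s : Icc 0 T) {d : ℝ} (hd : 0 ≤ d) :
    (s : ℝ) - d < 0 ∨ ∃ u : Icc 0 T, (s : ℝ) - d = u ∧ u ≤ s := by
  rcases lt_or_ge ((s : ℝ) - d) 0 with h | h
  · exact Or.inl h
  · exact Or.inr ⟨⟨(s : ℝ) - d, h, by linarith [s.2.2]⟩, rfl,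
      Subtype.coe_le_coe.1 (by simpa using hd)⟩

section Existence

variable {ι E : Type*} [Fintype ι] [NormedAddCommGroup E] {T : ℝ}

theorem aestronglyMeasurable_extendBy_delay (hT : 0 ≤ T) {x₀ : ℝ → E} {y : Icc 0 T → E} {d : ℝ}
    (hd : 0 ≤ d) (hx₀ : AEStronglyMeasurable (fun s : Icc 0 T => x₀ (s - d)) (leb T))
    (hy : Continuous y) :
    AEStronglyMeasurable (fun s : Icc 0 T => extendBy x₀ y (s - d)) (leb T) := by
  have hS : MeasurableSet {s : Icc 0 T | (s : ℝ) - d < 0} :=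
    measurableSet_lt (measurable_subtype_coe.sub_const d) measurable_const
  have hyc : Continuous fun s : Icc 0 T => y (projIcc 0 T hT (s - d)) :=
    hy.comp (continuous_projIcc.comp (continuous_subtype_val.sub continuous_const))
  have : (fun s : Icc 0 T => extendBy x₀ y (s - d)) =
      fun s => {s : Icc 0 T | (s : ℝ) - d < 0}.indicator (fun s : Icc 0 T => x₀ (s - d)) s +
        {s : Icc 0 T | (s : ℝ) - d < 0}ᶜ.indicator
          (fun s : Icc 0 T => y (projIcc 0 T hT (s - d))) s := by
    funext s
    rcases delay_cases s hd with h | ⟨u, hu, -⟩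
    · rw [extendBy_of_neg _ _ h, indicator_of_mem (by exact h),
        indicator_of_notMem (by simpa using h), add_zero]
    · have hns : ¬ ((s : ℝ) - d < 0) := by
        rw [hu]
        exact not_lt.2 u.2.1
      have hum : (s : ℝ) - d ∈ Icc 0 T := by
        rw [hu]
        exact u.2
      rw [extendBy_of_mem _ _ hum, indicator_of_notMem (by exact hns),
        indicator_of_mem (by exact hns), zero_add, projIcc_of_mem hT hum]
  rw [this]
  exact (hx₀.indicator hS).add (hyc.aestronglyMeasurable.indicator hS.compl)

theorem integrable_drift_extendBy (hT : 0 ≤ T) {h : ι → ℝ} (hh : ∀ k, 0 ≤ h k)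
    {F : Icc 0 T → (ι → E) → E} (hFm : ∀ z, AEStronglyMeasurable (fun s => F s z) (leb T))
    (hFc : ∀ᵐ s ∂(leb T), Continuous (F s))
    {g : Icc 0 T → ℝ} (hg : Integrable g (leb T)) (hFg : ∀ᵐ s ∂(leb T), ∀ z, ‖F s z‖ ≤ g s)
    {x₀ : ℝ → E} (hx₀ : ∀ k, AEStronglyMeasurable (fun s : Icc 0 T => x₀ (s - h k)) (leb T))
    {y : Icc 0 T → E} (hy : Continuous y) :
    Integrable (fun s => F s fun k => extendBy x₀ y (s - h k)) (leb T) := by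
  refine hg.mono' (aestronglyMeasurable_comp_of_continuous hFm hFc ?_) ?_
  · exact aestronglyMeasurable_of_eval fun k =>
      aestronglyMeasurable_extendBy_delay hT (hh k) (hx₀ k) hy
  · filter_upwards [hFg] with s hs
    exact hs _

variable [NormedSpace ℝ E]

/-- **Existence of solutions** of delay integral equations with a globally Lipschitz right-hand
side. -/
theorem exists_delay_solution [CompleteSpace E] (hT : 0 ≤ T) {h : ι → ℝ} (hh : ∀ k, 0 ≤ h k)
    {F : Icc 0 T → (ι → E) → E} (hFm : ∀ z, AEStronglyMeasurable (fun s => F s z) (leb T))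
    {L : Icc 0 T → ℝ} (hL : Integrable L (leb T)) (hL0 : ∀ t, 0 ≤ L t)
    (hLip : ∀ᵐ s ∂(leb T), ∀ z y, ‖F s z - F s y‖ ≤ L s * ‖z - y‖)
    {g : Icc 0 T → ℝ} (hg : Integrable g (leb T)) (hFg : ∀ᵐ s ∂(leb T), ∀ z, ‖F s z‖ ≤ g s)
    {x₀ : ℝ → E} (hx₀ : ∀ k, AEStronglyMeasurable (fun s : Icc 0 T => x₀ (s - h k)) (leb T))
    {b : Icc 0 T → E} (hb : Continuous b) :
    ∃ y : Icc 0 T → E, Continuous y ∧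
      Integrable (fun s => F s fun k => extendBy x₀ y (s - h k)) (leb T) ∧
      ∀ t, y t = b t + primitive (fun s => F s fun k => extendBy x₀ y (s - h k)) t := by
  have hFc : ∀ᵐ s ∂(leb T), Continuous (F s) := by
    filter_upwards [hLip] with s hs
    exact (LipschitzWith.of_dist_le_mul (K := (L s).toNNReal) fun z y => by
      rw [dist_eq_norm, dist_eq_norm, Real.coe_toNNReal _ (hL0 s)]
      exact hs z y).continuous
  have hint := fun (y : Icc 0 T → E) (hy : Continuous y) =>
    integrable_drift_extendBy hT hh hFm hFc hg hFg hx₀ hy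
  set w := weight L with hw
  have hwc : Continuous w := continuous_weight hL
  have hw1 : ∀ t, 1 ≤ w t := one_le_weight hL0
  have hwp : ∀ t, 0 < w t := fun t => zero_lt_one.trans_le (hw1 t)
  have hwu : ∀ u : C(Icc 0 T, E), Continuous fun t => w t • u t := fun u =>
    hwc.smul u.continuous
  let Φ : (Icc 0 T → E) → Icc 0 T → E := fun y t =>
    b t + primitive (fun s => F s fun k => extendBy x₀ y (s - h k)) t
  have hΦ : ∀ y, Continuous y → Continuous (Φ y) := fun y hy =>
    hb.add (continuous_primitive (hint y hy))
  -- `Ψ` is the Picard operator `Φ` conjugated by the weight, so the usual sup metric on `C(Icc 0 T,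
  -- E)` plays the role of the Bielecki metric.
  let Ψ : C(Icc 0 T, E) → C(Icc 0 T, E) := fun u =>
    ⟨fun t => (w t)⁻¹ • Φ (fun t => w t • u t) t,
      (hwc.inv₀ fun t => (hwp t).ne').smul (hΦ _ (hwu u))⟩
  have hΨ : ContractingWith (1 / 2) Ψ := by
    refine ⟨by rw [← NNReal.coe_lt_coe]; norm_num, LipschitzWith.of_dist_le_mul fun u v => ?_⟩
    rw [ContinuousMap.dist_le (by positivity)]
    intro t
    have hdiff : ‖Φ (fun t => w t • u t) t - Φ (fun t => w t • v t) t‖ ≤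
        dist u v * (w t / 2) := by
      simp only [Φ, add_sub_add_left_eq_sub, primitive]
      rw [← integral_sub (hint _ (hwu u)).integrableOn (hint _ (hwu v)).integrableOn]
      refine (norm_integral_le_of_norm_le (g := fun s => dist u v * (L s * w s))
        ((integrable_mul_weight hL hL0).integrableOn.const_mul _) ?_).trans ?_
      · refine ae_restrict_of_ae ?_
        filter_upwards [hLip] with s hs
        refine (hs _ _).trans ?_
        have : ‖(fun k => extendBy x₀ (fun t => w t • u t) ((s : ℝ) - h k)) -
            fun k => extendBy x₀ (fun t => w t • v t) ((s : ℝ) - h k)‖ ≤ w s * dist u v := by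
          rw [pi_norm_le_iff_of_nonneg (mul_nonneg (hwp s).le dist_nonneg)]
          intro k
          rw [Pi.sub_apply]
          rcases delay_cases s (hh k) with hneg | ⟨r, hr, hrs⟩
          · rw [extendBy_of_neg _ _ hneg, extendBy_of_neg _ _ hneg, sub_self, norm_zero]
            exact mul_nonneg (hwp s).le dist_nonneg
          · rw [hr, extendBy_of_mem _ _ r.2, extendBy_of_mem _ _ r.2, ← smul_sub, norm_smul,
              Real.norm_of_nonneg (hwp _).le, ← dist_eq_norm]
            exact mul_le_mul (monotone_weight hL hL0 hrs) (ContinuousMap.dist_apply_le_dist _)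
              dist_nonneg (hwp s).le
        calc L s * _ ≤ L s * (w s * dist u v) := mul_le_mul_of_nonneg_left this (hL0 s)
          _ = dist u v * (L s * w s) := by ring
      · rw [integral_const_mul]
        exact mul_le_mul_of_nonneg_left (setIntegral_mul_weight_le hT hL hL0 t) dist_nonneg
    change dist ((w t)⁻¹ • Φ (fun t => w t • u t) t) ((w t)⁻¹ • Φ (fun t => w t • v t) t) ≤ _
    rw [dist_eq_norm, ← smul_sub, norm_smul, norm_inv, Real.norm_of_nonneg (hwp t).le]
    calc (w t)⁻¹ * _ ≤ (w t)⁻¹ * (dist u v * (w t / 2)) :=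
          mul_le_mul_of_nonneg_left hdiff (inv_nonneg.2 (hwp t).le)
      _ = ((1 / 2 : NNReal) : ℝ) * dist u v := by
          have := (hwp t).ne'
          push_cast
          field_simp
  obtain ⟨u, hu⟩ : ∃ u, Ψ u = u := ⟨_, hΨ.fixedPoint_isFixedPt⟩
  refine ⟨fun t => w t • u t, hwu u, hint _ (hwu u), fun t => ?_⟩
  have : (w t)⁻¹ • Φ (fun t => w t • u t) t = u t := congrArg (fun v => v t) hu
  change w t • u t = Φ (fun t => w t • u t) t
  rw [← this, smul_smul, mul_inv_cancel₀ (hwp t).ne', one_smul]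

/-- An a priori bound for solutions of delay integral equations with linear growth. -/
theorem norm_delay_solution_le (hT : 0 ≤ T) {h : ι → ℝ} (hh : ∀ k, 0 ≤ h k)
    {F : Icc 0 T → (ι → E) → E} {c : Icc 0 T → ℝ} (hc : Integrable c (leb T))
    (hc0 : ∀ t, 0 ≤ c t) (hF : ∀ᵐ s ∂(leb T), ∀ z, ‖F s z‖ ≤ c s * (1 + ‖z‖))
    {x₀ : ℝ → E} {B₀ B : ℝ} (hB₀ : 0 ≤ B₀) (hB : 0 ≤ B)
    (hx₀ : ∀ (s : Icc 0 T) k, (s : ℝ) - h k < 0 → ‖x₀ (s - h k)‖ ≤ B₀)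
    {b y : Icc 0 T → E} (hb : ∀ t, ‖b t‖ ≤ B) (hy : Continuous y)
    (hsol : ∀ t, y t = b t + primitive (fun s => F s fun k => extendBy x₀ y (s - h k)) t)
    (t : Icc 0 T) :
    ‖y t‖ ≤ 2 * (B + (1 + B₀) * ∫ s, c s ∂(leb T)) * Real.exp (2 * ∫ s, c s ∂(leb T)) := by
  have hI : 0 ≤ ∫ s, c s ∂(leb T) := integral_nonneg hc0
  have hδ : 0 ≤ B + (1 + B₀) * ∫ s, c s ∂(leb T) := by positivity
  set w := weight c with hw
  have hw1 : ∀ t, 1 ≤ w t := one_le_weight hc0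
  obtain ⟨C₀, hC₀⟩ : ∃ C₀, ∀ t, ‖y t‖ ≤ C₀ := by
    obtain ⟨C, hC⟩ := isCompact_univ.exists_bound_of_continuousOn hy.continuousOn
    exact ⟨C, fun t => hC t (mem_univ t)⟩
  have key := le_of_forall_bound_imp (r := fun t => ‖y t‖) (w := w) (C₀ := max C₀ 0)
    (fun t => zero_le_one.trans (hw1 t)) hδ (le_max_right _ _)
    (fun t => ((hC₀ t).trans (le_max_left _ _)).trans
      (le_mul_of_one_le_right (le_max_right _ _) (hw1 t))) ?_ t
  · exact key.trans (mul_le_mul_of_nonneg_left (weight_le hc hc0 t) (by positivity))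
  intro C hC hyC u
  rw [hsol u]
  have hbound : ‖primitive (fun s => F s fun k => extendBy x₀ y (s - h k)) u‖ ≤
      (1 + B₀) * ∫ s, c s ∂(leb T) + C * (w u / 2) := by
    refine (norm_integral_le_of_norm_le
      (g := fun s => (1 + B₀) * c s + C * (c s * w s))
      ((hc.const_mul _).add ((integrable_mul_weight hc hc0).const_mul C)).integrableOn ?_).trans ?_
    · refine ae_restrict_of_ae ?_
      filter_upwards [hF] with s hs
      refine (hs _).trans ?_
      have hws : 0 ≤ w s := zero_le_one.trans (hw1 s)
      have : ‖fun k => extendBy x₀ y ((s : ℝ) - h k)‖ ≤ B₀ + C * w s := by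
        rw [pi_norm_le_iff_of_nonneg (by positivity)]
        intro k
        rcases delay_cases s (hh k) with hneg | ⟨r, hr, hrs⟩
        · rw [extendBy_of_neg _ _ hneg]
          exact (hx₀ s k hneg).trans (le_add_of_nonneg_right (by positivity))
        · rw [hr, extendBy_of_mem _ _ r.2]
          refine (hyC r).trans ?_
          have := mul_le_mul_of_nonneg_left (monotone_weight hc hc0 hrs) hC
          linarith
      have := mul_le_mul_of_nonneg_left (add_le_add_right this 1) (hc0 s)
      linarith
    · rw [integral_add (hc.const_mul _).integrableOn
        ((integrable_mul_weight hc hc0).const_mul C).integrableOn, integral_const_mul,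
        integral_const_mul]
      exact add_le_add (mul_le_mul_of_nonneg_left (primitive_le_integral hc hc0 u) (by positivity))
        (mul_le_mul_of_nonneg_left (setIntegral_mul_weight_le hT hc hc0 u) hC)
  calc ‖b u + _‖ ≤ B + ((1 + B₀) * ∫ s, c s ∂(leb T) + C * (w u / 2)) :=
        (norm_add_le _ _).trans (add_le_add (hb u) hbound)
    _ = (B + (1 + B₀) * ∫ s, c s ∂(leb T)) * 1 + C / 2 * w u := by ring
    _ ≤ (B + (1 + B₀) * ∫ s, c s ∂(leb T)) * w u + C / 2 * w u :=
        add_le_add_left (mul_le_mul_of_nonneg_left (hw1 u) hδ) _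
    _ = _ := by ring

end Existence

/-- Indefinite integrals on `[0,T]` are of bounded variation. -/
theorem boundedVariationOn_primitive {T : ℝ} {E : Type*} [NormedAddCommGroup E] [NormedSpace ℝ E]
    {g : Icc 0 T → E} (hg : Integrable g (leb T)) {x : ℝ → E} {x₀ : E}
    (hx : ∀ t : Icc 0 T, x t = x₀ + primitive g t) : BoundedVariationOn x (Icc 0 T) := by
  have hN : Integrable (fun s => ‖g s‖) (leb T) := hg.norm
  have hmono := monotone_primitive hN fun _ => norm_nonneg _
  -- Increments of `x` are dominated by those of the monotone primitive of `‖g‖`, and the latter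
  -- telescope.
  have hdist : ∀ s t : Icc 0 T, s ≤ t →
      edist (x t) (x s) ≤ ENNReal.ofReal (primitive (fun s => ‖g s‖) t -
        primitive (fun s => ‖g s‖) s) := by
    intro s t hst
    rw [edist_dist, dist_eq_norm, hx, hx, add_sub_add_left_eq_sub]
    refine ENNReal.ofReal_le_ofReal ?_
    have hU : Iic t = Iic s ∪ Ioc s t := (Iic_union_Ioc_eq_Iic hst).symm
    have hd : Disjoint (Iic s) (Ioc s t) := Iic_disjoint_Ioc le_rfl
    rw [primitive, primitive, primitive, primitive, hU,
      setIntegral_union hd measurableSet_Ioc hg.integrableOn hg.integrableOn,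
      setIntegral_union hd measurableSet_Ioc hN.integrableOn hN.integrableOn,
      add_sub_cancel_left, add_sub_cancel_left]
    exact norm_integral_le_integral_norm _
  have hle : eVariationOn x (Icc 0 T) ≤ ENNReal.ofReal (∫ s, ‖g s‖ ∂(leb T)) := by
    refine iSup_le ?_
    rintro ⟨k, u, hu, huI⟩
    have h0 : ∀ i, 0 ≤ primitive (fun s => ‖g s‖) ⟨u (i + 1), huI (i + 1)⟩ -
        primitive (fun s => ‖g s‖) ⟨u i, huI i⟩ := fun i =>
      sub_nonneg.2 (hmono (Subtype.coe_le_coe.1 (hu (Nat.le_succ i))))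
    calc ∑ i ∈ Finset.range k, edist (x (u (i + 1))) (x (u i))
        ≤ ∑ i ∈ Finset.range k, ENNReal.ofReal
          (primitive (fun s => ‖g s‖) ⟨u (i + 1), huI (i + 1)⟩ -
            primitive (fun s => ‖g s‖) ⟨u i, huI i⟩) :=
          Finset.sum_le_sum fun i _ => hdist ⟨u i, huI i⟩ ⟨u (i + 1), huI (i + 1)⟩
            (Subtype.coe_le_coe.1 (hu (Nat.le_succ i)))
      _ = ENNReal.ofReal (∑ i ∈ Finset.range k,
          (primitive (fun s => ‖g s‖) ⟨u (i + 1), huI (i + 1)⟩ -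
            primitive (fun s => ‖g s‖) ⟨u i, huI i⟩)) :=
          (ENNReal.ofReal_sum_of_nonneg fun i _ => h0 i).symm
      _ ≤ _ := by
          rw [Finset.sum_range_sub fun i => primitive (fun s => ‖g s‖) ⟨u i, huI i⟩]
          refine ENNReal.ofReal_le_ofReal ?_
          have h1 := primitive_le_integral hN (fun _ => norm_nonneg _) ⟨u k, huI k⟩
          have h2 := primitive_nonneg (L := fun s => ‖g s‖) (fun _ => norm_nonneg _) ⟨u 0, huI 0⟩
          linarith
  exact ne_top_of_le_ne_top ENNReal.ofReal_ne_top hle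

/-! ### Partitions of `[0,T]` and small subsets -/

/-- The cells are the fibres of an index map given by rounding down, which makes them disjoint,
measurable and covering without further argument. -/
theorem exists_partition {T δ : ℝ} (hT : 0 < T) (hδ : 0 < δ) :
    ∃ (N : ℕ) (κ : Icc 0 T → Fin N), Measurable κ ∧ (∀ k, leb T (κ ⁻¹' {k}) ≠ 0) ∧
      (∀ k, leb T (κ ⁻¹' {k}) ≤ ENNReal.ofReal δ) ∧ ∀ s t, κ s = κ t → dist s t ≤ δ := by
  obtain ⟨n, hn⟩ := exists_nat_gt (T / δ)
  have hN : (0 : ℝ) < n + 1 := by positivity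
  have hTN : T / (n + 1) ≤ δ := by
    rw [div_lt_iff₀ hδ] at hn
    rw [div_le_iff₀ hN]
    nlinarith
  have hTN0 : 0 < T / (n + 1) := by positivity
  -- The minimum with `n` puts the endpoint `T` into the last of the `n + 1` cells.
  let κ : Icc 0 T → Fin (n + 1) := fun s => ⟨min ⌊(s : ℝ) / (T / (n + 1))⌋₊ n,
    Nat.lt_succ_of_le (min_le_right _ _)⟩
  have hκm : Measurable κ :=
    (Measurable.of_discrete (f := fun k : ℕ => (⟨min k n, Nat.lt_succ_of_le (min_le_right _ _)⟩ :
      Fin (n + 1)))).comp (Nat.measurable_floor.comp (measurable_subtype_coe.div_const _))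
  have hmem : ∀ s : Icc 0 T, ((κ s : ℕ) : ℝ) * (T / (n + 1)) ≤ s ∧
      (s : ℝ) ≤ ((κ s : ℕ) + 1 : ℝ) * (T / (n + 1)) := by
    intro s
    have hs0 : 0 ≤ (s : ℝ) / (T / (n + 1)) := div_nonneg s.2.1 hTN0.le
    constructor
    · rw [← le_div_iff₀ hTN0]
      exact (Nat.cast_le.2 (min_le_left _ _)).trans (Nat.floor_le hs0)
    · rcases le_total ⌊(s : ℝ) / (T / (n + 1))⌋₊ n with h | h
      · have : ((κ s : ℕ) : ℝ) = ⌊(s : ℝ) / (T / (n + 1))⌋₊ := by simp only [κ, min_eq_left h]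
        rw [this, ← div_le_iff₀ hTN0]
        exact (Nat.lt_floor_add_one _).le
      · have : ((κ s : ℕ) : ℝ) = n := by simp only [κ, min_eq_right h]
        rw [this, mul_div_cancel₀ T hN.ne']
        exact s.2.2
  refine ⟨n + 1, κ, hκm, fun k => ?_, fun k => ?_, fun s t hst => ?_⟩
  · have hk : ((k : ℕ) : ℝ) + 1 ≤ n + 1 := by exact_mod_cast k.2
    have hsub : Ioo ((k : ℕ) * (T / (n + 1))) (((k : ℕ) + 1 : ℝ) * (T / (n + 1))) ⊆
        Subtype.val '' (κ ⁻¹' {k}) := by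
      intro s hs
      have hs1 : (0 : ℝ) ≤ s := le_trans (by positivity) hs.1.le
      have hs2 : s ≤ T := by
        refine hs.2.le.trans ?_
        calc ((k : ℕ) + 1 : ℝ) * (T / (n + 1)) ≤ (n + 1) * (T / (n + 1)) := by gcongr
          _ = T := mul_div_cancel₀ T hN.ne'
      refine ⟨⟨s, hs1, hs2⟩, ?_, rfl⟩
      have hfl : ⌊s / (T / (n + 1))⌋₊ = k := by
        rw [Nat.floor_eq_iff (by positivity), le_div_iff₀ hTN0, div_lt_iff₀ hTN0]
        exact ⟨hs.1.le, hs.2⟩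
      refine mem_preimage.2 (mem_singleton_iff.2 (Fin.ext ?_))
      simp only [κ, hfl]
      exact min_eq_left (Nat.le_of_lt_succ k.2)
    rw [leb_apply]
    intro h0
    have := measure_mono_null hsub h0
    rw [Real.volume_Ioo, ENNReal.ofReal_eq_zero] at this
    linarith
  · have hsub : Subtype.val '' (κ ⁻¹' {k}) ⊆
        Icc ((k : ℕ) * (T / (n + 1))) (((k : ℕ) + 1 : ℝ) * (T / (n + 1))) := by
      rintro _ ⟨s, hs, rfl⟩
      have := hmem s
      rw [mem_preimage, mem_singleton_iff] at hs
      rwa [hs] at this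
    rw [leb_apply]
    refine (measure_mono hsub).trans ?_
    rw [Real.volume_Icc]
    refine ENNReal.ofReal_le_ofReal ?_
    linarith
  · have h1 := hmem s
    have h2 := hmem t
    rw [hst] at h1
    rw [Subtype.dist_eq, Real.dist_eq]
    refine abs_le.2 ⟨?_, ?_⟩ <;> linarith

/-- A set of positive measure meets one of finitely many short cells in positive measure. -/
theorem exists_subset_leb_le {T η : ℝ} (hT : 0 < T) (hη : 0 < η) {F : Set (Icc 0 T)}
    (hF : MeasurableSet F) (h0 : leb T F ≠ 0) :
    ∃ F' ⊆ F, MeasurableSet F' ∧ leb T F' ≠ 0 ∧ leb T F' ≤ ENNReal.ofReal η := by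
  obtain ⟨N, κ, hκ, -, hle, -⟩ := exists_partition hT hη
  by_contra! hcon
  refine h0 (measure_mono_null (t := ⋃ k, F ∩ κ ⁻¹' {k}) (fun s hs => ?_)
    (measure_iUnion_null fun k => ?_))
  · exact mem_iUnion.2 ⟨κ s, hs, rfl⟩
  · by_contra hk
    exact absurd ((measure_mono inter_subset_right).trans (hle k))
      (not_le.2 (hcon _ inter_subset_left
        (hF.inter (hκ (measurableSet_singleton k))) hk))

/-- Finitely many sets of positive measure contain small disjoint sets of positive measure. -/
theorem exists_pairwise_disjoint_subsets {T η : ℝ} (hT : 0 < T) (hη : 0 < η) {ι : Type*}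
    {F : ι → Set (Icc 0 T)} (hF : ∀ i, MeasurableSet (F i)) (h0 : ∀ i, leb T (F i) ≠ 0)
    (S : Finset ι) :
    ∃ F' : ι → Set (Icc 0 T), (∀ i, F' i ⊆ F i) ∧ (∀ i, MeasurableSet (F' i)) ∧
      (∀ i ∈ S, leb T (F' i) ≠ 0) ∧ (∀ i, leb T (F' i) ≤ ENNReal.ofReal η) ∧
      ∀ i ∈ S, ∀ j ∈ S, i ≠ j → Disjoint (F' i) (F' j) := by
  classical
  induction S using Finset.induction_on with
  | empty =>
    exact ⟨fun _ => ∅, fun _ => empty_subset _, fun _ => .empty, by simp, by simp, by simp⟩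
  | insert b S hb ih =>
    obtain ⟨F', hsub, hm, hpos, hle, hd⟩ := ih
    -- The new set has measure at most `r`, less than that of every earlier set, so it can be
    -- removed from each of them without making one null.
    obtain ⟨r, hr, hrη, hrF⟩ : ∃ r : ℝ, 0 < r ∧ r ≤ η ∧
        ∀ i ∈ S, ENNReal.ofReal r < leb T (F' i) := by
      clear hd hb
      induction S using Finset.induction_on with
      | empty => exact ⟨η, hη, le_refl _, by simp⟩
      | insert c S _ ih =>
        obtain ⟨r, hr, hrη, hrF⟩ := ih fun i hi => hpos i (Finset.mem_insert_of_mem hi)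
        have hc := hpos c (Finset.mem_insert_self c S)
        have hcr : 0 < (leb T (F' c)).toReal := ENNReal.toReal_pos hc (measure_ne_top _ _)
        refine ⟨min r ((leb T (F' c)).toReal / 2), lt_min hr (half_pos hcr),
          (min_le_left _ _).trans hrη, fun i hi => ?_⟩
        rcases Finset.mem_insert.1 hi with rfl | hi
        · rw [ENNReal.ofReal_lt_iff_lt_toReal (lt_min hr (half_pos hcr)).le (measure_ne_top _ _)]
          exact (min_le_right _ _).trans_lt (half_lt_self hcr)
        · exact (ENNReal.ofReal_le_ofReal (min_le_left _ _)).trans_lt (hrF i hi)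
    obtain ⟨Fb, hFb, hFbm, hFb0, hFbr⟩ := exists_subset_leb_le hT hr (hF b) (h0 b)
    refine ⟨fun i => if i = b then Fb else F' i \ Fb, fun i => ?_, fun i => ?_, fun i hi => ?_,
      fun i => ?_, fun i hi j hj hij => ?_⟩
    · by_cases h : i = b
      · simp only [h, if_true]
        exact hFb
      · simp only [h, if_false]
        exact sdiff_subset.trans (hsub i)
    · by_cases h : i = b
      · simp only [h, if_true]
        exact hFbm
      · simp only [h, if_false]
        exact (hm i).diff hFbm
    · by_cases h : i = b
      · simp only [h, if_true]
        exact hFb0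
      · simp only [h, if_false]
        intro hz
        have hi' := (Finset.mem_insert.1 hi).resolve_left h
        have h1 : leb T (F' i) ≤ leb T (F' i \ Fb) + leb T Fb :=
          (measure_mono (by rw [sdiff_union_self]; exact subset_union_left)).trans
            (measure_union_le _ _)
        rw [hz, zero_add] at h1
        exact absurd (h1.trans hFbr) (not_le.2 (hrF i hi'))
    · by_cases h : i = b
      · simp only [h, if_true]
        exact hFbr.trans (ENNReal.ofReal_le_ofReal hrη)
      · simp only [h, if_false]
        exact (measure_mono sdiff_subset).trans (hle i)
    · by_cases h : i = b
      · have hjb : j ≠ b := fun hj => hij (h.trans hj.symm)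
        simp only [h, if_true, hjb, if_false]
        exact disjoint_sdiff_right
      · by_cases h' : j = b
        · simp only [h, if_false, h', if_true]
          exact disjoint_sdiff_left
        · simp only [h, h', if_false]
          exact (hd i ((Finset.mem_insert.1 hi).resolve_left h) j
            ((Finset.mem_insert.1 hj).resolve_left h') hij).mono sdiff_subset sdiff_subset

/-! ### Averages in a slowly varying closed convex hull -/

/-- Continuity on a compact interval is uniform; a Lebesgue number of the cover by sets of
half-tolerance is the modulus. -/
theorem exists_uniform_hausdorffEDist {T : ℝ} {E : Type*} [NormedAddCommGroup E] {H : Icc 0 T → Set E}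
    (hH : ∀ t, Tendsto (fun s => Metric.hausdorffEDist (H s) (H t)) (𝓝 t) (𝓝 0)) {ε : ℝ}
    (hε : 0 < ε) :
    ∃ δ > 0, ∀ s t, dist s t < δ → Metric.hausdorffEDist (H s) (H t) ≤ ENNReal.ofReal ε := by
  have hε2 : (0 : ENNReal) < ENNReal.ofReal (ε / 2) := ENNReal.ofReal_pos.2 (half_pos hε)
  obtain ⟨δ, hδ, h⟩ := lebesgue_number_lemma_of_metric (isCompact_univ (X := Icc 0 T))
    (c := fun t => interior {s | Metric.hausdorffEDist (H s) (H t) < ENNReal.ofReal (ε / 2)})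
    (fun t => isOpen_interior)
    (fun t _ => mem_iUnion.2 ⟨t, mem_interior_iff_mem_nhds.2 ((hH t).eventually (gt_mem_nhds hε2))⟩)
  refine ⟨δ, hδ, fun s t hst => ?_⟩
  obtain ⟨r, hr⟩ := h t (mem_univ t)
  have h1 := interior_subset (hr (Metric.mem_ball.2 hst))
  have h2 := interior_subset (hr (Metric.mem_ball_self hδ))
  rw [mem_ofPred_eq] at h1 h2
  rw [Metric.hausdorffEDist_comm] at h2
  refine (Metric.hausdorffEDist_triangle (t := H r)).trans ?_
  refine (add_le_add h1.le h2.le).trans (le_of_eq ?_)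
  rw [← ENNReal.ofReal_add (half_pos hε).le (half_pos hε).le, add_halves]

section Convex

variable {T : ℝ} {E : Type*} [NormedAddCommGroup E] [NormedSpace ℝ E]

/-- If `p` is close to the closed convex hull of `V s` for all `s ∈ C`, then it is close to a
convex combination of points which are close to `V s` for many `s ∈ C`. -/
theorem exists_convexCombination {V : Icc 0 T → Set E} {C : Set (Icc 0 T)}
    (hC : leb T C ≠ 0) {net : Finset E} {ε : ℝ} (hε : 0 < ε)
    (hnet : ∀ s, ∀ v ∈ V s, ∃ c ∈ net, dist v c ≤ ε) {p : E}
    (hp : ∀ s ∈ C, p ∈ Metric.cthickening ε (closure (convexHull ℝ (V s)))) :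
    ∃ (J : Finset E) (w : E → ℝ), (∀ c ∈ J, leb T {s | s ∈ C ∧ ∃ v ∈ V s, dist v c ≤ ε} ≠ 0) ∧
      (∀ c ∈ J, 0 ≤ w c) ∧ ∑ c ∈ J, w c = 1 ∧ dist p (∑ c ∈ J, w c • c) ≤ 3 * ε := by
  classical
  let Z : E → Set (Icc 0 T) := fun c => {s | s ∈ C ∧ ∃ v ∈ V s, dist v c ≤ ε}
  let J := net.filter fun c => leb T (Z c) ≠ 0
  -- Removing the finitely many null sets `Z c` does not exhaust `C`. At a remaining point `s`,
  -- every net point near `V s` is near `V s'` for a set of `s'` of positive measure.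
  obtain ⟨s, hsC, hs⟩ : ∃ s ∈ C, ∀ c ∈ net, s ∈ Z c → c ∈ J := by
    by_contra! hcon
    refine hC (measure_mono_null (t := ⋃ c ∈ {c | c ∈ net ∧ leb T (Z c) = 0}, Z c)
      (fun s hs => ?_) ?_)
    · obtain ⟨c, hc, hsc, hcJ⟩ := hcon s hs
      have : leb T (Z c) = 0 := by
        by_contra h
        exact hcJ (Finset.mem_filter.2 ⟨hc, h⟩)
      exact mem_biUnion (show c ∈ {c | c ∈ net ∧ leb T (Z c) = 0} from ⟨hc, this⟩) hsc
    · refine (measure_biUnion_null_iff (Set.Finite.countable ?_)).2 fun c hc => hc.2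
      exact net.finite_toSet.subset fun c hc => hc.1
  have hVJ : V s ⊆ Metric.cthickening ε (convexHull ℝ (J : Set E)) := fun v hv => by
    obtain ⟨c, hc, hvc⟩ := hnet s v hv
    exact Metric.mem_cthickening_of_dist_le v c ε _
      (subset_convexHull ℝ _ (hs c hc ⟨hsC, v, hv, hvc⟩)) hvc
  have hhull : closure (convexHull ℝ (V s)) ⊆ Metric.cthickening ε (convexHull ℝ (J : Set E)) :=
    closure_minimal (convexHull_min hVJ ((convex_convexHull ℝ _).cthickening ε))
      Metric.isClosed_cthickening
  have h2 : p ∈ Metric.cthickening (ε + ε) (convexHull ℝ (J : Set E)) :=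
    Metric.cthickening_cthickening_subset hε.le hε.le _
      (Metric.cthickening_subset_of_subset ε hhull (hp s hsC))
  -- The radii add up to `2 * ε`; the third `ε` pays for passing from a closed to an open
  -- thickening, which supplies an actual nearby point of the hull.
  obtain ⟨z, hz, hpz⟩ := Metric.mem_thickening_iff.1
    (Metric.cthickening_subset_thickening' (δ₂ := 3 * ε) (by linarith) (by linarith) _ h2)
  obtain ⟨w, hw0, hw1, rfl⟩ := Finset.mem_convexHull'.1 hz
  exact ⟨J, w, fun c hc => (Finset.mem_filter.1 hc).2, hw0, hw1, hpz.le⟩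

/-- Over a small cell, the integral of a selection of a slowly varying convex hull is close to a
positive combination of points which are close to `V s` for many `s`. -/
theorem exists_combination_near_setIntegral [CompleteSpace E] {V : Icc 0 T → Set E}
    {C : Set (Icc 0 T)} (hCm : MeasurableSet C) (hC : leb T C ≠ 0) {net : Finset E} {ε : ℝ}
    (hε : 0 < ε) (hnet : ∀ s, ∀ v ∈ V s, ∃ c ∈ net, dist v c ≤ ε)
    (hV : ∀ s ∈ C, ∀ t ∈ C, Metric.hausdorffEDist (closure (convexHull ℝ (V s)))
      (closure (convexHull ℝ (V t))) ≤ ENNReal.ofReal ε)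
    {θ : Measure (Icc 0 T)} [IsFiniteMeasure θ] {v : Icc 0 T → E} (hv : Integrable v θ)
    (hvV : ∀ᵐ t ∂θ, v t ∈ closure (convexHull ℝ (V t))) :
    ∃ (J : Finset E) (w : E → ℝ), (∀ c ∈ J, leb T {s | s ∈ C ∧ ∃ v ∈ V s, dist v c ≤ ε} ≠ 0) ∧
      (∀ c ∈ J, 0 ≤ w c) ∧ ∑ c ∈ J, w c = θ.real C ∧
      dist (∫ t in C, v t ∂θ) (∑ c ∈ J, w c • c) ≤ 3 * ε * θ.real C := by
  by_cases hθ : θ C = 0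
  · refine ⟨∅, 0, by simp, by simp, ?_, ?_⟩
    · simp [Measure.real, hθ]
    · rw [Measure.restrict_eq_zero.2 hθ]
      simp [Measure.real, hθ]
  have hpos : 0 < θ.real C := ENNReal.toReal_pos hθ (measure_ne_top _ _)
  -- Over the cell all hulls lie in the closed `ε`-thickening of the one at `s`, which is closed and
  -- convex and so contains the average.
  have hp : ∀ s ∈ C, ⨍ t in C, v t ∂θ ∈
      Metric.cthickening ε (closure (convexHull ℝ (V s))) := by
    intro s hs
    refine ((convex_convexHull ℝ _).closure.cthickening ε).set_average_mem
      Metric.isClosed_cthickening hθ (measure_ne_top _ _) ?_ hv.integrableOn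
    rw [ae_restrict_iff' hCm]
    filter_upwards [hvV] with t ht htC
    rw [Metric.mem_cthickening_iff]
    exact (Metric.infEDist_le_hausdorffEDist_of_mem ht).trans (hV t htC s hs)
  obtain ⟨J, w, hJ, hw0, hw1, hd⟩ := exists_convexCombination hC hε hnet hp
  refine ⟨J, fun c => θ.real C * w c, hJ, fun c hc => mul_nonneg hpos.le (hw0 c hc), ?_, ?_⟩
  · rw [← Finset.mul_sum, hw1, mul_one]
  · have h1 : ∫ t in C, v t ∂θ = θ.real C • ⨍ t in C, v t ∂θ := by
      rw [setAverage_eq, smul_smul, mul_inv_cancel₀ hpos.ne', one_smul]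
    have h2 : ∑ c ∈ J, (θ.real C * w c) • c = θ.real C • ∑ c ∈ J, w c • c := by
      rw [Finset.smul_sum]
      exact Finset.sum_congr rfl fun c _ => mul_smul _ _ _
    rw [h1, h2, dist_smul₀, Real.norm_of_nonneg hpos.le, mul_comm]
    exact mul_le_mul_of_nonneg_right hd hpos.le

end Convex

namespace ImpulsiveSystem

variable {n m q N : ℕ} (S : ImpulsiveSystem n m q N)

/-! ### Approximation of impulsive controls by absolutely continuous ones -/

/-- The pair `(𝔥, 𝔤)`. -/
def hgfrak (t : S.I) (a : Fin q → ℝ) (w : Fin m → ℝ) : (Fin m → ℝ) × (Fin n → ℝ) :=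
  (S.hfrak t a w, S.gfrak t a w)

/-- The set `(𝔥, 𝔤)(t, A(t), K̃)`. -/
def values (t : S.I) : Set ((Fin m → ℝ) × (Fin n → ℝ)) :=
  {v | ∃ a ∈ S.A t, ∃ w ∈ S.Ktilde, v = S.hgfrak t a w}

variable {S}

theorem norming_pos (t : S.I) (a : Fin q → ℝ) (w : Fin m → ℝ) : 0 < S.norming t a w :=
  add_pos_of_pos_of_nonneg one_pos (Finset.sum_nonneg fun _ _ => abs_nonneg _)

theorem isClosed_Ktilde : IsClosed S.Ktilde := by
  have : S.Ktilde = S.K ∩ ⋂ j, {w | |w j| ≤ 1} := by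
    ext w
    simp [Ktilde]
  rw [this]
  exact S.K_closed.inter (isClosed_iInter fun j =>
    isClosed_le (continuous_apply j).abs continuous_const)

theorem measurable_lebesgueI {E : Type*} [MeasurableSpace E] {g : S.I → E} (hg : Measurable g) :
    Measurable (α := S.LebesgueI) g := fun _ hB => (hg hB).nullMeasurableSet

theorem aestronglyMeasurable_of_measurable_lebesgueI {E : Type*} [NormedAddCommGroup E]
    [SecondCountableTopology E] [MeasurableSpace E] [BorelSpace E] {g : S.I → E}
    (hg : Measurable (α := S.LebesgueI) g) : AEStronglyMeasurable g (leb S.T) := by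
  have h : NullMeasurable g (leb S.T) := fun _ hB => hg hB
  exact h.aemeasurable.aestronglyMeasurable

theorem measurable_hgfrak (hG : S.MeasurableFastDynamics) :
    Measurable fun p : S.LebesgueI × ((Fin q → ℝ) × (Fin m → ℝ)) =>
      S.hgfrak p.1 p.2.1 p.2.2 := by
  have hGc : ∀ i j, Measurable fun p : S.LebesgueI × ((Fin q → ℝ) × (Fin m → ℝ)) =>
      S.G p.1 p.2.1 i j := fun i j =>
    (hG i j).comp (measurable_fst.prodMk (measurable_fst.comp measurable_snd))
  have hw : ∀ j, Measurable fun p : S.LebesgueI × ((Fin q → ℝ) × (Fin m → ℝ)) => p.2.2 j :=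
    fun j => (measurable_pi_apply j).comp (measurable_snd.comp measurable_snd)
  have hGw : ∀ i, Measurable fun p : S.LebesgueI × ((Fin q → ℝ) × (Fin m → ℝ)) =>
      ∑ j, S.G p.1 p.2.1 i j * p.2.2 j := fun i =>
    Finset.measurable_fun_sum _ fun j _ => (hGc i j).mul (hw j)
  have hN : Measurable fun p : S.LebesgueI × ((Fin q → ℝ) × (Fin m → ℝ)) =>
      (S.norming p.1 p.2.1 p.2.2)⁻¹ :=
    ((Finset.measurable_fun_sum _ fun i _ => (hGw i).norm).const_add 1).inv
  exact (measurable_pi_iff.2 fun j => hN.mul (hw j)).prodMk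
    (measurable_pi_iff.2 fun i => hN.mul (hGw i))

theorem aestronglyMeasurable_hgfrak (hG : S.MeasurableFastDynamics) {a : S.I → Fin q → ℝ}
    {w : S.I → Fin m → ℝ} (ha : Measurable a) (hw : Measurable w) :
    AEStronglyMeasurable (fun s => S.hgfrak s (a s) (w s)) (leb S.T) := by
  have ha' : Measurable (α := S.LebesgueI) a := measurable_lebesgueI ha
  have hw' : Measurable (α := S.LebesgueI) w := measurable_lebesgueI hw
  have h1 : Measurable fun s : S.LebesgueI => (s, (a s, w s)) :=
    measurable_id.prodMk (ha'.prodMk hw')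
  have h2 := Measurable.comp (measurable_hgfrak hG) h1
  exact aestronglyMeasurable_of_measurable_lebesgueI fun _ hB => h2 hB

/-- The graph condition, `Ktilde` and the closeness to `c` cut out a measurable set of triples `(s,
a, w)`. A selection on some set of positive measure suffices, because the approximating density may
be concentrated on arbitrarily small sets. -/
theorem exists_control_selection (hA : S.MeasurableGraph) (hG : S.MeasurableFastDynamics)
    {C : Set S.I} (hC : MeasurableSet C) {c : (Fin m → ℝ) × (Fin n → ℝ)} {ε : ℝ}
    (h : leb S.T {s | s ∈ C ∧ ∃ v ∈ S.values s, dist v c ≤ ε} ≠ 0) :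
    ∃ F ⊆ C, MeasurableSet F ∧ leb S.T F ≠ 0 ∧ ∃ (a : S.I → Fin q → ℝ) (w : S.I → Fin m → ℝ),
      Measurable a ∧ Measurable w ∧
      ∀ s ∈ F, a s ∈ S.A s ∧ w s ∈ S.Ktilde ∧ dist (S.hgfrak s (a s) (w s)) c ≤ ε := by
  let D : Set (S.I × ((Fin q → ℝ) × (Fin m → ℝ))) :=
    {p | p.1 ∈ C ∧ p.2.1 ∈ S.A p.1 ∧ p.2.2 ∈ S.Ktilde ∧ dist (S.hgfrak p.1 p.2.1 p.2.2) c ≤ ε}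
  have hD : MeasurableSet (α := S.LebesgueI × ((Fin q → ℝ) × (Fin m → ℝ))) D := by
    have h1 : MeasurableSet (α := S.LebesgueI × ((Fin q → ℝ) × (Fin m → ℝ)))
        {p | p.1 ∈ C} := measurable_fst (show MeasurableSet (α := S.LebesgueI) C from
          hC.nullMeasurableSet)
    have h2 : MeasurableSet (α := S.LebesgueI × ((Fin q → ℝ) × (Fin m → ℝ)))
        {p | p.2.1 ∈ S.A p.1} :=
      (measurable_fst.prodMk (measurable_fst.comp measurable_snd)) hA
    have h3 : MeasurableSet (α := S.LebesgueI × ((Fin q → ℝ) × (Fin m → ℝ)))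
        {p | p.2.2 ∈ S.Ktilde} :=
      (measurable_snd.comp measurable_snd) isClosed_Ktilde.measurableSet
    have h4 : MeasurableSet (α := S.LebesgueI × ((Fin q → ℝ) × (Fin m → ℝ)))
        {p | dist (S.hgfrak p.1 p.2.1 p.2.2) c ≤ ε} :=
      measurable_hgfrak hG (Metric.isClosed_closedBall (x := c) (ε := ε)).measurableSet
    exact h1.inter (h2.inter (h3.inter h4))
  have hpos : leb S.T {s | ∃ y, (s, y) ∈ D} ≠ 0 := by
    intro h0
    refine h (measure_mono_null ?_ h0)
    rintro s ⟨hs, v, ⟨a, ha, w, hw, rfl⟩, hv⟩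
    exact ⟨(a, w), hs, ha, hw, hv⟩
  obtain ⟨F, hF, hF0, τ, hτ, hsel⟩ := exists_measurable_selection hD hpos
  exact ⟨F, fun s hs => (hsel s hs).1, hF, hF0, fun s => (τ s).1, fun s => (τ s).2,
    measurable_fst.comp hτ, measurable_snd.comp hτ, fun s hs => (hsel s hs).2⟩

/-- **Approximation of a control** by an absolutely continuous one, concentrated on a small set:
`v θ` stands for the pair `(μ, G μ)`, and `u ds` for the approximation of `μ`. -/
theorem exists_absolutelyContinuous_approx (hA : S.MeasurableGraph)
    (hG : S.MeasurableFastDynamics) (hhull : S.ContinuousHull) (hK0 : (0 : Fin m → ℝ) ∈ S.K)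
    {R : ℝ} (hR : ∀ t, ∀ v ∈ S.hull t, ‖v‖ ≤ R) {θ : Measure S.I}
    [IsFiniteMeasure θ] {v : S.I → (Fin m → ℝ) × (Fin n → ℝ)} (hv : Integrable v θ)
    (hvV : ∀ᵐ t ∂θ, v t ∈ S.hull t) {α : S.I → Fin q → ℝ} (hα : Measurable α)
    (hαA : ∀ᵐ t ∂(leb S.T), α t ∈ S.A t) {ε : ℝ} (hε : 0 < ε) :
    ∃ (M : ℕ) (κ : S.I → Fin M) (α' : S.I → Fin q → ℝ) (u : S.I → Fin m → ℝ),
      Measurable κ ∧ (∀ s t, κ s = κ t → dist s t ≤ ε) ∧ Measurable α' ∧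
      (∀ᵐ t ∂(leb S.T), α' t ∈ S.A t) ∧ leb S.T {t | α' t ≠ α t} ≤ ENNReal.ofReal ε ∧
      (∀ t, u t ∈ S.K) ∧
      Integrable (fun s => (u s, (S.G s (α' s)).mulVec (u s))) (leb S.T) ∧
      (∀ k, ∫ s in κ ⁻¹' {k}, ‖(u s, (S.G s (α' s)).mulVec (u s))‖ ∂(leb S.T) ≤
        R * θ.real (κ ⁻¹' {k})) ∧
      ∀ k, dist (∫ s in κ ⁻¹' {k}, (u s, (S.G s (α' s)).mulVec (u s)) ∂(leb S.T))
        (∫ s in κ ⁻¹' {k}, v s ∂θ) ≤ 4 * ε * θ.real (κ ⁻¹' {k}) := by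
  classical
  have hRv : ∀ t, ∀ v ∈ S.values t, ‖v‖ ≤ R := fun t v hv =>
    hR t v (subset_closure (subset_convexHull ℝ _ hv))
  obtain ⟨net₀, -, hfin, hcov⟩ := (isCompact_closedBall
    (0 : (Fin m → ℝ) × (Fin n → ℝ)) R).finite_cover_balls hε
  have hnet : ∀ s, ∀ v ∈ S.values s, ∃ c ∈ hfin.toFinset, dist v c ≤ ε := by
    intro s v hv
    obtain ⟨c, hc, hvc⟩ := mem_iUnion₂.1 (hcov (mem_closedBall_zero_iff.2 (hRv s v hv)))
    exact ⟨c, hfin.mem_toFinset.2 hc, (Metric.mem_ball.1 hvc).le⟩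
  obtain ⟨δ, hδ, hunif⟩ := exists_uniform_hausdorffEDist hhull.2 hε
  obtain ⟨M, κ, hκ, hκ0, -, hκd⟩ := exists_partition S.T_pos (lt_min (half_pos hδ) hε)
  have hcell : ∀ k, MeasurableSet (κ ⁻¹' {k}) := fun k => hκ (measurableSet_singleton k)
  have hcomb := fun k => exists_combination_near_setIntegral (hcell k) (hκ0 k) hε hnet
    (fun s hs t ht => hunif s t (((hκd s t (hs.trans ht.symm)).trans
      (min_le_left _ _)).trans_lt (half_lt_self hδ))) hv hvV
  choose J W hJ hW0 hW1 hWd using hcomb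
  -- One index for each cell and each net point used in that cell.
  let ι := Σ k, J k
  have hsel := fun i : ι => exists_control_selection hA hG (hcell i.1) (hJ i.1 i.2 i.2.2)
  choose F₀ hF₀C hF₀m hF₀0 a w ha hw hsel using hsel
  have hcard : (0 : ℝ) < Fintype.card ι + 1 := by positivity
  -- Each set has measure at most `ε / (card ι + 1)`, so their union has measure at most `ε`; the `+
  -- 1` covers an empty index set.
  obtain ⟨F, hFF₀, hF, hF0, hFη, hFd⟩ := exists_pairwise_disjoint_subsets S.T_pos
    (div_pos hε hcard) hF₀m hF₀0 (Finset.univ : Finset ι)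
  have huniq : ∀ {i j : ι} {s}, s ∈ F i → s ∈ F j → j = i := by
    intro i j s hi hj
    by_contra hij
    exact disjoint_left.1 (hFd j (Finset.mem_univ j) i (Finset.mem_univ i) hij) hj hi
  have hFpos : ∀ i, 0 < (leb S.T).real (F i) := fun i =>
    ENNReal.toReal_pos (hF0 i (Finset.mem_univ i)) (measure_ne_top _ _)
  -- Dividing by the length of `F i` makes the coefficient have total mass `W i.1 i.2` on `F i`,
  -- however short that set is.
  let coef : ι → ℝ := fun i => W i.1 i.2 / (leb S.T).real (F i)
  have hcoef0 : ∀ i, 0 ≤ coef i := fun i => div_nonneg (hW0 _ _ i.2.2) (hFpos i).le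
  have hcoef : ∀ i, coef i * (leb S.T).real (F i) = W i.1 i.2 := fun i =>
    div_mul_cancel₀ _ (hFpos i).ne'
  let g : ι → S.I → (Fin m → ℝ) × (Fin n → ℝ) := fun i s =>
    coef i • S.hgfrak s (a i s) (w i s)
  have hsel' : ∀ i, ∀ s ∈ F i, a i s ∈ S.A s ∧ w i s ∈ S.Ktilde ∧
      dist (S.hgfrak s (a i s) (w i s)) i.2 ≤ ε := fun i s hs => hsel i s (hFF₀ i hs)
  have hvalR : ∀ i, ∀ s ∈ F i, ‖S.hgfrak s (a i s) (w i s)‖ ≤ R := fun i s hs =>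
    hRv s _ ⟨_, (hsel' i s hs).1, _, (hsel' i s hs).2.1, rfl⟩
  have hvalint : ∀ i, IntegrableOn (fun s => S.hgfrak s (a i s) (w i s)) (F i) (leb S.T) := by
    intro i
    refine Integrable.of_bound (C := R)
      (aestronglyMeasurable_hgfrak hG (ha i) (hw i)).restrict ?_
    rw [ae_restrict_iff' (hF i)]
    exact Eventually.of_forall (hvalR i)
  let y : S.I → (Fin m → ℝ) × (Fin n → ℝ) := fun s => ∑ i, (F i).indicator (g i) s
  have hyF : ∀ i, ∀ s ∈ F i, y s = g i s := by
    intro i s hs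
    simp only [y]
    rw [Finset.sum_eq_single i, indicator_of_mem hs]
    · intro j _ hj
      exact indicator_of_notMem (fun hsj => hj (huniq hs hsj)) _
    · intro h
      exact absurd (Finset.mem_univ i) h
  have hy0 : ∀ s, (¬∃ i, s ∈ F i) → y s = 0 := fun s hs =>
    Finset.sum_eq_zero fun i _ => indicator_of_notMem (fun h => hs ⟨i, h⟩) _
  let α' : S.I → Fin q → ℝ := fun s => if h : ∃ i, s ∈ F i then a h.choose s else α s
  have hαF : ∀ i, ∀ s ∈ F i, α' s = a i s := by
    intro i s hs
    have h : ∃ i, s ∈ F i := ⟨i, hs⟩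
    have hi : h.choose = i := huniq hs h.choose_spec
    simp only [α', dif_pos h, hi]
  have hα0 : ∀ s, (¬∃ i, s ∈ F i) → α' s = α s := fun s hs => dif_neg hs
  -- Since `𝔤` is `G` applied to `𝔥` with the same normalisation, approximating the pair by `y` is
  -- the same as approximating `μ` by the first component under the modified control.
  have hpair : ∀ s, ((y s).1, (S.G s (α' s)).mulVec (y s).1) = y s := by
    intro s
    by_cases h : ∃ i, s ∈ F i
    · obtain ⟨i, hi⟩ := h
      rw [hyF i s hi, hαF i s hi]
      refine Prod.ext rfl ?_
      simp only [g, hgfrak, hfrak, gfrak, Prod.smul_fst, Prod.smul_snd, Matrix.mulVec_smul]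
    · rw [hy0 s h]
      simp
  have hyint : Integrable y (leb S.T) :=
    integrable_finsetSum _ fun i _ =>
      (integrable_indicator_iff (hF i)).2 ((hvalint i).smul (coef i))
  have hsub : ∀ i : ι, F i ⊆ κ ⁻¹' {i.1} := fun i => (hFF₀ i).trans (hF₀C i)
  have hcellint : ∀ {E : Type} [NormedAddCommGroup E] [NormedSpace ℝ E] (f : ι → S.I → E) (k),
      (∀ i, IntegrableOn (f i) (F i) (leb S.T)) →
      ∫ s in κ ⁻¹' {k}, ∑ i, (F i).indicator (f i) s ∂(leb S.T) =
        ∑ c : J k, ∫ s in F ⟨k, c⟩, f ⟨k, c⟩ s ∂(leb S.T) := by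
    intro E _ _ f k hf
    rw [integral_finsetSum _ fun i _ =>
      ((integrable_indicator_iff (hF i)).2 (hf i)).integrableOn, Fintype.sum_sigma,
      Finset.sum_eq_single k]
    · refine Finset.sum_congr rfl fun c _ => ?_
      rw [setIntegral_indicator (hF _), inter_eq_right.2 (hsub ⟨k, c⟩)]
    · intro k' _ hk'
      refine Finset.sum_eq_zero fun c _ => ?_
      rw [setIntegral_indicator (hF _)]
      have : κ ⁻¹' {k} ∩ F ⟨k', c⟩ = ∅ := by
        refine eq_empty_of_forall_notMem fun s hs => hk' ?_
        have h1 : κ s = k := hs.1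
        have h2 : κ s = k' := hsub _ hs.2
        exact h2.symm.trans h1
      rw [this, Measure.restrict_empty, integral_zero_measure]
    · intro h
      exact absurd (Finset.mem_univ k) h
  have hWsum : ∀ k, ∑ c : J k, W k c = θ.real (κ ⁻¹' {k}) := fun k => by
    rw [← hW1 k, Finset.sum_coe_sort (J k) (W k)]
  have hynorm : ∀ k, ∫ s in κ ⁻¹' {k}, ‖y s‖ ∂(leb S.T) ≤ R * θ.real (κ ⁻¹' {k}) := by
    intro k
    have hle : ∀ s, ‖y s‖ ≤ ∑ i, (F i).indicator (fun _ => coef i * R) s := by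
      intro s
      refine (norm_sum_le _ _).trans (Finset.sum_le_sum fun i _ => ?_)
      by_cases hs : s ∈ F i
      · rw [indicator_of_mem hs, indicator_of_mem hs, norm_smul, Real.norm_of_nonneg (hcoef0 i)]
        exact mul_le_mul_of_nonneg_left (hvalR i s hs) (hcoef0 i)
      · rw [indicator_of_notMem hs, indicator_of_notMem hs, norm_zero]
    refine (integral_mono hyint.norm.integrableOn ?_ hle).trans (le_of_eq ?_)
    · exact (integrable_finsetSum _ fun i _ =>
        (integrable_indicator_iff (hF i)).2 (integrable_const _).integrableOn).integrableOn
    · rw [hcellint (fun i _ => coef i * R) k fun i => integrable_const _, ← hWsum k,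
        Finset.mul_sum]
      refine Finset.sum_congr rfl fun c _ => ?_
      rw [setIntegral_const, smul_eq_mul, ← hcoef ⟨k, c⟩]
      ring
  have hycell : ∀ k, dist (∫ s in κ ⁻¹' {k}, y s ∂(leb S.T)) (∑ c ∈ J k, W k c • c) ≤
      ε * θ.real (κ ⁻¹' {k}) := by
    intro k
    rw [hcellint g k fun i => (hvalint i).smul (coef i),
      ← Finset.sum_coe_sort (J k) fun c => W k c • c, ← hWsum k, Finset.mul_sum]
    refine (dist_sum_sum_le _ _ _).trans (Finset.sum_le_sum fun c _ => ?_)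
    have h1 : ∫ s in F ⟨k, c⟩, g ⟨k, c⟩ s ∂(leb S.T) - W k c • (c : (Fin m → ℝ) × (Fin n → ℝ)) =
        coef ⟨k, c⟩ • ∫ s in F ⟨k, c⟩,
          (S.hgfrak s (a ⟨k, c⟩ s) (w ⟨k, c⟩ s) - (c : (Fin m → ℝ) × (Fin n → ℝ)))
          ∂(leb S.T) := by
      rw [integral_sub (hvalint _) (integrable_const _), setIntegral_const, smul_sub, smul_smul,
        hcoef ⟨k, c⟩, ← integral_smul]
    rw [dist_eq_norm, h1, norm_smul, Real.norm_of_nonneg (hcoef0 _), ← hcoef ⟨k, c⟩]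
    have h2 := norm_setIntegral_le_of_norm_le_const (μ := leb S.T) (s := F ⟨k, c⟩) (C := ε)
      (f := fun s => S.hgfrak s (a ⟨k, c⟩ s) (w ⟨k, c⟩ s) - (c : (Fin m → ℝ) × (Fin n → ℝ)))
      (measure_lt_top _ _) (fun s hs => by
        rw [← dist_eq_norm]
        exact (hsel' ⟨k, c⟩ s hs).2.2)
    calc coef ⟨k, c⟩ * _ ≤ coef ⟨k, c⟩ * (ε * (leb S.T).real (F ⟨k, c⟩)) :=
          mul_le_mul_of_nonneg_left h2 (hcoef0 _)
      _ = _ := by ring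
  refine ⟨M, κ, α', fun s => (y s).1, hκ, fun s t hst => (hκd s t hst).trans (min_le_right _ _),
    ?_, ?_, ?_, ?_, ?_, ?_, ?_⟩
  · intro B hB
    have : α' ⁻¹' B = (⋃ i, F i ∩ a i ⁻¹' B) ∪ ((⋃ i, F i)ᶜ ∩ α ⁻¹' B) := by
      ext s
      by_cases h : ∃ i, s ∈ F i
      · obtain ⟨i, hi⟩ := h
        simp only [mem_preimage, mem_union, mem_iUnion, mem_inter_iff, mem_compl_iff, hαF i s hi]
        constructor
        · exact fun hB => Or.inl ⟨i, hi, hB⟩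
        · rintro (⟨j, hj, hjB⟩ | ⟨hn, _⟩)
          · rwa [huniq hi hj] at hjB
          · exact absurd ⟨i, hi⟩ hn
      · have h' : ∀ i, s ∉ F i := fun i hi => h ⟨i, hi⟩
        simp only [mem_preimage, mem_union, mem_iUnion, mem_inter_iff, mem_compl_iff, hα0 s h, h',
          false_and, exists_false, not_false_eq_true, true_and, false_or]
    rw [this]
    exact (MeasurableSet.iUnion fun i => (hF i).inter (ha i hB)).union
      ((MeasurableSet.iUnion hF).compl.inter (hα hB))
  · filter_upwards [hαA] with s hs
    by_cases h : ∃ i, s ∈ F i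
    · obtain ⟨i, hi⟩ := h
      rw [hαF i s hi]
      exact (hsel' i s hi).1
    · rwa [hα0 s h]
  · have hsub' : {t | α' t ≠ α t} ⊆ ⋃ i ∈ (Finset.univ : Finset ι), F i := by
      intro s hs
      by_contra hn
      refine hs (hα0 s fun ⟨i, hi⟩ => hn ?_)
      exact mem_biUnion (Finset.mem_univ i) hi
    refine (measure_mono hsub').trans ((measure_biUnion_finset_le _ _).trans
      ((Finset.sum_le_sum fun i _ => hFη i).trans ?_))
    rw [Finset.sum_const, Finset.card_univ, nsmul_eq_mul, ← ENNReal.ofReal_natCast,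
      ← ENNReal.ofReal_mul (Nat.cast_nonneg _)]
    refine ENNReal.ofReal_le_ofReal ?_
    rw [mul_div_assoc', div_le_iff₀ hcard]
    nlinarith
  · intro s
    beta_reduce
    by_cases h : ∃ i, s ∈ F i
    · obtain ⟨i, hi⟩ := h
      rw [hyF i s hi]
      change coef i • (S.norming s (a i s) (w i s))⁻¹ • w i s ∈ S.K
      rcases (hcoef0 i).eq_or_lt with h0 | h0
      · rwa [← h0, zero_smul]
      · exact S.K_cone _ (S.K_cone _ (hsel' i s hi).2.1.1 _ (inv_pos.2 (norming_pos _ _ _))) _ h0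
    · rw [hy0 s h]
      exact hK0
  · simpa only [hpair] using hyint
  · simpa only [hpair] using hynorm
  · intro k
    simp only [hpair]
    -- The bound `4 * ε` is `ε` for replacing selected values by net points plus `3 * ε` for the
    -- convex combination.
    refine (dist_triangle_right _ _ _).trans ((add_le_add (hycell k) (hWd k)).trans (le_of_eq ?_))
    ring

end ImpulsiveSystem

/-! ### Convergence of approximations on fine partitions -/

/-- The measure `y ds` is close to `v θ` on the cells of a partition of mesh at most `ε`. -/
structure CellApprox {T : ℝ} {E : Type*} [NormedAddCommGroup E] [NormedSpace ℝ E]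
    (θ : Measure (Icc 0 T)) (v y : Icc 0 T → E) (R ε : ℝ) : Prop where
  integrable : Integrable y (leb T)
  exists_cells : ∃ (M : ℕ) (κ : Icc 0 T → Fin M), Measurable κ ∧
    (∀ s t, κ s = κ t → dist s t ≤ ε) ∧
    (∀ k, ∫ s in κ ⁻¹' {k}, ‖y s‖ ∂(leb T) ≤ R * θ.real (κ ⁻¹' {k})) ∧
    ∀ k, dist (∫ s in κ ⁻¹' {k}, y s ∂(leb T)) (∫ s in κ ⁻¹' {k}, v s ∂θ) ≤
      4 * ε * θ.real (κ ⁻¹' {k})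

theorem integral_eq_sum_fiber {X E : Type*} [MeasurableSpace X] [NormedAddCommGroup E]
    [NormedSpace ℝ E] {θ : Measure X} {M : ℕ} {κ : X → Fin M} (hκ : Measurable κ) {g : X → E}
    (hg : Integrable g θ) : ∫ s, g s ∂θ = ∑ k, ∫ s in κ ⁻¹' {k}, g s ∂θ := by
  rw [← integral_iUnion_fintype (fun k => hκ (measurableSet_singleton k)) ?_
    fun k => hg.integrableOn]
  · rw [← preimage_iUnion, iUnion_of_singleton, preimage_univ, setIntegral_univ]
  · intro i j hij
    exact Disjoint.preimage κ (disjoint_singleton.2 hij)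

theorem sum_real_fiber_inter {X : Type*} [MeasurableSpace X] {θ : Measure X} [IsFiniteMeasure θ]
    {M : ℕ} {κ : X → Fin M} (hκ : Measurable κ) (B : Set X) :
    ∑ k, θ.real (κ ⁻¹' {k} ∩ B) = θ.real B := by
  have h := integral_eq_sum_fiber (θ := θ.restrict B) hκ (integrable_const (1 : ℝ))
  simp only [integral_const, smul_eq_mul, mul_one] at h
  rw [Measure.real, Measure.restrict_apply_univ] at h
  rw [Measure.real, h]
  refine Finset.sum_congr rfl fun k _ => ?_
  rw [measureReal_restrict_apply_univ, measureReal_restrict_apply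
    (hκ (measurableSet_singleton k))]

namespace CellApprox

variable {T : ℝ} {E : Type*} [NormedAddCommGroup E] [NormedSpace ℝ E]
  {θ : Measure (Icc 0 T)} [IsFiniteMeasure θ] {v y : Icc 0 T → E} {R ε : ℝ}

theorem integral_norm_le (h : CellApprox θ v y R ε) :
    ∫ s, ‖y s‖ ∂(leb T) ≤ R * θ.real univ := by
  obtain ⟨M, κ, hκ, -, hn, -⟩ := h.exists_cells
  rw [integral_eq_sum_fiber hκ h.integrable.norm]
  have := sum_real_fiber_inter (θ := θ) hκ univ
  simp only [inter_univ] at this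
  rw [← this, Finset.mul_sum]
  exact Finset.sum_le_sum fun k _ => hn k

/-- Freezing `ψ` at one point of the cell costs the oscillation `o` times the mass on each side; the
frozen value, at most `C`, multiplies the discrepancy of the two integrals over the cell. -/
theorem norm_setIntegral_sub_le {κ : Set (Icc 0 T)} (hκ : MeasurableSet κ)
    (hy : Integrable y (leb T)) (hv : Integrable v θ) (hvR : ∀ᵐ t ∂θ, ‖v t‖ ≤ R)
    (hn : ∫ s in κ, ‖y s‖ ∂(leb T) ≤ R * θ.real κ)
    (hd : dist (∫ s in κ, y s ∂(leb T)) (∫ s in κ, v s ∂θ) ≤ 4 * ε * θ.real κ)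
    {ψ : Icc 0 T → ℝ} (hψ : Measurable ψ) {C : ℝ} (hC : ∀ t, |ψ t| ≤ C) (hC0 : 0 ≤ C) {o : ℝ}
    (ho : 0 ≤ o) (hosc : ∀ s ∈ κ, ∀ t ∈ κ, |ψ s - ψ t| ≤ o) :
    ‖∫ s in κ, ψ s • y s ∂(leb T) - ∫ s in κ, ψ s • v s ∂θ‖ ≤
      (2 * R * o + 4 * ε * C) * θ.real κ := by
  rcases κ.eq_empty_or_nonempty with rfl | ⟨s₀, hs₀⟩
  · simp
  have hψy : Integrable (fun s => ψ s • y s) (leb T) :=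
    hy.bdd_smul C hψ.aestronglyMeasurable (Eventually.of_forall hC)
  have hψv : Integrable (fun s => ψ s • v s) θ :=
    hv.bdd_smul C hψ.aestronglyMeasurable (Eventually.of_forall hC)
  have h1 : ∫ s in κ, ψ s • y s ∂(leb T) =
      ∫ s in κ, (ψ s - ψ s₀) • y s ∂(leb T) + ψ s₀ • ∫ s in κ, y s ∂(leb T) := by
    have h0 : Integrable (fun s => ψ s₀ • y s) (leb T) := hy.smul _
    simp only [sub_smul]
    rw [integral_sub hψy.integrableOn h0.integrableOn, integral_smul, sub_add_cancel]
  have h2 : ∫ s in κ, ψ s • v s ∂θ =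
      ∫ s in κ, (ψ s - ψ s₀) • v s ∂θ + ψ s₀ • ∫ s in κ, v s ∂θ := by
    have h0 : Integrable (fun s => ψ s₀ • v s) θ := hv.smul _
    simp only [sub_smul]
    rw [integral_sub hψv.integrableOn h0.integrableOn, integral_smul, sub_add_cancel]
  have h3 : ‖∫ s in κ, (ψ s - ψ s₀) • y s ∂(leb T)‖ ≤ o * (R * θ.real κ) := by
    refine (norm_integral_le_of_norm_le (g := fun s => o * ‖y s‖)
      (hy.norm.const_mul o).integrableOn ?_).trans ?_
    · rw [ae_restrict_iff' hκ]
      refine Eventually.of_forall fun s hs => ?_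
      rw [norm_smul]
      exact mul_le_mul_of_nonneg_right (hosc s hs s₀ hs₀) (norm_nonneg _)
    · rw [integral_const_mul]
      exact mul_le_mul_of_nonneg_left hn ho
  have h4 : ‖∫ s in κ, (ψ s - ψ s₀) • v s ∂θ‖ ≤ o * R * θ.real κ := by
    refine norm_setIntegral_le_of_norm_le_const_ae' (measure_lt_top _ _) ?_
    filter_upwards [hvR] with s hs hsκ
    rw [norm_smul]
    exact mul_le_mul (hosc s hsκ s₀ hs₀) hs (norm_nonneg _) ho
  have h5 : ‖ψ s₀ • (∫ s in κ, y s ∂(leb T) - ∫ s in κ, v s ∂θ)‖ ≤ C * (4 * ε * θ.real κ) := by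
    rw [norm_smul, ← dist_eq_norm]
    exact mul_le_mul (hC s₀) hd dist_nonneg hC0
  have h6 : ∫ s in κ, ψ s • y s ∂(leb T) - ∫ s in κ, ψ s • v s ∂θ =
      ∫ s in κ, (ψ s - ψ s₀) • y s ∂(leb T) - ∫ s in κ, (ψ s - ψ s₀) • v s ∂θ +
      ψ s₀ • (∫ s in κ, y s ∂(leb T) - ∫ s in κ, v s ∂θ) := by
    rw [h1, h2, smul_sub]
    abel
  rw [h6]
  refine (norm_add_le _ _).trans ((add_le_add ((norm_sub_le _ _).trans (add_le_add h3 h4))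
    h5).trans (le_of_eq ?_))
  ring

/-- Cells where `ψ` oscillates by more than `η` lie in `B` and are estimated with the trivial
oscillation `2 * C`. A continuous `ψ` needs no such `B` on fine partitions, and for the indicator of
`[0,t]` only a cell straddling `t` is bad. -/
theorem norm_integral_sub_le (h : CellApprox θ v y R ε) (hR : 0 ≤ R) (hv : Integrable v θ)
    (hvR : ∀ᵐ t ∂θ, ‖v t‖ ≤ R) {ψ : Icc 0 T → ℝ} (hψ : Measurable ψ) {C : ℝ}
    (hC : ∀ t, |ψ t| ≤ C) (hC0 : 0 ≤ C) (B : Set (Icc 0 T)) {η : ℝ}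
    (hη : 0 ≤ η) (hosc : ∀ s t, dist s t ≤ ε →
      |ψ s - ψ t| ≤ η ∨ ∀ r, dist r s ≤ ε → dist r t ≤ ε → r ∈ B) :
    ‖∫ s, ψ s • y s ∂(leb T) - ∫ s, ψ s • v s ∂θ‖ ≤
      (2 * R * η + 4 * ε * C) * θ.real univ + 4 * R * C * θ.real B := by
  obtain ⟨M, κ, hκ, hdiam, hn, hd⟩ := h.exists_cells
  have hcell : ∀ k, MeasurableSet (κ ⁻¹' {k}) := fun k => hκ (measurableSet_singleton k)
  have hψy : Integrable (fun s => ψ s • y s) (leb T) :=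
    h.integrable.bdd_smul C hψ.aestronglyMeasurable (Eventually.of_forall hC)
  have hψv : Integrable (fun s => ψ s • v s) θ :=
    hv.bdd_smul C hψ.aestronglyMeasurable (Eventually.of_forall hC)
  have hu := sum_real_fiber_inter (θ := θ) hκ univ
  simp only [inter_univ] at hu
  rw [integral_eq_sum_fiber hκ hψy, integral_eq_sum_fiber hκ hψv, ← Finset.sum_sub_distrib,
    ← hu, ← sum_real_fiber_inter (θ := θ) hκ B, Finset.mul_sum, Finset.mul_sum,
    ← Finset.sum_add_distrib]
  refine (norm_sum_le _ _).trans (Finset.sum_le_sum fun k _ => ?_)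
  by_cases hk : ∀ s ∈ κ ⁻¹' {k}, ∀ t ∈ κ ⁻¹' {k}, |ψ s - ψ t| ≤ η
  · refine (norm_setIntegral_sub_le (hcell k) h.integrable hv hvR (hn k) (hd k) hψ hC hC0 hη
      hk).trans (le_add_of_nonneg_right ?_)
    positivity
  · push Not at hk
    obtain ⟨s, hs, t, ht, hst⟩ := hk
    have hsub : κ ⁻¹' {k} ⊆ B := fun r hr =>
      ((hosc s t (hdiam s t (hs.trans ht.symm))).resolve_left (not_le.2 hst)) r
        (hdiam r s (hr.trans hs.symm)) (hdiam r t (hr.trans ht.symm))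
    rw [inter_eq_left.2 hsub]
    refine (norm_setIntegral_sub_le (hcell k) h.integrable hv hvR (hn k) (hd k) hψ hC hC0
      (o := 2 * C) (by positivity) fun s _ t _ => ?_).trans ?_
    · refine (abs_sub _ _).trans ?_
      linarith [hC s, hC t]
    · have : 0 ≤ 2 * R * η * θ.real (κ ⁻¹' {k}) := by positivity
      linarith

end CellApprox

section Limit

variable {T : ℝ} {E : Type*} [NormedAddCommGroup E] [NormedSpace ℝ E]
  {θ : Measure (Icc 0 T)} [IsFiniteMeasure θ] {v : Icc 0 T → E} {y : ℕ → Icc 0 T → E} {R : ℝ}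
  {ε : ℕ → ℝ}

/-- Uniform continuity makes every cell good once the mesh is small, so `B = ∅` works. -/
theorem tendsto_integral_continuous_smul (h : ∀ i, CellApprox θ v (y i) R (ε i)) (hR : 0 ≤ R)
    (hε : Tendsto ε atTop (𝓝 0)) (hv : Integrable v θ) (hvR : ∀ᵐ t ∂θ, ‖v t‖ ≤ R)
    (φ : C(Icc 0 T, ℝ)) :
    Tendsto (fun i => ∫ s, φ s • y i s ∂(leb T)) atTop (𝓝 (∫ s, φ s • v s ∂θ)) := by
  rw [Metric.tendsto_atTop']
  intro e he
  have hθ : 0 ≤ θ.real univ := measureReal_nonneg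
  obtain ⟨η, hη, hηe⟩ : ∃ η > 0, 2 * R * η * θ.real univ ≤ e / 2 := by
    refine ⟨e / (4 * R * θ.real univ + 1), by positivity, ?_⟩
    rw [mul_div_assoc', div_mul_eq_mul_div, div_le_iff₀ (by positivity)]
    nlinarith
  obtain ⟨δ, hδ, hφ⟩ := Metric.uniformContinuous_iff.1
    (CompactSpace.uniformContinuous_of_continuous φ.continuous) η hη
  have h1 : ∀ᶠ i in atTop, ε i < δ := hε.eventually (gt_mem_nhds hδ)
  have h2 : Tendsto (fun i => 4 * ε i * ‖φ‖ * θ.real univ) atTop (𝓝 0) := by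
    have := ((hε.const_mul 4).mul_const ‖φ‖).mul_const (θ.real univ)
    simpa using this
  obtain ⟨i₀, hi₀⟩ := eventually_atTop.1
    (h1.and (h2.eventually (gt_mem_nhds (half_pos he))))
  refine ⟨i₀, fun i hi => ?_⟩
  obtain ⟨hi1, hi2⟩ := hi₀ i hi.le
  have := (h i).norm_integral_sub_le hR hv hvR φ.continuous.measurable (C := ‖φ‖)
    (fun t => φ.norm_coe_le_norm t) (norm_nonneg _) ∅ hη.le
    (fun s t hst => Or.inl (hφ (hst.trans_lt hi1)).le)
  rw [dist_eq_norm]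
  rw [measureReal_empty, mul_zero, add_zero, add_mul] at this
  linarith

/-- The indicator of `Iic t` is constant on cells not straddling `t`, so `η = 0`. The straddling
ones lie in a shrinking neighbourhood of `t`, whose `θ`-measure tends to `θ {t} = 0`. -/
theorem tendsto_setIntegral_Iic (h : ∀ i, CellApprox θ v (y i) R (ε i)) (hR : 0 ≤ R)
    (hε : Tendsto ε atTop (𝓝 0)) (hv : Integrable v θ)
    (hvR : ∀ᵐ t ∂θ, ‖v t‖ ≤ R) {t : Icc 0 T} (ht : θ {t} = 0) :
    Tendsto (fun i => ∫ s in Iic t, y i s ∂(leb T)) atTop (𝓝 (∫ s in Iic t, v s ∂θ)) := by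
  rw [tendsto_iff_norm_sub_tendsto_zero]
  have hball : Tendsto (fun i => θ.real (Metric.cthickening (ε i) {t})) atTop (𝓝 0) := by
    have h1 := (tendsto_measure_cthickening_of_isClosed (μ := θ) (s := {t})
      ⟨1, one_pos, measure_ne_top _ _⟩ isClosed_singleton).comp hε
    rw [ht] at h1
    exact (ENNReal.tendsto_toReal ENNReal.zero_ne_top).comp h1
  have hbound : Tendsto (fun i => (2 * R * 0 + 4 * ε i * 1) * θ.real univ +
      4 * R * 1 * θ.real (Metric.cthickening (ε i) {t})) atTop (𝓝 0) := by
    have := (((hε.const_mul 4).mul_const 1).const_add (2 * R * 0)).mul_const (θ.real univ)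
      |>.add (hball.const_mul (4 * R * 1))
    simpa using this
  refine squeeze_zero (fun i => norm_nonneg _) (fun i => ?_) hbound
  have hind : ∀ (μ : Measure (Icc 0 T)) (g : Icc 0 T → E),
      ∫ s, (Iic t).indicator (1 : Icc 0 T → ℝ) s • g s ∂μ = ∫ s in Iic t, g s ∂μ := by
    intro μ g
    rw [← integral_indicator measurableSet_Iic]
    refine integral_congr_ae (Eventually.of_forall fun s => ?_)
    by_cases hs : s ∈ Iic t
    · simp [indicator_of_mem hs]
    · simp [indicator_of_notMem hs]
  rw [← hind, ← hind]
  refine (h i).norm_integral_sub_le hR hv hvR (measurable_one.indicator measurableSet_Iic)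
    (fun s => ?_) zero_le_one _ le_rfl fun s r hsr => ?_
  · by_cases hs : s ∈ Iic t
    · simp [indicator_of_mem hs]
    · simp [indicator_of_notMem hs]
  · have key : ∀ s r u : Icc 0 T, s ≤ t → ¬ r ≤ t → dist u s ≤ ε i → dist u r ≤ ε i →
        u ∈ Metric.cthickening (ε i) {t} := by
      intro s r u hs hr h1 h2
      refine Metric.mem_cthickening_of_dist_le u t _ _ (mem_singleton t) ?_
      rw [Subtype.dist_eq, Real.dist_eq, abs_le] at h1 h2 ⊢
      have hs' : (s : ℝ) ≤ t := hs
      have hr' : (t : ℝ) < r := not_le.1 hr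
      constructor <;> linarith
    by_cases hs : s ≤ t
    · by_cases hr : r ≤ t
      · left
        rw [indicator_of_mem (mem_Iic.2 hs), indicator_of_mem (mem_Iic.2 hr)]
        simp
      · exact Or.inr fun u h1 h2 => key s r u hs hr h1 h2
    · by_cases hr : r ≤ t
      · exact Or.inr fun u h1 h2 => key r s u hr hs h2 h1
      · left
        rw [indicator_of_notMem (fun h => hs (mem_Iic.1 h)),
          indicator_of_notMem (fun h => hr (mem_Iic.1 h))]
        simp

end Limit

/-! ### Normalised densities of impulsive controls. -/

namespace ImpulsiveSystem

variable {n m q N : ℕ} {S : ImpulsiveSystem n m q N}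

/-- The pair `(μ, G μ)` has a density with values in the convex hulls with respect to a finite
measure. -/
theorem IsControl.exists_density {μ : VectorMeasure S.I (Fin m → ℝ)} {α : S.I → Fin q → ℝ}
    (h : S.IsControl μ α) :
    ∃ (θ : Measure S.I) (v : S.I → (Fin m → ℝ) × (Fin n → ℝ)), IsFiniteMeasure θ ∧
      Integrable v θ ∧ (∀ᵐ t ∂θ, v t ∈ S.hull t) ∧
      (∀ t, (v t).2 = (S.G t (α t)).mulVec (v t).1) ∧ μ = θ.withDensityᵥ fun t => (v t).1 := by
  obtain ⟨hK, -, -, hαA, hGint⟩ := h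
  set τ := totalVar μ with hτ
  set ω := density μ with hω
  have hωint : Integrable ω τ := integrable_density μ
  have hωm : Measurable ω := measurable_pi_iff.2 fun j => SignedMeasure.measurable_rnDeriv _ _
  have hωK : ∀ᵐ t ∂τ, ω t ∈ S.K := ae_mem_cone S.K_closed S.K_cone hωm hωint fun B hB => by
    rw [setIntegral_density μ hB]
    exact hK B hB
  set Γ : S.I → Fin n → ℝ := fun t => (S.G t (α t)).mulVec (ω t) with hΓ
  have hΓint : Integrable Γ τ := hGint
  -- Division by `M` brings `ω` into `Ktilde`; the maximum with `1` keeps the divisor positive.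
  let M : S.I → ℝ := fun t => max 1 ‖ω t‖
  have hM1 : ∀ t, 1 ≤ M t := fun t => le_max_left _ _
  -- `ρ` is `M` times the normalising factor at `ω / M`, so `(ω, Γ) / ρ` is exactly `(𝔥, 𝔤)` at `(α
  -- t, ω / M)`. It is integrable because both `ω` and `G ω` are, which makes the new measure
  -- finite.
  let ρ : S.I → ℝ := fun t => M t + ∑ i, |Γ t i|
  have hρM : ∀ t, M t ≤ ρ t := fun t =>
    le_add_of_nonneg_right (Finset.sum_nonneg fun _ _ => abs_nonneg _)
  have hρ0 : ∀ t, 0 < ρ t := fun t => zero_lt_one.trans_le ((hM1 t).trans (hρM t))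
  have hρint : Integrable ρ τ :=
    (((integrable_const (1 : ℝ)).sup hωint.norm)).add
      (integrable_finsetSum _ fun i _ => (hΓint.eval i).abs)
  have hρae : AEMeasurable (fun t => ENNReal.ofReal (ρ t)) τ := hρint.aemeasurable.ennreal_ofReal
  have hρfin : ∀ᵐ t ∂τ, ENNReal.ofReal (ρ t) < ⊤ := Eventually.of_forall fun _ =>
    ENNReal.ofReal_lt_top
  have hρr : ∀ t, (ENNReal.ofReal (ρ t)).toReal = ρ t := fun t =>
    ENNReal.toReal_ofReal (hρ0 t).le
  let v : S.I → (Fin m → ℝ) × (Fin n → ℝ) := fun t => ((ρ t)⁻¹ • ω t, (ρ t)⁻¹ • Γ t)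
  have hρv : ∀ t, (ENNReal.ofReal (ρ t)).toReal • v t = (ω t, Γ t) := fun t => by
    rw [hρr]
    simp only [v, Prod.smul_mk, smul_smul, mul_inv_cancel₀ (hρ0 t).ne', one_smul]
  refine ⟨τ.withDensity fun t => ENNReal.ofReal (ρ t), v,
    isFiniteMeasure_withDensity_ofReal hρint.2, ?_, ?_, fun t => ?_, ?_⟩
  · rw [integrable_withDensity_iff_integrable_smul₀' hρae hρfin]
    simp only [hρv]
    exact hωint.prodMk hΓint
  · refine (withDensity_absolutelyContinuous _ _).ae_le ?_
    filter_upwards [hωK, hαA] with t htK htA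
    have hMp : 0 < M t := zero_lt_one.trans_le (hM1 t)
    refine subset_closure (subset_convexHull ℝ _ ⟨α t, htA, (M t)⁻¹ • ω t,
      ⟨S.K_cone _ htK _ (inv_pos.2 hMp), fun j => ?_⟩, ?_⟩)
    · rw [Pi.smul_apply, smul_eq_mul, abs_mul, abs_inv, abs_of_pos hMp, inv_mul_le_iff₀ hMp,
        mul_one]
      exact (norm_le_pi_norm (ω t) j).trans (le_max_right _ _)
    · have hnorm : S.norming t (α t) ((M t)⁻¹ • ω t) = ρ t / M t := by
        have : ∀ i, ∑ j, S.G t (α t) i j * ((M t)⁻¹ • ω t) j = (M t)⁻¹ * Γ t i := fun i => by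
          change ((S.G t (α t)).mulVec ((M t)⁻¹ • ω t)) i = _
          rw [Matrix.mulVec_smul]
          rfl
        simp only [norming, this, abs_mul, abs_inv, abs_of_pos hMp, ← Finset.mul_sum, ρ]
        field_simp
      have hinv : (ρ t / M t)⁻¹ * (M t)⁻¹ = (ρ t)⁻¹ := by
        have := (hρ0 t).ne'
        field_simp
      simp only [v, hfrak, gfrak, hnorm, Matrix.mulVec_smul, smul_smul, hinv, Γ]
  · simp only [v, Γ, Matrix.mulVec_smul]
  · have h1 : (fun t => (ENNReal.ofReal (ρ t)).toReal • (v t).1) = ω := by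
      funext t
      exact congrArg Prod.fst (hρv t)
    have h2 := withDensityᵥ_smul_eq_withDensityᵥ_withDensity' (g := fun t => (v t).1) hρae hρfin
      (by rw [h1]; exact hωint)
    rw [← h2, h1, hω, hτ, withDensityᵥ_density_eq]

end ImpulsiveSystem

/-! ### Truncation -/

/-- The projection of a matrix onto the ball of radius `M` for the sup norm. -/
def clamp {ι κ : Type*} (M : ℝ) (z : ι → κ → ℝ) : ι → κ → ℝ := fun k i => max (-M) (min M (z k i))

section Clamp

variable {ι κ : Type*} [Fintype ι] [Fintype κ] {M : ℝ}

theorem norm_clamp_le (hM : 0 ≤ M) (z : ι → κ → ℝ) : ‖clamp M z‖ ≤ M := by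
  refine (pi_norm_le_iff_of_nonneg hM).2 fun k => (pi_norm_le_iff_of_nonneg hM).2 fun i => ?_
  rw [Real.norm_eq_abs, abs_le]
  exact ⟨le_max_left _ _, max_le (by linarith) (min_le_left _ _)⟩

theorem norm_clamp_sub_le (z y : ι → κ → ℝ) : ‖clamp M z - clamp M y‖ ≤ ‖z - y‖ := by
  refine (pi_norm_le_iff_of_nonneg (norm_nonneg _)).2 fun k =>
    (pi_norm_le_iff_of_nonneg (norm_nonneg _)).2 fun i => ?_
  refine le_trans ?_ ((norm_le_pi_norm ((z - y) k) i).trans (norm_le_pi_norm (z - y) k))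
  simp only [Real.norm_eq_abs, Pi.sub_apply, clamp]
  refine (abs_max_sub_max_le_max _ _ _ _).trans (max_le (by simp) ?_)
  exact (abs_min_sub_min_le_max _ _ _ _).trans (max_le (by simp) le_rfl)

theorem clamp_eq_self {z : ι → κ → ℝ} (hz : ‖z‖ ≤ M) : clamp M z = z := by
  funext k i
  have h := abs_le.1 ((norm_le_pi_norm (z k) i).trans ((norm_le_pi_norm z k).trans hz))
  rw [clamp, min_eq_right h.2, max_eq_right h.1]

theorem norm_clamp_le_norm (hM : 0 ≤ M) (z : ι → κ → ℝ) : ‖clamp M z‖ ≤ ‖z‖ := by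
  have h0 : clamp M (0 : ι → κ → ℝ) = 0 := clamp_eq_self (by rwa [norm_zero])
  simpa [h0] using norm_clamp_sub_le (M := M) z 0

end Clamp

namespace ImpulsiveSystem

variable {n m q N : ℕ} {S : ImpulsiveSystem n m q N}

/-! ### Delays and measurability -/

theorem h_nonneg (k : Fin (N + 1)) : 0 ≤ S.h k :=
  S.h_zero.symm.le.trans (S.h_strictMono.monotone (Fin.zero_le k))

theorem h_le_hmax (k : Fin (N + 1)) : S.h k ≤ S.hmax := S.h_strictMono.monotone (Fin.le_last k)

theorem hmax_nonneg : 0 ≤ S.hmax := h_nonneg _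

theorem delay_mem (s : S.I) (k : Fin (N + 1)) : (s : ℝ) - S.h k ∈ Icc (-S.hmax) S.T :=
  ⟨by linarith [s.2.1, h_le_hmax (S := S) k], by linarith [s.2.2, h_nonneg (S := S) k]⟩

/-- Each component of a function of bounded variation is a difference of monotone functions, hence
Borel after the monotone shift of time. -/
theorem aestronglyMeasurable_delay {x : ℝ → Fin n → ℝ}
    (hx : BoundedVariationOn x (Icc (-S.hmax) S.T)) (k : Fin (N + 1)) :
    AEStronglyMeasurable (fun s : S.I => x (s - S.h k)) (leb S.T) := by
  refine aestronglyMeasurable_of_eval fun j => ?_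
  obtain ⟨p, r, hp, hr, hpr⟩ := ((LipschitzWith.eval (α := fun _ : Fin n => ℝ)
    j).comp_boundedVariationOn hx).locallyBoundedVariationOn.exists_monotoneOn_sub_monotoneOn
  have hm : ∀ p : ℝ → ℝ, MonotoneOn p (Icc (-S.hmax) S.T) →
      Measurable fun s : S.I => p (s - S.h k) := fun p hp =>
    Monotone.measurable fun s t hst => hp (delay_mem s k) (delay_mem t k)
      (sub_le_sub_right (Subtype.coe_le_coe.2 hst) _)
  have : (fun s : S.I => x (s - S.h k) j) = fun s : S.I => p (s - S.h k) - r (s - S.h k) := by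
    funext s
    exact congrFun hpr _
  rw [this]
  exact ((hm p hp).sub (hm r hr)).aestronglyMeasurable

theorem aestronglyMeasurable_drift_const (hf : S.LipschitzDrift) {α : S.I → Fin q → ℝ}
    (hα : Measurable α) (z : Fin (N + 1) → Fin n → ℝ) :
    AEStronglyMeasurable (fun s => S.f s z (α s)) (leb S.T) := by
  have hα' : Measurable (α := S.LebesgueI) α := measurable_lebesgueI hα
  have h1 : Measurable fun s : S.LebesgueI => (s, α s) := measurable_id.prodMk hα'
  have h2 := Measurable.comp (hf.2.1 z) h1
  exact aestronglyMeasurable_of_measurable_lebesgueI fun _ hB => h2 hB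

/-- Truncation turns the local Lipschitz condition into a global one, as the fixed point argument
requires. The a priori bound shows afterwards that the truncation is inactive. -/
theorem exists_lipschitz_clamp (hf : S.LipschitzDrift) {M : ℝ} (hM : 0 < M) :
    ∃ L : S.I → ℝ, Integrable L (leb S.T) ∧ (∀ t, 0 ≤ L t) ∧
      ∀ᵐ t ∂leb S.T, ∀ a ∈ S.A t, ∀ z y,
        ‖S.f t (clamp M z) a - S.f t (clamp M y) a‖ ≤ L t * ‖z - y‖ := by
  obtain ⟨L, hL, hL0, hLip⟩ := hf.2.2 M hM
  refine ⟨L, hL, hL0, ?_⟩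
  filter_upwards [hLip] with t ht a ha z y
  exact (ht _ _ (norm_clamp_le hM.le z) (norm_clamp_le hM.le y) a ha).trans
    (mul_le_mul_of_nonneg_left (norm_clamp_sub_le z y) (hL0 t))

theorem aestronglyMeasurable_drift (hf : S.LipschitzDrift) {α : S.I → Fin q → ℝ}
    (hα : Measurable α) (hαA : ∀ᵐ t ∂(leb S.T), α t ∈ S.A t)
    {z : S.I → Fin (N + 1) → Fin n → ℝ} (hz : AEStronglyMeasurable z (leb S.T)) {M : ℝ}
    (hM : 0 < M) (hzM : ∀ s, ‖z s‖ ≤ M) :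
    AEStronglyMeasurable (fun s => S.f s (z s) (α s)) (leb S.T) := by
  obtain ⟨L, -, hL0, hLip⟩ := exists_lipschitz_clamp hf hM
  have h := aestronglyMeasurable_comp_of_continuous (F := fun s z => S.f s (clamp M z) (α s))
    (fun z => aestronglyMeasurable_drift_const hf hα _) ?_ hz
  · simpa only [clamp_eq_self (hzM _)] using h
  · filter_upwards [hLip, hαA] with s hs hsA
    exact (LipschitzWith.of_dist_le_mul (K := (L s).toNNReal) fun z y => by
      rw [dist_eq_norm, dist_eq_norm, Real.coe_toNNReal _ (hL0 s)]
      exact hs _ hsA z y).continuous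

theorem norm_delayed_le {x : ℝ → Fin n → ℝ} {M : ℝ} (hM : 0 ≤ M)
    (hx : ∀ t ∈ Icc (-S.hmax) S.T, ‖x t‖ ≤ M) (s : S.I) : ‖S.delayed x s‖ ≤ M :=
  (pi_norm_le_iff_of_nonneg hM).2 fun k => hx _ (delay_mem s k)

theorem primitive_zero {E : Type*} [NormedAddCommGroup E] [NormedSpace ℝ E] (g : S.I → E)
    {t : S.I} (ht : (t : ℝ) = 0) : primitive g t = 0 := by
  have : Iic t = {t} := by
    ext s
    rw [mem_Iic, mem_singleton_iff]
    refine ⟨fun h => le_antisymm h ?_, fun h => h.le⟩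
    rw [← Subtype.coe_le_coe, ht]
    exact s.2.1
  rw [primitive, this, Measure.restrict_singleton, measure_singleton, zero_smul,
    integral_zero_measure]

/-! ### Strict sense processes -/

/-- **Existence of strict sense processes** with a given absolutely continuous control; they are
bounded uniformly over bounded sets of controls. -/
theorem exists_strictSenseTriple (hf : S.LipschitzDrift) (hc : S.LinearGrowth)
    (hK0 : (0 : Fin m → ℝ) ∈ S.K) {x : ℝ → Fin n → ℝ}
    (hx : BoundedVariationOn x (Icc (-S.hmax) S.T))
    (hxζ : ∀ᵐ t ∂(volume.restrict (Ico (-S.hmax) 0)), x t = S.ζ t) {B : ℝ} (hB : 0 ≤ B) :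
    ∃ M : ℝ, 0 < M ∧ (∀ t ∈ Icc (-S.hmax) S.T, ‖x t‖ ≤ M) ∧
      ∀ (α : S.I → Fin q → ℝ) (u : S.I → Fin m → ℝ), Measurable α →
        (∀ᵐ t ∂(leb S.T), α t ∈ S.A t) → (∀ t, u t ∈ S.K) → Integrable u (leb S.T) →
        Integrable (fun s => (S.G s (α s)).mulVec (u s)) (leb S.T) →
        ∫ s, ‖(S.G s (α s)).mulVec (u s)‖ ∂(leb S.T) ≤ B →
        ∃ x' : ℝ → Fin n → ℝ, S.IsStrictSenseTriple ((leb S.T).withDensityᵥ u) α x' ∧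
          (∀ t < 0, x' t = x t) ∧ (∀ t ∈ Icc (-S.hmax) S.T, ‖x' t‖ ≤ M) ∧
          ∀ t : S.I, x' t = x 0 + primitive (fun s => S.f s (S.delayed x' s) (α s)) t +
            primitive (fun s => (S.G s (α s)).mulVec (u s)) t := by
  obtain ⟨c, hc, hc0, hgrow⟩ := hc
  have hT := S.T_pos.le
  have h0mem : (0 : ℝ) ∈ Icc (-S.hmax) S.T := ⟨by linarith [hmax_nonneg (S := S)], hT⟩
  obtain ⟨B₀, hB₀, hxB₀⟩ : ∃ B₀, 0 ≤ B₀ ∧ ∀ t ∈ Icc (-S.hmax) S.T, ‖x t‖ ≤ B₀ := by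
    refine ⟨‖x 0‖ + (eVariationOn x (Icc (-S.hmax) S.T)).toReal, by positivity, fun t ht => ?_⟩
    have := hx.dist_le ht h0mem
    rw [dist_eq_norm] at this
    exact (norm_le_norm_add_norm_sub' (x t) (x 0)).trans (by gcongr)
  have hI : 0 ≤ ∫ s, c s ∂(leb S.T) := integral_nonneg hc0
  -- This a priori bound uses only the growth constant, which truncation does not worsen. It is thus
  -- independent of the truncation level `M`, which can be taken above it without circularity.
  set M' : ℝ := 2 * (B₀ + B + (1 + B₀) * ∫ s, c s ∂(leb S.T)) *
    Real.exp (2 * ∫ s, c s ∂(leb S.T)) with hM'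
  set M : ℝ := max B₀ M' + 1 with hMdef
  have hB₀M : B₀ ≤ M := (le_max_left _ _).trans (lt_add_one _).le
  have hM'M : M' ≤ M := (le_max_right _ _).trans (lt_add_one _).le
  have hM : 0 < M := (hB₀.trans (le_max_left _ _)).trans_lt (lt_add_one _)
  refine ⟨M, hM, fun t ht => (hxB₀ t ht).trans hB₀M, ?_⟩
  intro α u hα hαA huK hu hGu hGuB
  obtain ⟨L, hL, hL0, hLip⟩ := exists_lipschitz_clamp hf hM
  let F : S.I → (Fin (N + 1) → Fin n → ℝ) → Fin n → ℝ := fun s z => S.f s (clamp M z) (α s)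
  have hFgrow : ∀ᵐ s ∂(leb S.T), ∀ z, ‖F s z‖ ≤ c s * (1 + ‖z‖) := by
    filter_upwards [hgrow, hαA] with s hs hsA z
    exact (hs _ _ hsA).trans (mul_le_mul_of_nonneg_left
      (add_le_add_right (norm_clamp_le_norm hM.le z) 1) (hc0 s))
  have hFg : ∀ᵐ s ∂(leb S.T), ∀ z, ‖F s z‖ ≤ c s * (1 + M) := by
    filter_upwards [hgrow, hαA] with s hs hsA z
    exact (hs _ _ hsA).trans (mul_le_mul_of_nonneg_left
      (add_le_add_right (norm_clamp_le hM.le z) 1) (hc0 s))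
  -- The new trajectory starts at `x 0` and is continuous there, even if `x` itself jumps at `0`.
  let b : S.I → Fin n → ℝ := fun t => x 0 + primitive (fun s => (S.G s (α s)).mulVec (u s)) t
  have hb : Continuous b := continuous_const.add (continuous_primitive hGu)
  have hbB : ∀ t, ‖b t‖ ≤ B₀ + B := fun t =>
    (norm_add_le _ _).trans (add_le_add (hxB₀ 0 h0mem) ((norm_integral_le_integral_norm _).trans
      ((setIntegral_le_integral hGu.norm (Eventually.of_forall fun _ => norm_nonneg _)).trans
        hGuB)))
  obtain ⟨y, hy, hyint, hsol⟩ := exists_delay_solution hT h_nonneg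
    (fun z => aestronglyMeasurable_drift_const hf hα _) hL hL0
    (by filter_upwards [hLip, hαA] with s hs hsA using hs _ hsA)
    (hc.mul_const (1 + M)) hFg (aestronglyMeasurable_delay hx) hb (F := F)
  have hyM : ∀ t, ‖y t‖ ≤ M := fun t => (norm_delay_solution_le hT h_nonneg hc hc0 hFgrow hB₀
    (add_nonneg hB₀ hB) (fun s k _ => hxB₀ _ (delay_mem s k)) hbB hy hsol t).trans hM'M
  set x' : ℝ → Fin n → ℝ := extendBy x y with hx'
  have hx'neg : ∀ t < 0, x' t = x t := fun t ht => extendBy_of_neg _ _ ht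
  have hx'I : ∀ t : S.I, x' t = y t := fun t => extendBy_of_mem _ _ t.2
  have hx'M : ∀ t ∈ Icc (-S.hmax) S.T, ‖x' t‖ ≤ M := by
    intro t ht
    rcases lt_or_ge t 0 with h | h
    · rw [hx'neg t h]
      exact (hxB₀ t ht).trans hB₀M
    · rw [show x' t = y ⟨t, h, ht.2⟩ from hx'I ⟨t, h, ht.2⟩]
      exact hyM _
  have hdrift : (fun s => F s fun k => extendBy x y ((s : ℝ) - S.h k)) =
      fun s => S.f s (S.delayed x' s) (α s) := by
    -- The solution stays within the bound `M`, so the clamp acts as the identity on its delayed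
    -- values.
    funext s
    change S.f s (clamp M (S.delayed x' s)) (α s) = _
    rw [clamp_eq_self (norm_delayed_le hM.le hx'M s)]
  rw [hdrift] at hyint
  have hx'sol : ∀ t : S.I, x' t = x 0 + primitive (fun s => S.f s (S.delayed x' s) (α s)) t +
      primitive (fun s => (S.G s (α s)).mulVec (u s)) t := by
    intro t
    rw [hx'I, hsol, hdrift, add_right_comm]
  have hx'0 : x' 0 = x 0 := by
    have := hx'sol ⟨0, le_rfl, hT⟩
    rwa [primitive_zero _ rfl, primitive_zero _ rfl, add_zero, add_zero] at this
  have hx'BV : BoundedVariationOn x' (Icc (-S.hmax) S.T) := by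
    have h1 : BoundedVariationOn x' (Icc 0 S.T) :=
      boundedVariationOn_primitive (hyint.add hGu) (x₀ := x 0) fun t => by
        rw [hx'sol, add_assoc, primitive, primitive, primitive,
          ← integral_add hyint.integrableOn hGu.integrableOn]
        rfl
    have h2 : BoundedVariationOn x' (Icc (-S.hmax) 0) := by
      have heq : EqOn x' x (Icc (-S.hmax) 0) := fun t ht => by
        rcases ht.2.lt_or_eq with h | rfl
        · exact hx'neg t h
        · exact hx'0
      rw [BoundedVariationOn, eVariationOn.eq_of_eqOn heq]
      exact hx.mono (Icc_subset_Icc_right hT)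
    have h3 := eVariationOn.Icc_add_Icc x' (s := univ) h0mem.1 hT (mem_univ 0)
    simp only [univ_inter] at h3
    rw [BoundedVariationOn, ← h3]
    exact ENNReal.add_ne_top.2 ⟨h2, h1⟩
  have hac := totalVar_withDensityᵥ_absolutelyContinuous hu
  refine ⟨x', ⟨⟨⟨fun E hE => ?_, hα, hαA, hac.ae_le hαA,
    (integrableAgainst_withDensityᵥ_iff hu _).2 hGu⟩, hx'BV, hyint, fun t _ => ?_, ?_⟩, hac⟩,
    hx'neg, hx'M, hx'sol⟩
  · rw [withDensityᵥ_apply hu hE]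
    exact setIntegral_mem_cone S.K_closed S.K_convex S.K_cone hK0 hu (Eventually.of_forall huK) E
  · rw [integralAgainst_withDensityᵥ hu _ measurableSet_Iic, hx'0]
    exact hx'sol t
  · filter_upwards [hxζ, self_mem_ae_restrict measurableSet_Ico] with t ht htm
    rw [hx'neg t htm.2, ht]

end ImpulsiveSystem

namespace ImpulsiveSystem

variable {n m q N : ℕ} {S : ImpulsiveSystem n m q N}

/-! ### Convergence of the drifts -/

theorem norm_primitive_le {E : Type*} [NormedAddCommGroup E] [NormedSpace ℝ E] {g : S.I → E}
    (hg : Integrable g (leb S.T)) (t : S.I) : ‖primitive g t‖ ≤ ∫ s, ‖g s‖ ∂(leb S.T) :=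
  (norm_integral_le_integral_norm _).trans
    (setIntegral_le_integral hg.norm (Eventually.of_forall fun _ => norm_nonneg _))

/-- If two functions differ by the primitive of `g`, up to an error `e`, and `g` is controlled by
the difference of the delayed functions and by `d`, then `g` is small in `L¹` when `e` and `d`
are. -/
theorem integral_norm_le_of_delay {ι E : Type*} [Fintype ι] [NormedAddCommGroup E]
    [NormedSpace ℝ E] {T : ℝ} (hT : 0 ≤ T) {h : ι → ℝ} (hh : ∀ k, 0 ≤ h k)
    {L : Icc 0 T → ℝ} (hL : Integrable L (leb T)) (hL0 : ∀ t, 0 ≤ L t)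
    {g : Icc 0 T → E} (hg : Integrable g (leb T)) {e d : Icc 0 T → ℝ}
    (he0 : ∀ s, 0 ≤ e s) (hd0 : ∀ s, 0 ≤ d s)
    (hed : Integrable (fun s => L s * e s + d s) (leb T))
    (hgL : ∀ᵐ s : Icc 0 T ∂(leb T), ∀ C, 0 ≤ C →
      (∀ k, ‖extendBy 0 (primitive g) ((s : ℝ) - h k)‖ ≤ C) → ‖g s‖ ≤ L s * (e s + C) + d s) :
    ∫ s, ‖g s‖ ∂(leb T) ≤ (1 + 2 * ∫ s, L s * weight L s ∂(leb T)) *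
      ∫ s, (L s * e s + d s) ∂(leb T) := by
  set w := weight L with hw
  have hw1 : ∀ t, 1 ≤ w t := one_le_weight hL0
  have hw0 : ∀ t, 0 ≤ w t := fun t => zero_le_one.trans (hw1 t)
  have hLw := integrable_mul_weight hL hL0
  set δ := ∫ s, (L s * e s + d s) ∂(leb T) with hδ
  have hed0 : ∀ s, 0 ≤ L s * e s + d s := fun s =>
    add_nonneg (mul_nonneg (hL0 s) (he0 s)) (hd0 s)
  have hδ0 : 0 ≤ δ := integral_nonneg hed0
  have hstep : ∀ C, 0 ≤ C → (∀ t, ‖primitive g t‖ ≤ C * w t) →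
      ∀ᵐ s ∂(leb T), ‖g s‖ ≤ (L s * e s + d s) + C * (L s * w s) := by
    intro C hC hr
    filter_upwards [hgL] with s hs
    refine (hs (C * w s) (mul_nonneg hC (hw0 s)) fun k => ?_).trans (le_of_eq (by ring))
    rcases delay_cases s (hh k) with hneg | ⟨r, hrs, hle⟩
    · rw [extendBy_of_neg _ _ hneg, Pi.zero_apply, norm_zero]
      exact mul_nonneg hC (hw0 s)
    · rw [hrs, extendBy_of_mem _ _ r.2]
      exact (hr r).trans (mul_le_mul_of_nonneg_left (monotone_weight hL hL0 hle) hC)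
  have hint : ∀ C, Integrable (fun s => (L s * e s + d s) + C * (L s * w s)) (leb T) := fun C =>
    hed.add (hLw.const_mul C)
  -- The crude bound `∫ ‖g‖` starts the iteration; each round replaces `C` by `δ + C / 2`, leaving
  -- `2 * δ`. Inserting this into `hstep` bounds the `L¹` norm itself.
  have hr := le_of_forall_bound_imp (r := fun t => ‖primitive g t‖) (w := w)
    (C₀ := ∫ s, ‖g s‖ ∂(leb T)) hw0 hδ0
    (integral_nonneg fun _ => norm_nonneg _)
    (fun t => ((norm_integral_le_integral_norm _).trans
      (setIntegral_le_integral hg.norm (Eventually.of_forall fun _ => norm_nonneg _))).trans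
        (le_mul_of_one_le_right (integral_nonneg fun _ => norm_nonneg _) (hw1 t))) fun C hC hr t => by
      refine (norm_integral_le_of_norm_le (hint C).integrableOn
        (ae_restrict_of_ae (hstep C hC hr))).trans ?_
      rw [integral_add hed.integrableOn (hLw.const_mul C).integrableOn, integral_const_mul]
      have h1 : ∫ s in Iic t, (L s * e s + d s) ∂(leb T) ≤ δ :=
        setIntegral_le_integral hed (Eventually.of_forall hed0)
      have h2 := mul_le_mul_of_nonneg_left (setIntegral_mul_weight_le hT hL hL0 t) hC
      have h3 := mul_le_mul_of_nonneg_left (hw1 t) hδ0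
      linarith
  refine (integral_mono_ae hg.norm (hint _)
    (hstep (2 * δ) (by positivity) hr)).trans (le_of_eq ?_)
  rw [integral_add hed (hLw.const_mul _), integral_const_mul, ← hδ]
  ring

/-- **Convergence of the drifts** of trajectories whose jump parts converge almost everywhere. -/
theorem tendsto_integral_norm_drift_sub (hf : S.LipschitzDrift) (hc : S.LinearGrowth)
    {x : ℝ → Fin n → ℝ} {xs : ℕ → ℝ → Fin n → ℝ} {α : S.I → Fin q → ℝ}
    {αs : ℕ → S.I → Fin q → ℝ} {M : ℝ} (hM : 0 < M)
    (hx : BoundedVariationOn x (Icc (-S.hmax) S.T))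
    (hxs : ∀ i, BoundedVariationOn (xs i) (Icc (-S.hmax) S.T))
    (hxM : ∀ t ∈ Icc (-S.hmax) S.T, ‖x t‖ ≤ M)
    (hxsM : ∀ i, ∀ t ∈ Icc (-S.hmax) S.T, ‖xs i t‖ ≤ M)
    (hα : Measurable α) (hαs : ∀ i, Measurable (αs i))
    (hαA : ∀ᵐ t ∂(leb S.T), α t ∈ S.A t) (hαsA : ∀ i, ∀ᵐ t ∂(leb S.T), αs i t ∈ S.A t)
    (hαα : Tendsto (fun i => leb S.T {t | αs i t ≠ α t}) atTop (𝓝 0))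
    {g : ℕ → S.I → Fin n → ℝ}
    (hgdef : ∀ i s, g i s = S.f s (S.delayed (xs i) s) (αs i s) - S.f s (S.delayed x s) (α s))
    (hE : ∀ᵐ s : S.I ∂(leb S.T), ∀ k, Tendsto (fun i => xs i ((s : ℝ) - S.h k) - x (s - S.h k) -
      extendBy 0 (primitive (g i)) (s - S.h k)) atTop (𝓝 0)) :
    Tendsto (fun i => ∫ s, ‖g i s‖ ∂(leb S.T)) atTop (𝓝 0) := by
  obtain ⟨c, hc, hc0, hgrow⟩ := hc
  obtain ⟨L, hL, hL0, hLip⟩ := hf.2.2 M hM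
  have hT := S.T_pos.le
  have hdel : ∀ {x : ℝ → Fin n → ℝ}, BoundedVariationOn x (Icc (-S.hmax) S.T) →
      AEStronglyMeasurable (fun s => S.delayed x s) (leb S.T) := fun hx =>
    aestronglyMeasurable_of_eval fun k => aestronglyMeasurable_delay hx k
  have hfm : ∀ {x : ℝ → Fin n → ℝ} {α : S.I → Fin q → ℝ},
      BoundedVariationOn x (Icc (-S.hmax) S.T) → (∀ t ∈ Icc (-S.hmax) S.T, ‖x t‖ ≤ M) →
      Measurable α → (∀ᵐ t ∂(leb S.T), α t ∈ S.A t) →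
      Integrable (fun s => S.f s (S.delayed x s) (α s)) (leb S.T) ∧
      ∀ᵐ s ∂(leb S.T), ‖S.f s (S.delayed x s) (α s)‖ ≤ c s * (1 + M) := by
    intro x α hx hxM hα hαA
    have hb : ∀ᵐ s ∂(leb S.T), ‖S.f s (S.delayed x s) (α s)‖ ≤ c s * (1 + M) := by
      filter_upwards [hgrow, hαA] with s hs hsA
      exact (hs _ _ hsA).trans (mul_le_mul_of_nonneg_left
        (add_le_add_right (norm_delayed_le hM.le hxM s) 1) (hc0 s))
    exact ⟨(hc.mul_const (1 + M)).mono' (aestronglyMeasurable_drift hf hα hαA (hdel hx) hM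
      (norm_delayed_le hM.le hxM)) hb, hb⟩
  have h1 := hfm hx hxM hα hαA
  have h2 := fun i => hfm (hxs i) (hxsM i) (hαs i) (hαsA i)
  have h3 := fun i => hfm hx hxM (hαs i) (hαsA i)
  have hgint : ∀ i, Integrable (g i) (leb S.T) := fun i => by
    rw [show g i = _ from funext (hgdef i)]
    exact (h2 i).1.sub h1.1
  set D := ∫ s, 2 * (c s * (1 + M)) ∂(leb S.T) with hD
  have hDint : Integrable (fun s => 2 * (c s * (1 + M))) (leb S.T) :=
    (hc.mul_const (1 + M)).const_mul 2
  have hgD : ∀ i, ∫ s, ‖g i s‖ ∂(leb S.T) ≤ D := fun i => by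
    refine integral_mono_ae (hgint i).norm hDint ?_
    filter_upwards [h1.2, (h2 i).2] with s hs1 hs2
    rw [hgdef]
    exact (norm_sub_le _ _).trans (by linarith)
  have hD0 : 0 ≤ D := (integral_nonneg fun _ => norm_nonneg _).trans (hgD 0)
  let P : ℕ → ℝ → Fin n → ℝ := fun i => extendBy 0 (primitive (g i))
  have hPD : ∀ i t, ‖P i t‖ ≤ D := by
    intro i t
    by_cases ht : t ∈ Icc 0 S.T
    · simp only [P, extendBy_of_mem _ _ ht]
      exact (norm_primitive_le (hgint i) _).trans (hgD i)
    · simp only [P, extendBy, dif_neg ht, Pi.zero_apply, norm_zero]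
      exact hD0
  -- The part of the delayed trajectory difference not explained by the drifts; it is bounded and
  -- tends to zero almost everywhere by `hE`.
  let err : ℕ → Fin (N + 1) → S.I → Fin n → ℝ := fun i k s =>
    xs i (s - S.h k) - x (s - S.h k) - P i (s - S.h k)
  have herrm : ∀ i k, AEStronglyMeasurable (err i k) (leb S.T) := fun i k =>
    ((aestronglyMeasurable_delay (hxs i) k).sub (aestronglyMeasurable_delay hx k)).sub
      (aestronglyMeasurable_extendBy_delay hT (h_nonneg k) aestronglyMeasurable_zero
        (continuous_primitive (hgint i)))
  have herrb : ∀ i k s, ‖err i k s‖ ≤ M + M + D := fun i k s =>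
    (norm_sub_le _ _).trans (add_le_add ((norm_sub_le _ _).trans
      (add_le_add (hxsM i _ (delay_mem s k)) (hxM _ (delay_mem s k)))) (hPD i _))
  let e : ℕ → S.I → ℝ := fun i s => ∑ k, ‖err i k s‖
  have he0 : ∀ i s, 0 ≤ e i s := fun i s => Finset.sum_nonneg fun _ _ => norm_nonneg _
  have hem : ∀ i, AEStronglyMeasurable (e i) (leb S.T) := fun i =>
    Finset.aestronglyMeasurable_fun_sum _ fun k _ => (herrm i k).norm
  have heb : ∀ i s, e i s ≤ ∑ _k : Fin (N + 1), (M + M + D) := fun i s =>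
    Finset.sum_le_sum fun k _ => herrb i k s
  set b := ∑ _k : Fin (N + 1), (M + M + D) with hbdef
  have hLe : ∀ i s, ‖L s * e i s‖ ≤ L s * b := fun i s => by
    rw [Real.norm_of_nonneg (mul_nonneg (hL0 s) (he0 i s))]
    exact mul_le_mul_of_nonneg_left (heb i s) (hL0 s)
  have hLem : ∀ i, AEStronglyMeasurable (fun s => L s * e i s) (leb S.T) := fun i =>
    hL.aestronglyMeasurable.mul (hem i)
  have hLeint : ∀ i, Integrable (fun s => L s * e i s) (leb S.T) := fun i =>
    (hL.mul_const b).mono' (hLem i) (Eventually.of_forall (hLe i))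
  have hLelim : Tendsto (fun i => ∫ s, L s * e i s ∂(leb S.T)) atTop (𝓝 0) := by
    have := tendsto_integral_of_dominated_convergence (f := fun _ => (0 : ℝ))
      (fun s => L s * b) hLem (hL.mul_const b) (fun i => Eventually.of_forall (hLe i)) ?_
    · simpa using this
    · filter_upwards [hE] with s hs
      have h := tendsto_finsetSum Finset.univ fun k (_ : k ∈ Finset.univ) => (hs k).norm
      simp only [norm_zero, Finset.sum_const_zero] at h
      simpa using h.const_mul (L s)
  -- The effect of changing the control along the fixed trajectory `x`. It vanishes where the
  -- controls agree, so absolute continuity of the integral makes it small.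
  let d : ℕ → S.I → ℝ := fun i s =>
    ‖S.f s (S.delayed x s) (αs i s) - S.f s (S.delayed x s) (α s)‖
  have hdint : ∀ i, Integrable (d i) (leb S.T) := fun i => ((h3 i).1.sub h1.1).norm
  have hdlim : Tendsto (fun i => ∫ s, d i s ∂(leb S.T)) atTop (𝓝 0) := by
    refine squeeze_zero (fun i => integral_nonneg fun _ => norm_nonneg _) (fun i => ?_)
      (hDint.tendsto_setIntegral_nhds_zero hαα)
    have hms : MeasurableSet {t | αs i t ≠ α t} :=
      (measurableSet_eq_fun (hαs i) hα).compl
    rw [← integral_indicator hms]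
    refine integral_mono_ae (hdint i) (hDint.indicator hms) ?_
    filter_upwards [h1.2, (h3 i).2] with s hs1 hs2
    by_cases hs : αs i s = α s
    · rw [indicator_of_notMem (by simpa using hs)]
      simp only [d, hs, sub_self, norm_zero, le_refl]
    · rw [indicator_of_mem (by exact hs)]
      exact (norm_sub_le _ _).trans (by linarith)
  have hbound : ∀ i, ∫ s, ‖g i s‖ ∂(leb S.T) ≤
      (1 + 2 * ∫ s, L s * weight L s ∂(leb S.T)) *
        ∫ s, (L s * e i s + d i s) ∂(leb S.T) := by
    intro i
    refine integral_norm_le_of_delay hT (h := S.h) h_nonneg hL hL0 (hgint i) (he0 i)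
      (fun _ => norm_nonneg _) ((hLeint i).add (hdint i)) ?_
    filter_upwards [hLip, hαsA i] with s hs hsA C hC hPC
    have hz : ‖S.delayed (xs i) s - S.delayed x s‖ ≤ e i s + C := by
      refine (pi_norm_le_iff_of_nonneg (add_nonneg (he0 i s) hC)).2 fun k => ?_
      have : (S.delayed (xs i) s - S.delayed x s) k = err i k s + P i (s - S.h k) :=
        (sub_add_cancel _ _).symm
      rw [this]
      refine (norm_add_le _ _).trans (add_le_add ?_ (hPC k))
      exact Finset.single_le_sum (f := fun k => ‖err i k s‖) (fun _ _ => norm_nonneg _)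
        (Finset.mem_univ k)
    rw [hgdef]
    refine (norm_sub_le_norm_sub_add_norm_sub _ (S.f s (S.delayed x s) (αs i s)) _).trans
      (add_le_add_left ?_ _)
    exact (hs _ _ (norm_delayed_le hM.le (hxsM i) s) (norm_delayed_le hM.le hxM s) _ hsA).trans
      (mul_le_mul_of_nonneg_left hz (hL0 s))
  refine squeeze_zero (fun i => integral_nonneg fun _ => norm_nonneg _) hbound ?_
  have h := (hLelim.add hdlim).const_mul (1 + 2 * ∫ s, L s * weight L s ∂(leb S.T))
  rw [add_zero, mul_zero] at h
  refine h.congr fun i => ?_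
  rw [integral_add (hLeint i) (hdint i)]

end ImpulsiveSystem

/-! ### Passage to the limit in controls and trajectories. -/

theorem signedIntegral_comp_withDensityᵥ {T : ℝ} {l : ℕ} (φ : C(Icc 0 T, ℝ))
    {θ : Measure (Icc 0 T)} {v : Icc 0 T → Fin l → ℝ} (hv : Integrable v θ) (j : Fin l) :
    signedIntegral φ (comp (θ.withDensityᵥ v) j) = (∫ t, φ t • v t ∂θ) j := by
  have h : Integrable (fun t => φ t • v t) θ :=
    hv.bdd_smul ‖φ‖ φ.continuous.aestronglyMeasurable
      (Eventually.of_forall fun t => φ.norm_coe_le_norm t)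
  rw [comp_withDensityᵥ hv, signedIntegral_withDensityᵥ φ (hv.eval j),
    eval_integral fun i => h.eval i]
  rfl

namespace ImpulsiveSystem

variable {n m q N : ℕ} {S : ImpulsiveSystem n m q N}

/-- Density of strict sense processes, for a control given by a density. -/
theorem exists_strictSense_approx (hA : S.MeasurableGraph) (hf : S.LipschitzDrift)
    (hc : S.LinearGrowth) (hG : S.MeasurableFastDynamics) (hhull : S.ContinuousHull)
    (hK0 : (0 : Fin m → ℝ) ∈ S.K) {θ : Measure S.I} [IsFiniteMeasure θ]
    {v : S.I → (Fin m → ℝ) × (Fin n → ℝ)} (hv : Integrable v θ)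
    (hvV : ∀ᵐ t ∂θ, v t ∈ S.hull t) {α : S.I → Fin q → ℝ} (hα : Measurable α)
    (hαA : ∀ᵐ t ∂(leb S.T), α t ∈ S.A t) {x : ℝ → Fin n → ℝ}
    (hx : BoundedVariationOn x (Icc (-S.hmax) S.T))
    (hxf : Integrable (fun s => S.f s (S.delayed x s) (α s)) (leb S.T))
    (hxsol : ∀ t : S.I, 0 < (t : ℝ) →
      x t = x 0 + primitive (fun s => S.f s (S.delayed x s) (α s)) t + ∫ s in Iic t, (v s).2 ∂θ)
    (hxζ : ∀ᵐ t ∂(volume.restrict (Ico (-S.hmax) 0)), x t = S.ζ t) :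
    ∃ (us : ℕ → S.I → Fin m → ℝ) (αs : ℕ → S.I → Fin q → ℝ) (xs : ℕ → ℝ → Fin n → ℝ),
      (∀ i, Integrable (us i) (leb S.T)) ∧
      (∀ i, Integrable (fun s => (S.G s (αs i s)).mulVec (us i s)) (leb S.T)) ∧
      (∀ i, S.IsStrictSenseTriple ((leb S.T).withDensityᵥ (us i)) (αs i) (xs i)) ∧
      (∀ φ : C(S.I, ℝ), Tendsto (fun i => ∫ s, φ s • us i s ∂(leb S.T)) atTop
        (𝓝 (∫ s, φ s • (v s).1 ∂θ))) ∧
      (∀ φ : C(S.I, ℝ), Tendsto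
        (fun i => ∫ s, φ s • (S.G s (αs i s)).mulVec (us i s) ∂(leb S.T)) atTop
        (𝓝 (∫ s, φ s • (v s).2 ∂θ))) ∧
      Tendsto (fun i => leb S.T {t | αs i t ≠ α t}) atTop (𝓝 0) ∧
      (∀ i (t : S.I), xs i t = xs i 0 +
        primitive (fun s => S.f s (S.delayed (xs i) s) (αs i s)) t +
        primitive (fun s => (S.G s (αs i s)).mulVec (us i s)) t) ∧
      Tendsto (fun i => ∫ s, ‖S.f s (S.delayed (xs i) s) (αs i s) -
        S.f s (S.delayed x s) (α s)‖ ∂(leb S.T)) atTop (𝓝 0) ∧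
      ∀ t : S.I, (t : ℝ) = 0 ∨ (t : ℝ) = S.T ∨ θ {t} = 0 →
        Tendsto (fun i => xs i t) atTop (𝓝 (x t)) := by
  obtain ⟨R₀, hR₀⟩ := hhull.1
  set R := max R₀ 0 with hRdef
  have hR0 : 0 ≤ R := le_max_right _ _
  have hR : ∀ t, ∀ v ∈ S.hull t, ‖v‖ ≤ R := fun t v hv => (hR₀ t v hv).trans (le_max_left _ _)
  have hvR : ∀ᵐ t ∂θ, ‖v t‖ ≤ R := hvV.mono fun t ht => hR t _ ht
  let ε : ℕ → ℝ := fun i => 1 / ((i : ℝ) + 1)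
  have hε0 : ∀ i, 0 < ε i := fun i => Nat.one_div_pos_of_nat
  have hε : Tendsto ε atTop (𝓝 0) := tendsto_one_div_add_atTop_nhds_zero_nat
  have happ := fun i => exists_absolutelyContinuous_approx hA hG hhull hK0 hR hv hvV hα hαA (hε0 i)
  choose P κ αs us hκ hκd hαs hαsA hαα husK hyint hyn hyd using happ
  have hcell : ∀ i, CellApprox θ v (fun s => (us i s, (S.G s (αs i s)).mulVec (us i s))) R (ε i) :=
    fun i => ⟨hyint i, P i, κ i, hκ i, hκd i, hyn i, hyd i⟩
  have hus : ∀ i, Integrable (us i) (leb S.T) := fun i => (hyint i).fst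
  have hGus : ∀ i, Integrable (fun s => (S.G s (αs i s)).mulVec (us i s)) (leb S.T) := fun i =>
    (hyint i).snd
  have hGB : ∀ i, ∫ s, ‖(S.G s (αs i s)).mulVec (us i s)‖ ∂(leb S.T) ≤ R * θ.real univ := fun i =>
    (integral_mono (hGus i).norm (hyint i).norm fun s => le_max_right _ _).trans
      (hcell i).integral_norm_le
  -- The mass bound for `G u` is the same for all `i`, so one `M` bounds all the trajectories.
  obtain ⟨M, hM, hxM, hex⟩ := exists_strictSenseTriple hf hc hK0 hx hxζ
    (B := R * θ.real univ) (by positivity)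
  choose xs htriple hneg hxsM hsol using fun i => hex (αs i) (us i) (hαs i) (hαsA i) (husK i)
    (hus i) (hGus i) (hGB i)
  have hααlim : Tendsto (fun i => leb S.T {t | αs i t ≠ α t}) atTop (𝓝 0) := by
    refine tendsto_of_tendsto_of_tendsto_of_le_of_le tendsto_const_nhds ?_
      (fun _ => zero_le) hαα
    simpa using ENNReal.tendsto_ofReal hε
  have hlimφ : ∀ φ : C(S.I, ℝ), Tendsto
      (fun i => ∫ s, φ s • (us i s, (S.G s (αs i s)).mulVec (us i s)) ∂(leb S.T)) atTop
      (𝓝 (∫ s, φ s • v s ∂θ)) := tendsto_integral_continuous_smul hcell hR0 hε hv hvR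
  have hφint : ∀ (φ : C(S.I, ℝ)) {μ : Measure S.I} {w : S.I → (Fin m → ℝ) × (Fin n → ℝ)},
      Integrable w μ → Integrable (fun s => φ s • w s) μ := fun φ μ w hw =>
    hw.bdd_smul ‖φ‖ φ.continuous.aestronglyMeasurable
      (Eventually.of_forall fun t => φ.norm_coe_le_norm t)
  have hlim1 : ∀ φ : C(S.I, ℝ), Tendsto (fun i => ∫ s, φ s • us i s ∂(leb S.T)) atTop
      (𝓝 (∫ s, φ s • (v s).1 ∂θ)) := fun φ => by
    have h := (continuous_fst.tendsto _).comp (hlimφ φ)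
    rw [fst_integral (hφint φ hv)] at h
    refine h.congr fun i => ?_
    rw [Function.comp_apply, fst_integral (hφint φ (hyint i))]
    rfl
  have hlim2 : ∀ φ : C(S.I, ℝ), Tendsto
      (fun i => ∫ s, φ s • (S.G s (αs i s)).mulVec (us i s) ∂(leb S.T)) atTop
      (𝓝 (∫ s, φ s • (v s).2 ∂θ)) := fun φ => by
    have h := (continuous_snd.tendsto _).comp (hlimφ φ)
    rw [snd_integral (hφint φ hv)] at h
    refine h.congr fun i => ?_
    rw [Function.comp_apply, snd_integral (hφint φ (hyint i))]
    rfl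
  have hlimt : ∀ t : S.I, θ {t} = 0 → Tendsto
      (fun i => primitive (fun s => (S.G s (αs i s)).mulVec (us i s)) t) atTop
      (𝓝 (∫ s in Iic t, (v s).2 ∂θ)) := fun t ht => by
    have h := (continuous_snd.tendsto _).comp (tendsto_setIntegral_Iic hcell hR0 hε hv hvR ht)
    rw [snd_integral hv.integrableOn] at h
    refine h.congr fun i => ?_
    rw [Function.comp_apply, snd_integral (hyint i).integrableOn]
    rfl
  have hxs0 : ∀ i, xs i 0 = x 0 := fun i => by
    have := hsol i ⟨0, le_rfl, S.T_pos.le⟩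
    rwa [primitive_zero _ rfl, primitive_zero _ rfl, add_zero, add_zero] at this
  let g : ℕ → S.I → Fin n → ℝ := fun i s =>
    S.f s (S.delayed (xs i) s) (αs i s) - S.f s (S.delayed x s) (α s)
  have hfint : ∀ i, Integrable (fun s => S.f s (S.delayed (xs i) s) (αs i s)) (leb S.T) :=
    fun i => (htriple i).1.2.2.1
  have hgint : ∀ i, Integrable (g i) (leb S.T) := fun i => (hfint i).sub hxf
  -- Subtracting the integral equations removes the drifts. Positivity of `t` is needed because at
  -- `0` the equation for `x` would count a possible jump.
  have hdiff : ∀ i (t : S.I), 0 < (t : ℝ) → xs i t - x t - primitive (g i) t =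
      primitive (fun s => (S.G s (αs i s)).mulVec (us i s)) t - ∫ s in Iic t, (v s).2 ∂θ := by
    intro i t ht
    have : primitive (g i) t = primitive (fun s => S.f s (S.delayed (xs i) s) (αs i s)) t -
        primitive (fun s => S.f s (S.delayed x s) (α s)) t :=
      integral_sub (hfint i).integrableOn hxf.integrableOn
    rw [hsol, hxsol t ht, this]
    abel
  have herr : ∀ t : S.I, (t : ℝ) = 0 ∨ (t : ℝ) = S.T ∨ θ {t} = 0 →
      Tendsto (fun i => xs i t - x t - primitive (g i) t) atTop (𝓝 0) := by
    intro t ht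
    rcases t.2.1.eq_or_lt with h0 | h0
    · refine tendsto_const_nhds.congr fun i => ?_
      rw [← h0, hxs0, primitive_zero _ h0.symm, sub_self, sub_zero]
    · refine Tendsto.congr (fun i => (hdiff i t h0).symm) ?_
      rw [← sub_self (∫ s in Iic t, (v s).2 ∂θ)]
      refine Tendsto.sub_const ?_ _
      rcases ht with ht | ht | ht
      · exact absurd ht h0.ne'
      · have huniv : Iic t = univ := by
          refine eq_univ_of_forall fun s => ?_
          rw [mem_Iic, ← Subtype.coe_le_coe, ht]
          exact s.2.2
        -- At `T` the interval `Iic t` is everything, so testing with the constant `1` works even if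
        -- `θ` has an atom there.
        have h := hlim2 1
        simp only [ContinuousMap.one_apply, one_smul] at h
        simpa only [primitive, huniv, setIntegral_univ] using h
      · exact hlimt t ht
  have hatoms : {t : ℝ | 0 < θ {a : S.I | (a : ℝ) = t}}.Countable :=
    Measure.countable_meas_level_set_pos measurable_subtype_coe
  -- For each delay, `s ↦ s - h k` is injective, so only countably many `s` are sent to atoms of
  -- `θ`.
  have hae : ∀ᵐ s : S.I ∂(leb S.T), ∀ k, ¬ 0 < θ {a : S.I | (a : ℝ) = s - S.h k} := by
    refine ae_all_iff.2 fun k => ?_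
    have h : {s : S.I | 0 < θ {a : S.I | (a : ℝ) = s - S.h k}}.Countable :=
      hatoms.preimage_of_injOn (f := fun s : S.I => (s : ℝ) - S.h k)
        fun s _ t _ hst => Subtype.ext (sub_left_injective hst)
    rw [ae_iff]
    simpa only [not_not] using h.measure_zero (leb S.T)
  have hE : ∀ᵐ s : S.I ∂(leb S.T), ∀ k, Tendsto (fun i => xs i ((s : ℝ) - S.h k) -
      x (s - S.h k) - extendBy 0 (primitive (g i)) (s - S.h k)) atTop (𝓝 0) := by
    filter_upwards [hae] with s hs k
    rcases delay_cases s (h_nonneg k) with h | ⟨r, hr, -⟩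
    · refine tendsto_const_nhds.congr fun i => ?_
      rw [hneg i _ h, extendBy_of_neg _ _ h, Pi.zero_apply, sub_self, sub_zero]
    · have hsk := hs k
      rw [hr] at hsk ⊢
      simp only [extendBy_of_mem _ _ r.2]
      refine herr r (Or.inr (Or.inr ?_))
      rw [not_lt, nonpos_iff_eq_zero] at hsk
      simpa only [Subtype.coe_inj, ofPred_eq_eq_singleton] using hsk
  have hglim : Tendsto (fun i => ∫ s, ‖g i s‖ ∂(leb S.T)) atTop (𝓝 0) :=
    tendsto_integral_norm_drift_sub hf hc hM hx (fun i => (htriple i).1.2.1) hxM hxsM hα hαs hαA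
      hαsA hααlim (fun _ _ => rfl) hE
  refine ⟨us, αs, xs, hus, hGus, htriple, hlim1, hlim2, hααlim, fun i t => ?_, hglim,
    fun t ht => ?_⟩
  · rw [hxs0]
    exact hsol i t
  · have h1 : Tendsto (fun i => primitive (g i) t) atTop (𝓝 0) :=
      squeeze_zero_norm (fun i => norm_primitive_le (hgint i) t) hglim
    have h2 := ((herr t ht).add h1).add_const (x t)
    rw [add_zero, zero_add] at h2
    exact h2.congr fun i => by abel

theorem leb_eq_tendsto {α : S.I → Fin q → ℝ} {αs : ℕ → S.I → Fin q → ℝ} (hα : Measurable α)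
    (hαs : ∀ i, Measurable (αs i))
    (h : Tendsto (fun i => leb S.T {t | αs i t ≠ α t}) atTop (𝓝 0)) :
    Tendsto (fun i => leb S.T {t | αs i t = α t}) atTop (𝓝 (ENNReal.ofReal S.T)) := by
  have h1 : ∀ i, leb S.T {t | αs i t = α t} =
      ENNReal.ofReal S.T - leb S.T {t | αs i t ≠ α t} := fun i => by
    have hms : MeasurableSet {t | αs i t ≠ α t} := (measurableSet_eq_fun (hαs i) hα).compl
    rw [← leb_univ, ← measure_compl hms (measure_ne_top _ _)]
    congr 1
    ext t
    simp
  simp only [h1]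
  have := ENNReal.Tendsto.sub (tendsto_const_nhds (x := ENNReal.ofReal S.T)) h
    (Or.inl ENNReal.ofReal_ne_top)
  rwa [tsub_zero] at this

end ImpulsiveSystem

end Impulsive

end

/-! ### The density proposition. -/

open Impulsive ImpulsiveSystem in
theorem proposition2p2 {n m q N : ℕ} (S : Impulsive.ImpulsiveSystem n m q N)
    (hA : S.MeasurableGraph) (hf : S.LipschitzDrift) (hc : S.LinearGrowth)
    (hG : S.MeasurableFastDynamics) (hhull : S.ContinuousHull)
    (μ : VectorMeasure S.I (Fin m → ℝ)) (α : S.I → Fin q → ℝ) (x : ℝ → Fin n → ℝ)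
    (hproc : S.IsImpulsiveTriple μ α x) :
    ∃ (μs : ℕ → VectorMeasure S.I (Fin m → ℝ)) (αs : ℕ → S.I → Fin q → ℝ)
      (xs : ℕ → ℝ → Fin n → ℝ),
      (∀ i, S.IsStrictSenseTriple (μs i) (αs i) (xs i)) ∧
      Impulsive.WeakStar μs μ ∧
      Tendsto (fun i => Impulsive.leb S.T {t : S.I | αs i t = α t}) atTop (𝓝 (ENNReal.ofReal S.T)) ∧
      (∃ (dxs : ℕ → VectorMeasure S.I (Fin n → ℝ)) (dx : VectorMeasure S.I (Fin n → ℝ)),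
        (∀ i, Impulsive.IsDifferential (xs i) (dxs i)) ∧ Impulsive.IsDifferential x dx ∧
        Impulsive.WeakStar dxs dx) ∧
      ∃ E : Set ℝ, E ⊆ Icc 0 S.T ∧ volume (Icc 0 S.T \ E) = 0 ∧ 0 ∈ E ∧ S.T ∈ E ∧
        ∀ t ∈ E, Tendsto (fun i => xs i t) atTop (𝓝 (x t)) := by
  obtain ⟨hcontrol, hx, hxf, hxsol, hxζ⟩ := hproc
  -- The cone condition involves positive multiples only, so `0 ∈ K` is read off from `μ ∅ = 0`.
  have hK0 : (0 : Fin m → ℝ) ∈ S.K := by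
    have := hcontrol.1 ∅ MeasurableSet.empty
    rwa [VectorMeasure.empty] at this
  obtain ⟨θ, v, hθ, hv, hvV, hvG, rfl⟩ := hcontrol.exists_density
  have hv1 : Integrable (fun t => (v t).1) θ := hv.fst
  have hv2 : Integrable (fun t => (v t).2) θ := hv.snd
  have hxsol' : ∀ t : S.I, 0 < (t : ℝ) → x t = x 0 +
      primitive (fun s => S.f s (S.delayed x s) (α s)) t + ∫ s in Iic t, (v s).2 ∂θ := by
    intro t ht
    rw [hxsol t ht, integralAgainst_withDensityᵥ hv1 _ measurableSet_Iic]
    simp only [hvG]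
    rfl
  obtain ⟨us, αs, xs, hus, hGus, htriple, hlim1, hlim2, hαlim, hsol, hglim, hxlim⟩ :=
    exists_strictSense_approx hA hf hc hG hhull hK0 hv hvV hcontrol.2.1 hcontrol.2.2.1 hx hxf
      hxsol' hxζ
  have hfint := fun i => (htriple i).1.2.2.1
  refine ⟨fun i => (leb S.T).withDensityᵥ (us i), αs, xs, htriple, fun φ j => ?_,
    leb_eq_tendsto hcontrol.2.1 (fun i => (htriple i).1.1.2.1) hαlim,
    ⟨fun i => (leb S.T).withDensityᵥ (fun s => S.f s (S.delayed (xs i) s) (αs i s)) +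
        (leb S.T).withDensityᵥ (fun s => (S.G s (αs i s)).mulVec (us i s)),
      (leb S.T).withDensityᵥ (fun s => S.f s (S.delayed x s) (α s)) +
        θ.withDensityᵥ (fun s => (v s).2), fun i t _ => ?_, fun t ht => ?_, fun φ j => ?_⟩, ?_⟩
  · rw [signedIntegral_comp_withDensityᵥ φ hv1]
    simp only [signedIntegral_comp_withDensityᵥ φ (hus _)]
    exact ((continuous_apply j).tendsto _).comp (hlim1 φ)
  · rw [_root_.add_apply, withDensityᵥ_apply (hfint i) measurableSet_Iic,
      withDensityᵥ_apply (hGus i) measurableSet_Iic, ← add_assoc]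
    exact hsol i t
  · rw [_root_.add_apply, withDensityᵥ_apply hxf measurableSet_Iic,
      withDensityᵥ_apply hv2 measurableSet_Iic, ← add_assoc]
    exact hxsol' t ht
  · simp only [comp_add, signedIntegral_add, signedIntegral_comp_withDensityᵥ φ (hfint _),
      signedIntegral_comp_withDensityᵥ φ (hGus _), signedIntegral_comp_withDensityᵥ φ hxf,
      signedIntegral_comp_withDensityᵥ φ hv2]
    -- The `G` parts converge weak*, while the drift parts converge even in `L¹`.
    refine Tendsto.add ?_ (((continuous_apply j).tendsto _).comp (hlim2 φ))
    refine ((continuous_apply j).tendsto _).comp ?_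
    rw [tendsto_iff_norm_sub_tendsto_zero]
    have hφint : ∀ {w : S.I → Fin n → ℝ}, Integrable w (leb S.T) →
        Integrable (fun s => φ s • w s) (leb S.T) := fun hw =>
      hw.bdd_smul ‖φ‖ φ.continuous.aestronglyMeasurable
        (Eventually.of_forall fun t => φ.norm_coe_le_norm t)
    refine squeeze_zero (fun i => norm_nonneg _) (fun i => ?_)
      (by simpa using hglim.const_mul ‖φ‖)
    rw [← integral_sub (hφint (hfint i)) (hφint hxf), ← integral_const_mul]
    refine norm_integral_le_of_norm_le (((hfint i).sub hxf).norm.const_mul _)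
      (Eventually.of_forall fun s => ?_)
    rw [← smul_sub, norm_smul]
    exact mul_le_mul_of_nonneg_right (φ.norm_coe_le_norm s) (norm_nonneg _)
  · refine ⟨{t | t ∈ Icc 0 S.T ∧ (t = 0 ∨ t = S.T ∨ ¬ 0 < θ {a : S.I | (a : ℝ) = t})},
      fun t ht => ht.1, ?_, ⟨⟨le_rfl, S.T_pos.le⟩, Or.inl rfl⟩,
      ⟨⟨S.T_pos.le, le_rfl⟩, Or.inr (Or.inl rfl)⟩, ?_⟩
    · have hatoms : {t : ℝ | 0 < θ {a : S.I | (a : ℝ) = t}}.Countable :=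
        Measure.countable_meas_level_set_pos measurable_subtype_coe
      refine measure_mono_null (fun t ht => ?_) (hatoms.measure_zero volume)
      by_contra h
      exact ht.2 ⟨ht.1, Or.inr (Or.inr h)⟩
    · rintro t ⟨ht, h⟩
      refine hxlim ⟨t, ht⟩ (h.imp_right (Or.imp_right fun h => ?_))
      rw [not_lt, nonpos_iff_eq_zero] at h
      convert h using 2
      ext a
      simp [Subtype.ext_iff]
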